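/- Let $a_1,a_2,a_3$ be positive odd integers, let $X$ be the complement in $S^3$ of an open tubular neighborhood of the pretzel knot $P(a_1,a_2,a_3)$ (with the chirality for which $P(1,1,1)$ is the right-handed trefoil), and let $X_{m/l}$ be the closed 3-manifold obtained from $S^3$ by $\frac{m}{l}$-surgery along $P(a_1,a_2,a_3)$; that is, a solid torus is glued to $X$ along the boundary so that its meridian is identified with a curve of class $\mu^m\lambda^l$, where $\mu$ is a meridian and $\lambda$ the canonical longitude of the knot. Then for each rational number $\frac{m}{l}\in(-\infty,0)\cup(0,1)$ ($m,l$ coprime integers) there exists a representation $\rho:\pi_1(X_{m/l})\to\mathrm{SL}_2(\mathbb R)$ such that the induced representation $\rho|_{\pi_1(\partial X)}:\pi_1(\partial X)\cong\mathbb Z^2\to\mathrm{SL}_2(\mathbb R)$ (composition with $\pi_1(\partial X)\to\pi_1(X_{m/l})$) is elliptic, i.e. its image contains an element whose trace lies in $(-2,2)$. -/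

import Mathlib

open Complex (I)
open scoped Real MatrixGroups ComplexConjugate

noncomputable section

namespace PretzelSurgery

/-! The `3`-sphere is the one-point compactification of `ℝ³ = ℂ × ℝ`; a point `(ζ, z)` has
horizontal coordinate `ζ = x + i y` and height `z`, and `(x, y, z)` is the standard orientation. -/

/-- Tubular neighbourhood of an ascending strand of the `k`-th twisted band, `0 ≤ t ≤ 1`. The band
stands on the vertical axis `ζ = 4 k` between the heights `0` and `1` and makes `n` left-handed
half-twists on the way up; for odd `n` its strand goes from the lower left corner `4 k - 1` to the
upper right corner `4 k + 1`. The number `w` of the closed unit disc is the coordinate on the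
horizontal cross-section, a disc of radius `1 / 4`; `w = 0` is the strand itself, `w = 1` is pushed
from the strand into the band. -/
def strand (n : ℕ) (k : Fin 3) (t : ℝ) (w : ℂ) : ℂ × ℝ :=
  (4 * ((k : ℕ) : ℂ) - (1 - w / 4) * Complex.exp (-(π * n * t : ℝ) * I), t)

/-- Tubular neighbourhood of the semicircle over the bands (in the plane `y = 0`, above the height
`1`) that joins the upper right corner of the `k`-th band to the upper left corner of the next one
(cyclically, the band `0` comes after the band `2`), `0 ≤ t ≤ 1`. It is swept out by a disc of
radius `1 / 4` that makes half a turn about the horizontal axis `x = c`, `z = 1`. -/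
def arc (k : Fin 3) (t : ℝ) (w : ℂ) : ℂ × ℝ :=
  let c : ℝ := 2 * ((k : ℕ) : ℝ) + 2 * (((k + 1 : Fin 3) : ℕ) : ℝ)
  let u : ℝ := 4 * ((k : ℕ) : ℝ) + 1 - w.re / 4 - c
  (⟨c + u * Real.cos (π * t), -(w.im / 4)⟩, 1 + |u| * Real.sin (π * t))

/-- The rotation of `ℝ³` by the angle `π` about the axis `y = 0`, `z = 1 / 2`. -/
def halfTurn (x : ℂ × ℝ) : ℂ × ℝ := (conj x.1, 1 - x.2)

/-- Parametrized closed tubular neighbourhood of the pretzel knot `P(a 0, a 1, a 2)`, all `a i`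
odd: `s ∈ ℝ / ℤ` is the coordinate along the knot and `w` that on the closed unit disc. The core
`w = 0` is the pretzel knot: three vertical bands, with `a 0`, `a 1`, `a 2` left-handed half-twists,
whose edges are joined by arcs above and below, neighbouring bands cyclically. The knot runs six
times through a band and a following arc, alternately upwards and downwards; the image of a band,
with its ascending strand, under the half-turn is the band with its other strand, descending.

The curve `w = 1` lies on the spanning surface of the knot that consists of the three bands and a
disc above and a disc below them, so it is the canonical longitude; the curves `s = const`,
`‖w‖ = 1` are meridians, of linking number `+1` with the knot for increasing argument of `w`.
With these conventions `P(1, 1, 1)` is the right-handed trefoil. -/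
def pretzelTube (a : Fin 3 → ℕ) (s : ℝ) (w : ℂ) : ℂ × ℝ :=
  let j : ℤ := ⌊6 * s⌋
  let t : ℝ := 2 * Int.fract (6 * s)
  let k : Fin 3 := Fin.ofNat 3 (j % 3).toNat
  let x : ℂ × ℝ := if t ≤ 1 then strand (a k) k t w else arc k (t - 1) w
  if Even j then x else halfTurn x

/-! In the following definitions `N : ℝ → ℂ → ℂ × ℝ` is a parametrized tubular neighbourhood of a
knot: `N s w` has period `1` in `s`, and the second variable is used in the closed unit disc. -/

/-- The exterior `X` of the knot: the complement in `S³` of the open tubular neighbourhood. -/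
def exterior (N : ℝ → ℂ → ℂ × ℝ) : Set (OnePoint (ℂ × ℝ)) :=
  {x | ∀ (s : ℝ) (w : ℂ), ‖w‖ < 1 → x ≠ ((N s w : ℂ × ℝ) : OnePoint (ℂ × ℝ))}

/-- The boundary torus `∂X` of the exterior. -/
def boundaryTorus (N : ℝ → ℂ → ℂ × ℝ) : Set (exterior N) :=
  {x | ∃ (s : ℝ) (w : ℂ), ‖w‖ = 1 ∧
    (x : OnePoint (ℂ × ℝ)) = ((N s w : ℂ × ℝ) : OnePoint (ℂ × ℝ))}

/-- The solid torus `S¹ × D²`. -/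
abbrev SolidTorus : Type := Circle × Metric.closedBall (0 : ℂ) 1

/-- Identification of the boundary of the solid torus with `∂X`: the point with angular coordinates
`(α, β)` (in full turns, `α` along the core and `β` along the boundary of the disc) is glued to the
point of `∂X` with longitude coordinate `l β + q α` and meridian coordinate `m β + p α`. So the
boundary of a meridian disc of the solid torus is glued to a curve of the class `m μ + l λ`, where
`μ` is the meridian and `λ` the longitude `w = 1`. For `l p - m q = 1` this is a homeomorphism of
the two tori. -/
inductive Glue (N : ℝ → ℂ → ℂ × ℝ) (m l p q : ℤ) :
    exterior N ⊕ SolidTorus → exterior N ⊕ SolidTorus → Prop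
  | glue (α β : ℝ) (x : exterior N) (v : SolidTorus)
      (hx : (x : OnePoint (ℂ × ℝ)) =
        ((N (l * β + q * α) (Complex.exp (2 * π * (m * β + p * α) * I)) : ℂ × ℝ) :
          OnePoint (ℂ × ℝ)))
      (hv₁ : v.1 = Circle.exp (2 * π * α))
      (hv₂ : (v.2 : ℂ) = Complex.exp (2 * π * β * I)) :
      Glue N m l p q (Sum.inl x) (Sum.inr v)

/-- The closed manifold `X_{m/l}` obtained by `m/l`-surgery, with the quotient topology: the
exterior and a solid torus are glued along their boundaries. Up to homeomorphism it depends on `m`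
and `l` only, not on the choice of `p` and `q` with `l p - m q = 1`. -/
abbrev DehnSurgery (N : ℝ → ℂ → ℂ × ℝ) (m l p q : ℤ) : Type := Quot (Glue N m l p q)

/-- The inclusion of `∂X` into `X_{m/l}`. -/
def boundaryInclusion (N : ℝ → ℂ → ℂ × ℝ) (m l p q : ℤ) :
    C(boundaryTorus N, DehnSurgery N m l p q) where
  toFun x := Quot.mk _ (Sum.inl x.1)
  continuous_toFun :=
    continuous_quot_mk.comp (continuous_inl.comp continuous_subtype_val)

/-- An element of `SL₂(ℝ)` is elliptic if its trace lies in `(-2, 2)`. -/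
def IsElliptic (g : SL(2, ℝ)) : Prop := (g : Matrix (Fin 2) (Fin 2) ℝ).trace ∈ Set.Ioo (-2) 2

/-- A representation in `SL₂(ℝ)` is elliptic if its image contains an elliptic element. -/
def IsEllipticRep {H : Type*} [Group H] (ρ : H →* SL(2, ℝ)) : Prop :=
  ∃ g ∈ ρ.range, IsElliptic g

end PretzelSurgery

end

/-! The representation is the holonomy of a flat structure, built by hand on the surgered manifold.

*Topology.* A flat structure on the knot complement is given by gauges on open sets, i.e. functions
to the group `G` whose quotients are locally constant. The plane `y = 0` of the pretzel diagram is
cut by the knot into three holes and two discs of the spanning surface; the gauge of a region is `1`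
in front of the plane and the label of the region behind it. Near a twisted band one uses a frame
that rotates with the band. The gauges fit together if the labels satisfy one relation for each
band, which defines a `Labelling` (`exists_isPretzelAtlas`). Following the boundary torus through
the charts gives the holonomy of longitude and meridian as words in the labels
(`exists_torus_primitive`). If the word `λ ^ l μ ^ m` is trivial, the flat structure extends over
the discs of the glued-in solid torus (`exists_surgeryAtlas`), and its holonomy is the
representation (`exists_rep_of_labelling`).

*Algebra.* In `SL₂(ℝ)` take three half-turns of the hyperbolic plane about points at the same
distance from a centre, this distance being measured by `ρ`, and multiply each by the rotation by
`2 ω` about the centre. Let `2 ψ k` be the angles under which consecutive points are seen from the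
centre. The relation of the `k`-th band becomes the single equation `tan (ψ k) * U k / V k = tan ω`,
where `U k` and `V k` are the polynomials `chebyshev` in `ρ ^ 2 * sin (ψ k) ^ 2`. Then the meridian
and the longitude are, up to sign and a common conjugation, in one elliptic one-parameter group,
with angles `θ` and `π - 2 * (η 0 + η 1 + η 2)` (`exists_labelling`), where
`cos θ = √(1 + ρ ^ 2) * sin ω` and `tan (η k) = U k / V k * tan θ`.

*Analysis.* The left-hand side of the equation of a band is strictly increasing in `ψ k`, so that
for every `ρ` there are unique `ω` and `ψ` with `ψ 0 + ψ 1 + ψ 2 = π`, and they depend continuously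
on `ρ` (`exists_tangents`). The angle `F = m * θ + l * (π - 2 * (η 0 + η 1 + η 2))` of `λ ^ l μ ^ m`
is `m * θ` with `0 < θ < π / 2` at `ρ = 0`, where the longitude is trivial. Where the meridian is
not elliptic, `θ` is clamped to `0` and `F` equals `l * π`; this is the case at `ρ = 1`. If `l > 0`
and `m / l` lies in `(-∞, 0)` or `(0, 1)`, then `F` takes the value `j * π` with `j = 0` or
`j = l - 1` in between, where the meridian is still elliptic. The sign `(-1) ^ j` is absorbed in the
sign of the meridian (`exists_labelling_of_slope`). -/

open Filter Topology

noncomputable section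

namespace PretzelSurgery

/-! ### Flat structures and their holonomy -/

/-- A flat `G`-structure on the part of a space `Y` covered by the charts, that is, a principal
bundle with discrete structure group, given by a gauge on each chart: the quotients of any two
gauges are locally constant, while the gauges themselves need not be continuous. -/
structure FlatAtlas (G : Type*) [Group G] (Y : Type*) [TopologicalSpace Y] (ι : Type*) where
  /-- the charts -/
  chart : ι → Set Y
  isOpen_chart : ∀ i, IsOpen (chart i)
  /-- the gauges -/
  gauge : ι → Y → G
  locConst : ∀ i j x, x ∈ chart i → x ∈ chart j →
    ∀ᶠ y in 𝓝 x, gauge i y * (gauge j y)⁻¹ = gauge i x * (gauge j x)⁻¹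

namespace FlatAtlas

variable {G : Type*} [Group G] {Y Z Z' : Type*} [TopologicalSpace Y] [TopologicalSpace Z]
  [TopologicalSpace Z'] {ι : Type*} (A : FlatAtlas G Y ι)

/-- `P` is a primitive of the map `φ` if it differs from each gauge along `φ` by a locally constant
left factor, as the values of a flat section do. -/
def IsPrimitive (φ : Z → Y) (P : Z → G) : Prop :=
  ∀ z i, φ z ∈ A.chart i →
    ∀ᶠ z' in 𝓝 z, P z' * (A.gauge i (φ z'))⁻¹ = P z * (A.gauge i (φ z))⁻¹

variable {A}

lemma IsPrimitive.comp {φ : Z → Y} {P : Z → G} (h : A.IsPrimitive φ P) {c : Z' → Z}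
    (hc : Continuous c) : A.IsPrimitive (φ ∘ c) (P ∘ c) := fun z i hi =>
  hc.continuousAt.eventually (h (c z) i hi)

lemma IsPrimitive.const_mul {φ : Z → Y} {P : Z → G} (h : A.IsPrimitive φ P) (g : G) :
    A.IsPrimitive φ (fun z => g * P z) := fun z i hi => by
  filter_upwards [h z i hi] with z' hz'
  rw [mul_assoc, hz', mul_assoc]

/-- Two primitives of the same map on a preconnected space differ by a constant left factor. -/
lemma IsPrimitive.mul_inv_eq [PreconnectedSpace Z] {φ : Z → Y} {P Q : Z → G}
    (hA : ∀ z, ∃ i, φ z ∈ A.chart i) (hP : A.IsPrimitive φ P) (hQ : A.IsPrimitive φ Q) (z z' : Z) :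
    P z * (Q z)⁻¹ = P z' * (Q z')⁻¹ := by
  have : IsLocallyConstant fun z => P z * (Q z)⁻¹ := by
    rw [IsLocallyConstant.iff_eventually_eq]
    intro z
    obtain ⟨i, hi⟩ := hA z
    filter_upwards [hP z i hi, hQ z i hi] with y h1 h2
    calc P y * (Q y)⁻¹ = (P y * (A.gauge i (φ y))⁻¹) * (Q y * (A.gauge i (φ y))⁻¹)⁻¹ := by group
      _ = _ := by rw [h1, h2]; group
  exact this.apply_eq_of_preconnectedSpace z z'

lemma IsPrimitive.inv_mul_eq [PreconnectedSpace Z] {φ : Z → Y} {P Q : Z → G}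
    (hA : ∀ z, ∃ i, φ z ∈ A.chart i) (hP : A.IsPrimitive φ P) (hQ : A.IsPrimitive φ Q) (z z' : Z) :
    (P z)⁻¹ * P z' = (Q z)⁻¹ * Q z' := by
  have h := hP.mul_inv_eq hA hQ z z'
  have : P z' = (P z * (Q z)⁻¹) * Q z' := by rw [h]; group
  rw [this]; group

/-- The flat bundle, with discrete fibre `G`, of an atlas. -/
def bundle [TopologicalSpace G] [DiscreteTopology G] (A : FlatAtlas G Y ι)
    (hA : ∀ y, ∃ i, y ∈ A.chart i) : FiberBundleCore ι Y G where
  baseSet := A.chart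
  isOpen_baseSet := A.isOpen_chart
  indexAt y := (hA y).choose
  mem_baseSet_at y := (hA y).choose_spec
  coordChange i j y g := g * (A.gauge i y * (A.gauge j y)⁻¹)
  coordChange_self i y _ g := by group
  continuousOn_coordChange i j := by
    rintro ⟨y, g⟩ ⟨⟨hi, hj⟩, -⟩
    refine ContinuousAt.continuousWithinAt ?_
    rw [ContinuousAt, nhds_discrete G, tendsto_pure, nhds_prod_eq, nhds_discrete G]
    filter_upwards [(A.locConst i j y hi hj).prod_inl (pure g),
      (eventually_pure.2 (rfl : g = g) : ∀ᶠ x in pure g, x = g).prod_inr (𝓝 y)] with p h1 h2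
    rw [h1, h2]
  coordChange_comp i j k y _ g := by group

/-- Maps of simply connected spaces to a space with a flat structure have primitives: they are
lifts to the total space of the bundle, which is a covering. -/
lemma exists_isPrimitive [SimplyConnectedSpace Z] [LocallyPathConnectedSpace Z]
    (hA : ∀ y, ∃ i, y ∈ A.chart i) (φ : C(Z, Y)) (z₀ : Z) :
    ∃ P : Z → G, P z₀ = 1 ∧ A.IsPrimitive φ P := by
  let _ : TopologicalSpace G := ⊥
  have _ : DiscreteTopology G := ⟨rfl⟩
  set B := A.bundle hA with hB
  have cov : IsCoveringMap B.proj := IsFiberBundle.isCoveringMap fun y =>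
    ⟨B.localTriv (B.indexAt y), B.mem_baseSet_at y⟩
  obtain ⟨F, ⟨hF0, hF⟩, -⟩ := cov.existsUnique_continuousMap_lifts φ z₀
    (⟨φ z₀, (1 : G)⟩ : B.TotalSpace) rfl
  have hF' : ∀ z, (F z).1 = φ z := fun z => congrFun hF z
  let fib : Z → G := fun z => (F z).2
  let P : Z → G := fun z => fib z * A.gauge (B.indexAt (φ z)) (φ z)
  have hP : A.IsPrimitive φ P := by
    intro z i hi
    have key : ∀ z, P z * (A.gauge i (φ z))⁻¹ = (B.localTriv i (F z)).2 := by
      intro z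
      have h2 : (B.localTriv i (F z)).2 = fib z *
          (A.gauge (B.indexAt (φ z)) (φ z) * (A.gauge i (φ z))⁻¹) := by
        rw [← hF' z]
        rfl
      rw [h2, ← mul_assoc]
    simp only [key]
    have hc : ContinuousAt (fun z => (B.localTriv i (F z)).2) z := by
      refine continuous_snd.continuousAt.comp (ContinuousAt.comp ?_ F.continuous.continuousAt)
      refine (B.localTriv i).continuousAt ?_
      rw [B.mem_localTriv_source, hF' z]
      exact hi
    rw [ContinuousAt, nhds_discrete G, tendsto_pure] at hc
    exact hc
  exact ⟨fun z => (P z₀)⁻¹ * P z, by simp, hP.const_mul _⟩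

/-- Pull-back of a flat structure. -/
def comap (A : FlatAtlas G Y ι) (φ : C(Z, Y)) : FlatAtlas G Z ι where
  chart i := φ ⁻¹' A.chart i
  isOpen_chart i := (A.isOpen_chart i).preimage φ.continuous
  gauge i := A.gauge i ∘ φ
  locConst i j _ hi hj := φ.continuous.continuousAt.eventually (A.locConst i j _ hi hj)

/-- The charts need to cover the image of the map only. -/
lemma exists_isPrimitive_of_forall_mem [SimplyConnectedSpace Z] [LocallyPathConnectedSpace Z]
    (φ : C(Z, Y)) (hφ : ∀ z, ∃ i, φ z ∈ A.chart i) (z₀ : Z) :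
    ∃ P : Z → G, P z₀ = 1 ∧ A.IsPrimitive φ P :=
  exists_isPrimitive (A := A.comap φ) hφ (ContinuousMap.id Z) z₀

/-- Functions whose quotients are locally constant on a dense set `D` are the gauges of a flat
structure, after a change of their values outside `D`. -/
lemma exists_of_dense {U : ι → Set Y} (hU : ∀ i, IsOpen (U i)) {D : Set Y} (hD : Dense D)
    (f : ι → Y → G)
    (h : ∀ i j x, x ∈ U i → x ∈ U j → ∃ g, ∀ᶠ y in 𝓝[D] x, f i y = g * f j y) :
    ∃ A : FlatAtlas G Y ι, A.chart = U ∧ ∀ i j x g, x ∈ U i → x ∈ U j →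
      (∀ᶠ y in 𝓝[D] x, f i y = g * f j y) → A.gauge i x * (A.gauge j x)⁻¹ = g := by
  classical
  have hne : ∀ x, (𝓝[D] x).NeBot := fun x => mem_closure_iff_nhdsWithin_neBot.1 (hD x)
  let T : ι → ι → Y → G := fun i j x =>
    if h : ∃ g, ∀ᶠ y in 𝓝[D] x, f i y = g * f j y then h.choose else 1
  have hT : ∀ i j x g, (∀ᶠ y in 𝓝[D] x, f i y = g * f j y) → T i j x = g := by
    intro i j x g hg
    have hex : ∃ g, ∀ᶠ y in 𝓝[D] x, f i y = g * f j y := ⟨g, hg⟩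
    have h1 : T i j x = hex.choose := dif_pos hex
    have := hne x
    obtain ⟨y, h2, h3⟩ := (hex.choose_spec.and hg).exists
    rw [h1]
    exact mul_right_cancel (h2.symm.trans h3)
  let gauge : ι → Y → G := fun i x => if h : ∃ k, x ∈ U k then T i h.choose x else 1
  have key : ∀ i j x g, x ∈ U i → x ∈ U j → (∀ᶠ y in 𝓝[D] x, f i y = g * f j y) →
      gauge i x * (gauge j x)⁻¹ = g := by
    intro i j x g hi hj hg
    have hex : ∃ k, x ∈ U k := ⟨i, hi⟩
    obtain ⟨a, ha⟩ := h i hex.choose x hi hex.choose_spec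
    obtain ⟨b, hb⟩ := h j hex.choose x hj hex.choose_spec
    have e1 : gauge i x = a := by simp only [gauge, dif_pos hex]; exact hT _ _ _ _ ha
    have e2 : gauge j x = b := by simp only [gauge, dif_pos hex]; exact hT _ _ _ _ hb
    have := hne x
    obtain ⟨y, h1, h2, h3⟩ := (ha.and (hb.and hg)).exists
    rw [h1, h2, ← mul_assoc] at h3
    rw [e1, e2, mul_right_cancel h3]
    group
  refine ⟨⟨U, hU, gauge, fun i j x hi hj => ?_⟩, rfl, key⟩
  obtain ⟨g, hg⟩ := h i j x hi hj
  filter_upwards [(hU i).mem_nhds hi, (hU j).mem_nhds hj,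
    eventually_nhds_nhdsWithin.2 hg] with y hyi hyj hy
  rw [key i j y g hyi hyj hy, key i j x g hi hj hg]

/-- The holonomy of a path: the quotient of the end values of a primitive along it. -/
def holonomy (hA : ∀ y, ∃ i, y ∈ A.chart i) {x y : Y} (γ : Path x y) : G :=
  (exists_isPrimitive hA ⟨γ.extend, γ.continuous_extend⟩ (0 : ℝ)).choose 1

variable (hA : ∀ y, ∃ i, y ∈ A.chart i)

lemma holonomy_eq {x y : Y} (γ : Path x y) {P : ℝ → G} (hP : A.IsPrimitive γ.extend P) :
    holonomy hA γ = (P 0)⁻¹ * P 1 := by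
  have h := (exists_isPrimitive hA ⟨γ.extend, γ.continuous_extend⟩ (0 : ℝ)).choose_spec
  rw [← IsPrimitive.inv_mul_eq (fun z => hA _) h.2 hP 0 1, h.1, inv_one, one_mul]
  rfl

lemma holonomy_refl (x : Y) : holonomy hA (Path.refl x) = 1 := by
  rw [holonomy_eq hA (P := fun _ => 1), inv_one, one_mul]
  intro z i _
  exact Eventually.of_forall fun z' => by simp

lemma holonomy_trans {x y z : Y} (γ : Path x y) (γ' : Path y z) :
    holonomy hA (γ.trans γ') = holonomy hA γ * holonomy hA γ' := by
  obtain ⟨P, -, hP⟩ := exists_isPrimitive hA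
    ⟨(γ.trans γ').extend, (γ.trans γ').continuous_extend⟩ (0 : ℝ)
  let c : ℝ → ℝ := fun t => (Set.projIcc (0:ℝ) 1 zero_le_one t : ℝ) / 2
  have hc : Continuous c := by fun_prop
  have h1 : A.IsPrimitive γ.extend (P ∘ c) := by
    have := hP.comp hc
    convert this using 1
    funext t
    simp only [Function.comp_apply, ContinuousMap.coe_mk, c]
    have ht := (Set.projIcc (0:ℝ) 1 zero_le_one t).2
    symm
    rw [Path.extend_apply _ ⟨by linarith [ht.1], by linarith [ht.2]⟩, Path.trans_apply]
    simp only
    rw [dif_pos (by linarith [ht.2])]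
    change _ = γ (Set.projIcc 0 1 zero_le_one t)
    congr 1
    ext
    simp only
    ring
  have h2 : A.IsPrimitive γ'.extend (P ∘ fun t => c t + 1/2) := by
    have := hP.comp (hc.add_const (1/2))
    convert this using 1
    funext t
    simp only [Function.comp_apply, ContinuousMap.coe_mk, c]
    have ht := (Set.projIcc (0:ℝ) 1 zero_le_one t).2
    symm
    rw [Path.extend_apply _ ⟨by linarith [ht.1], by linarith [ht.2]⟩, Path.trans_apply]
    simp only
    split_ifs with h
    · have h0 : (Set.projIcc (0:ℝ) 1 zero_le_one t : ℝ) = 0 := by linarith [ht.1]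
      have h1 : (⟨2 * ((Set.projIcc (0:ℝ) 1 zero_le_one t : ℝ) / 2 + 1 / 2), by
        rw [h0]; norm_num⟩ : unitInterval) = 1 := by ext; simp [h0]
      rw [h1, γ.target]
      change _ = γ' (Set.projIcc 0 1 zero_le_one t)
      have h2 : Set.projIcc (0:ℝ) 1 zero_le_one t = 0 := by ext; simpa using h0
      rw [h2, γ'.source]
    · change _ = γ' (Set.projIcc 0 1 zero_le_one t)
      congr 1
      ext
      simp
      ring
  rw [holonomy_eq hA _ hP, holonomy_eq hA _ h1, holonomy_eq hA _ h2]
  have e0 : c 0 = 0 := by simp [c]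
  have e1 : c 1 = 1/2 := by simp [c]
  simp only [Function.comp_apply, e0, e1]
  rw [zero_add, show (1 / 2 + 1 / 2 : ℝ) = 1 by norm_num]
  group

lemma holonomy_congr {x y : Y} {γ γ' : Path x y} (h : γ.Homotopic γ') :
    holonomy hA γ = holonomy hA γ' := by
  obtain ⟨H⟩ := h
  let pr := Set.projIcc (0:ℝ) 1 zero_le_one
  have hpr : Continuous pr := continuous_projIcc
  let Φ : C(ℝ × ℝ, Y) := ⟨fun p => H (pr p.1, pr p.2), by fun_prop⟩
  obtain ⟨P, -, hP⟩ := exists_isPrimitive hA Φ 0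
  have p0 : pr 0 = 0 := by simp [pr]
  have p1 : pr 1 = 1 := by simp [pr]
  have h0 : A.IsPrimitive γ.extend (P ∘ fun t => ((0:ℝ), t)) := by
    convert hP.comp (c := fun t => ((0:ℝ), t)) (by fun_prop) using 1
    funext t
    simp [Φ, Path.extend, Set.IccExtend, pr]
  have h1 : A.IsPrimitive γ'.extend (P ∘ fun t => ((1:ℝ), t)) := by
    convert hP.comp (c := fun t => ((1:ℝ), t)) (by fun_prop) using 1
    funext t
    simp [Φ, Path.extend, Set.IccExtend, pr]
  have key : ∀ b : ℝ, pr b = 0 ∨ pr b = 1 → P (0, b) = P (1, b) := by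
    intro b hb
    have hs : A.IsPrimitive (Φ ∘ fun s => (s, b)) (P ∘ fun s : ℝ => (s, b)) :=
      hP.comp (by fun_prop)
    have hs' : A.IsPrimitive (Φ ∘ fun s : ℝ => (s, b)) (fun _ => 1) := by
      intro z i _
      refine Eventually.of_forall fun z' => ?_
      have : Φ (z', b) = Φ (z, b) := by
        rcases hb with hb | hb <;> simp [Φ, hb]
      simp [this]
    have := hs.inv_mul_eq (fun z => hA _) hs' 0 1
    simpa [inv_mul_eq_one] using this
  rw [holonomy_eq hA _ h0, holonomy_eq hA _ h1]
  simp only [Function.comp_apply]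
  rw [key 0 (Or.inl p0), key 1 (Or.inr p1)]

/-- The holonomy representation. The product in `FundamentalGroup` runs along the second factor
first, hence the inverse. -/
def holonomyRep (x : Y) : FundamentalGroup Y x →* G where
  toFun γ := Quotient.lift (fun γ : Path x x => (holonomy hA γ)⁻¹)
    (fun _ _ h => congrArg _ (holonomy_congr hA h)) γ
  map_one' := by
    change (holonomy hA (Path.refl x))⁻¹ = 1
    rw [holonomy_refl, inv_one]
  map_mul' p q := by
    induction p using Quotient.inductionOn with | _ p => ?_
    induction q using Quotient.inductionOn with | _ q => ?_
    change (holonomy hA (q.trans p))⁻¹ = _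
    rw [holonomy_trans, mul_inv_rev]
    rfl

lemma holonomyRep_mk (x : Y) (γ : Path x x) :
    holonomyRep hA x (FundamentalGroup.fromPath (Path.Homotopic.Quotient.mk γ)) =
      (holonomy hA γ)⁻¹ := rfl

end FlatAtlas

/-! ### Coordinates near the bands -/

/-- The distance of the height `z` to the interval `[0, 1]` of heights of the bands. -/
def gap (z : ℝ) : ℝ := max (z - 1) (max (-z) 0)

lemma continuous_gap : Continuous gap := by unfold gap; fun_prop

lemma gap_nonneg (z : ℝ) : 0 ≤ gap z := le_max_of_le_right (le_max_right _ _)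

lemma gap_of_one_le {z : ℝ} (h : 1 ≤ z) : gap z = z - 1 := by
  unfold gap
  rw [max_eq_right (by linarith : -z ≤ 0), max_eq_left (by linarith)]

lemma gap_of_mem {z : ℝ} (h₀ : 0 ≤ z) (h₁ : z ≤ 1) : gap z = 0 := by
  unfold gap
  rw [max_eq_right (by linarith : -z ≤ 0), max_eq_right (by linarith)]

lemma gap_pos {z : ℝ} (h : ¬ (0 ≤ z ∧ z ≤ 1)) : 0 < gap z := by
  unfold gap
  by_cases h0 : 0 ≤ z
  · exact lt_max_of_lt_left (by linarith [lt_of_not_ge fun h1 => h ⟨h0, h1⟩])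
  · exact lt_max_of_lt_right (lt_max_of_lt_left (by linarith))

/-- The height, clamped to the interval `[0, 1]`. -/
def clamp (z : ℝ) : ℝ := max 0 (min z 1)

lemma continuous_clamp : Continuous clamp := by unfold clamp; fun_prop

lemma clamp_of_one_le {z : ℝ} (h : 1 ≤ z) : clamp z = 1 := by
  simp [clamp, min_eq_right h]

lemma clamp_of_nonpos {z : ℝ} (h : z ≤ 0) : clamp z = 0 := by
  unfold clamp
  rw [min_eq_left (by linarith), max_eq_left h]

lemma clamp_of_mem {z : ℝ} (h₀ : 0 ≤ z) (h₁ : z ≤ 1) : clamp z = z := by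
  simp [clamp, min_eq_left h₁, h₀]

/-- Horizontal coordinate relative to the axis of the `k`-th band. -/
def rel (k : Fin 3) (x : ℂ × ℝ) : ℂ := x.1 - 4 * ((k : ℕ) : ℂ)

lemma continuous_rel (k : Fin 3) : Continuous (rel k) := by unfold rel; fun_prop

lemma rel_re (k : Fin 3) (x : ℂ × ℝ) : (rel k x).re = x.1.re - 4 * ((k : ℕ) : ℝ) := by
  simp [rel]

lemma rel_im (k : Fin 3) (x : ℂ × ℝ) : (rel k x).im = x.1.im := by
  simp [rel]

/-- Horizontal coordinate relative to the axis of the `k`-th band in a frame rotating with the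
band, which makes `n` half-twists. -/
def untwist (n : ℕ) (k : Fin 3) (x : ℂ × ℝ) : ℂ :=
  Complex.exp ((π * n * clamp x.2 : ℝ) * I) * rel k x

lemma continuous_untwist (n : ℕ) (k : Fin 3) : Continuous (untwist n k) := by
  unfold untwist
  have := continuous_rel k
  have := continuous_clamp
  fun_prop

lemma norm_untwist (n : ℕ) (k : Fin 3) (x : ℂ × ℝ) : ‖untwist n k x‖ = ‖rel k x‖ := by
  rw [untwist, norm_mul, Complex.norm_exp_ofReal_mul_I, one_mul]

lemma untwist_of_nonpos (n : ℕ) (k : Fin 3) {x : ℂ × ℝ} (h : x.2 ≤ 0) :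
    untwist n k x = rel k x := by
  simp [untwist, clamp_of_nonpos h]

lemma untwist_of_one_le {n : ℕ} (hn : Odd n) (k : Fin 3) {x : ℂ × ℝ} (h : 1 ≤ x.2) :
    untwist n k x = -rel k x := by
  obtain ⟨N, rfl⟩ := hn
  have : Complex.exp ((π * (2 * N + 1 : ℕ) * clamp x.2 : ℝ) * I) = -1 := by
    rw [clamp_of_one_le h]
    have : (((π * (2 * N + 1 : ℕ) * 1 : ℝ) : ℂ) * I) = (N : ℂ) * (2 * π * I) + π * I := by
      push_cast; ring
    rw [this, Complex.exp_add, Complex.exp_nat_mul_two_pi_mul_I, Complex.exp_pi_mul_I, one_mul]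
  rw [untwist, this, neg_one_mul]

/-- The number of turns by which the two angular coordinates about the axis of a band differ. -/
def turns (n : ℕ) (k : Fin 3) (x : ℂ × ℝ) : ℤ :=
  round (((rel k x).arg - (untwist n k x).arg + π * n * clamp x.2) / (2 * π))

lemma arg_rel_sub (n : ℕ) (k : Fin 3) {x : ℂ × ℝ} (h : rel k x ≠ 0) :
    (rel k x).arg - (untwist n k x).arg + π * n * clamp x.2 = 2 * π * turns n k x := by
  have h1 : ∃ j : ℤ, (rel k x).arg - (untwist n k x).arg + π * n * clamp x.2 = 2 * π * j := by
    have h2 : ((untwist n k x).arg : Real.Angle) =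
        ((π * n * clamp x.2 : ℝ) : Real.Angle) + ((rel k x).arg : Real.Angle) := by
      rw [untwist, Complex.arg_mul_coe_angle (Complex.exp_ne_zero _) h]
      congr 1
      rw [Complex.arg_exp_mul_I, Real.Angle.coe_toIocMod]
    rw [← Real.Angle.coe_add, Real.Angle.angle_eq_iff_two_pi_dvd_sub] at h2
    obtain ⟨j, hj⟩ := h2
    refine ⟨-j, ?_⟩
    push_cast
    linarith
  obtain ⟨j, hj⟩ := h1
  have hpi := Real.pi_pos
  rw [turns, hj, mul_div_cancel_left₀ _ (by positivity), round_intCast]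

/-- If `β` and `b` are continuous branches of the two angular coordinates, then `turns` is, up to a
constant, the difference of the deviations of the principal values from these branches. -/
lemma exists_turns_eq (n : ℕ) (k : Fin 3) {x : ℂ × ℝ} {β b : ℂ × ℝ → ℝ}
    (hβ : ContinuousAt β x) (hb : ContinuousAt b x) :
    ∃ C : ℤ, ∀ᶠ p in 𝓝 x, ∀ A B : ℤ, rel k p ≠ 0 → (rel k p).arg = β p + 2 * π * A →
      (untwist n k p).arg = b p + 2 * π * B → turns n k p = A - B + C := by
  let c : ℂ × ℝ → ℝ := fun p => (β p - b p + π * n * clamp p.2) / (2 * π)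
  have hc : ContinuousAt c x := by
    have : ContinuousAt (fun p : ℂ × ℝ => clamp p.2) x :=
      (continuous_clamp.comp continuous_snd).continuousAt
    exact ((hβ.sub hb).add (continuousAt_const.mul this)).div_const _
  refine ⟨round (c x), ?_⟩
  have := Metric.continuousAt_iff'.1 hc (1/2) (by norm_num)
  filter_upwards [this] with p hp A B h0 hA hB
  have h1 := arg_rel_sub n k h0
  have hpi := Real.pi_pos
  have h2 : c p = (turns n k p - A + B : ℤ) := by
    simp only [c]
    rw [div_eq_iff (by positivity)]
    push_cast
    rw [hA, hB] at h1
    linarith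
  rw [Real.dist_eq, h2] at hp
  have h3 : round (c x) = turns n k p - A + B := by
    rw [round_eq, Int.floor_eq_iff]
    rw [abs_lt] at hp
    constructor <;> linarith [hp.1, hp.2]
  omega

/-- The complement of the planes on which the gauges jump: the plane `y = 0` of the diagram and the
twisted planes of the bands. -/
def generic (n : Fin 3 → ℕ) : Set (ℂ × ℝ) :=
  {p | p.1.im ≠ 0 ∧ ∀ k, (untwist (n k) k p).im ≠ 0}

lemma dense_generic (n : Fin 3 → ℕ) : Dense (generic n) := by
  have key : ∀ (u : ℂ × ℝ → ℂ) (_ : Continuous u) (c : ℝ → ℂ) (hc : ∀ z, c z ≠ 0)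
      (hu : ∀ x : ℂ × ℝ, ∀ ζ, u (x.1 + ζ, x.2) = u x + c x.2 * ζ),
      Dense {p | (u p).im ≠ 0} := by
    intro u hu' c hc hu x
    by_cases h : (u x).im ≠ 0
    · exact subset_closure h
    push Not at h
    have h1 : Tendsto (fun ε : ℝ => ((x.1 + (c x.2)⁻¹ * (ε * I), x.2) : ℂ × ℝ)) (𝓝[≠] 0) (𝓝 x) := by
      have : Continuous (fun ε : ℝ => ((x.1 + (c x.2)⁻¹ * (ε * I), x.2) : ℂ × ℝ)) := by fun_prop
      have := this.tendsto 0
      simp only [Complex.ofReal_zero, zero_mul, mul_zero, add_zero, Prod.mk.eta] at this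
      exact this.mono_left nhdsWithin_le_nhds
    refine mem_closure_of_tendsto h1 ?_
    filter_upwards [self_mem_nhdsWithin] with ε hε
    simp only [hu, ← mul_assoc, mul_inv_cancel₀ (hc _)]
    simpa [h] using hε
  have h0 : Dense {p : ℂ × ℝ | p.1.im ≠ 0} :=
    key (fun p => p.1) continuous_fst (fun _ => 1) (fun _ => one_ne_zero) (by simp)
  have h1 : ∀ k, Dense {p : ℂ × ℝ | (untwist (n k) k p).im ≠ 0} := fun k =>
    key _ (continuous_untwist (n k) k) (fun z => Complex.exp ((π * n k * clamp z : ℝ) * I))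
      (fun _ => Complex.exp_ne_zero _) (fun x ζ => by simp only [untwist, rel]; ring)
  have o1 : ∀ k, IsOpen {p : ℂ × ℝ | (untwist (n k) k p).im ≠ 0} := fun k =>
    isOpen_ne_fun (Complex.continuous_im.comp (continuous_untwist _ _)) continuous_const
  have : generic n = {p : ℂ × ℝ | p.1.im ≠ 0} ∩ ({p | (untwist (n 0) 0 p).im ≠ 0} ∩
      ({p | (untwist (n 1) 1 p).im ≠ 0} ∩ {p | (untwist (n 2) 2 p).im ≠ 0})) := by
    ext p
    simp [generic, Fin.forall_fin_succ]
  rw [this]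
  refine h0.inter_of_isOpen_right ?_ ((o1 0).inter ((o1 1).inter (o1 2)))
  exact (h1 0).inter_of_isOpen_right ((h1 1).inter_of_isOpen_right (h1 2) (o1 2))
    ((o1 1).inter (o1 2))

/-! ### Labellings and gauges -/

/-- The number of half-twists of the `k`-th band. -/
def halfTwists (N : Fin 3 → ℕ) (k : Fin 3) : ℕ := 2 * N k + 1

lemma odd_halfTwists (N : Fin 3 → ℕ) (k : Fin 3) : Odd (halfTwists N k) := ⟨N k, rfl⟩

/-- A labelling of the diagram: the plane `y = 0` is divided by the knot into regions, and the label
of a region stands for the holonomy of a path that crosses it from the front `y < 0` to the back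
`y > 0`. The `k`-th hole lies to the right of the `k`-th band; for `k = 2` it is unbounded. The
discs are those of the spanning surface, above and below the bands. The relation says that the
`k`-th band, with its `2 N k + 1` half-twists, also has a flat structure with the given labels to
its left and right, above and below. -/
structure Labelling (G : Type*) [Group G] (N : Fin 3 → ℕ) where
  /-- crossing the hole to the right of the `k`-th band -/
  hole : Fin 3 → G
  /-- crossing the upper disc -/
  upper : G
  /-- crossing the lower disc -/
  lower : G
  rel : ∀ k, hole k * lower⁻¹ = (hole (k - 1) * (hole k)⁻¹) ^ N k * upper * (hole k)⁻¹ *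
    ((hole (k - 1) * (hole k)⁻¹) ^ (N k + 1))⁻¹

/-- The three parts of the plane of a band, seen in a rotating frame. -/
inductive Side
  /-- to the left of the band -/
  | left
  /-- the band -/
  | mid
  /-- to the right of the band -/
  | right

/-- The index set of the charts. -/
inductive Piece
  /-- around the `r`-th hole -/
  | hole (r : Fin 3)
  /-- around the upper disc -/
  | upper
  /-- around the lower disc -/
  | lower
  /-- around a part of the plane of the `k`-th band -/
  | band (k : Fin 3) (s : Side)

/-- Square of the distance in the plane `y = 0` to the segment from `(c, 0)` to `(c, 1)`. -/
def sqDist (c : ℝ) (x : ℂ × ℝ) : ℝ := (x.1.re - c) ^ 2 + gap x.2 ^ 2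

lemma continuous_sqDist (c : ℝ) : Continuous (sqDist c) := by
  unfold sqDist
  have := continuous_gap
  fun_prop

/-- The holes of the diagram in the plane `y = 0`; the last one is the unbounded region. -/
def holeRegion : Fin 3 → Set (ℂ × ℝ)
  | 0 => {x | sqDist 2 x < 1}
  | 1 => {x | sqDist 6 x < 1}
  | 2 => {x | 25 < sqDist 4 x}

/-- The region of the plane `y = 0` that contains, above and below the bands, the two discs of the
spanning surface. -/
def discRegion : Set (ℂ × ℝ) := {x | 1 < sqDist 2 x ∧ 1 < sqDist 6 x ∧ sqDist 4 x < 25}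

/-- The closed cylinders around the bands. -/
def cylinders : Set (ℂ × ℝ) := {x | ∃ k, ‖rel k x‖ ≤ 3 / 2 ∧ 0 ≤ x.2 ∧ x.2 ≤ 1}

/-- The parts of the plane of a band, in the rotating frame. -/
def sideRegion (d : ℝ) : Side → Set ℂ
  | .left => {v | v.re < -(1 + d)}
  | .mid => {v | |v.re| < 1 - d}
  | .right => {v | 1 + d < v.re}

/-- The charts, without the point at infinity: each leaves out, of the plane on which its gauge
jumps, all but the one region to which the jump belongs. -/
def pieceSet (n : Fin 3 → ℕ) : Piece → Set (ℂ × ℝ)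
  | .hole r => {x | (x.1.im ≠ 0 ∨ x ∈ holeRegion r) ∧ x ∉ cylinders}
  | .upper => {x | (x.1.im ≠ 0 ∨ x ∈ discRegion) ∧ 1 < x.2}
  | .lower => {x | (x.1.im ≠ 0 ∨ x ∈ discRegion) ∧ x.2 < 0}
  | .band k s => {x | ‖rel k x‖ < 2 ∧ gap x.2 < 1 ∧
      ((untwist (n k) k x).im ≠ 0 ∨ untwist (n k) k x ∈ sideRegion (gap x.2) s)}

lemma isOpen_holeRegion (r : Fin 3) : IsOpen (holeRegion r) := by
  have := continuous_sqDist
  fin_cases r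
  · exact isOpen_lt (this 2) continuous_const
  · exact isOpen_lt (this 6) continuous_const
  · exact isOpen_lt continuous_const (this 4)

lemma isOpen_discRegion : IsOpen discRegion :=
  (isOpen_lt continuous_const (continuous_sqDist 2)).inter
    ((isOpen_lt continuous_const (continuous_sqDist 6)).inter
      (isOpen_lt (continuous_sqDist 4) continuous_const))

lemma isClosed_cylinders : IsClosed cylinders := by
  have : cylinders = ⋃ k, {x | ‖rel k x‖ ≤ 3 / 2 ∧ 0 ≤ x.2 ∧ x.2 ≤ 1} := by
    ext; simp [cylinders]
  rw [this]
  exact isClosed_iUnion_of_finite fun k =>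
    (isClosed_le (continuous_rel k).norm continuous_const).inter
      ((isClosed_le continuous_const continuous_snd).inter
        (isClosed_le continuous_snd continuous_const))

lemma isOpen_im_ne : IsOpen {x : ℂ × ℝ | x.1.im ≠ 0} :=
  isOpen_ne_fun (Complex.continuous_im.comp continuous_fst) continuous_const

lemma isOpen_pieceSet (n : Fin 3 → ℕ) (i : Piece) : IsOpen (pieceSet n i) := by
  cases i with
  | hole r =>
    exact (isOpen_im_ne.union (isOpen_holeRegion r)).inter isClosed_cylinders.isOpen_compl
  | upper =>
    exact (isOpen_im_ne.union isOpen_discRegion).inter (isOpen_lt continuous_const continuous_snd)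
  | lower =>
    exact (isOpen_im_ne.union isOpen_discRegion).inter (isOpen_lt continuous_snd continuous_const)
  | band k s =>
    have hv := continuous_untwist (n k) k
    have hg : Continuous fun x : ℂ × ℝ => gap x.2 := continuous_gap.comp continuous_snd
    have hre := Complex.continuous_re.comp hv
    refine (isOpen_lt (continuous_rel k).norm continuous_const).inter
      ((isOpen_lt hg continuous_const).inter
      ((isOpen_ne_fun (Complex.continuous_im.comp hv) continuous_const).union ?_))
    cases s with
    | left => exact isOpen_lt hre (continuous_const.add hg).neg
    | mid => exact isOpen_lt hre.abs (continuous_const.sub hg)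
    | right => exact isOpen_lt (continuous_const.add hg) hre

section gauges
variable {G : Type*} [Group G]

/-- The function with value `1` on the negative and `g` on the positive half-line. -/
def jump (g : G) (y : ℝ) : G := if 0 < y then g else 1

lemma jump_of_pos (g : G) {y : ℝ} (h : 0 < y) : jump g y = g := if_pos h
lemma jump_of_neg (g : G) {y : ℝ} (h : y < 0) : jump g y = 1 := if_neg (not_lt.2 h.le)
@[simp] lemma jump_one (y : ℝ) : jump (1 : G) y = 1 := by simp [jump]

lemma jump_eventually (g : G) {X : Type*} [TopologicalSpace X] {u : X → ℝ} {x : X}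
    (hu : ContinuousAt u x) (hx : u x ≠ 0) : ∀ᶠ p in 𝓝 x, jump g (u p) = jump g (u x) := by
  rcases lt_or_gt_of_ne hx with h | h
  · filter_upwards [hu.eventually_lt continuousAt_const h] with p hp
    rw [jump_of_neg g hp, jump_of_neg g h]
  · filter_upwards [continuousAt_const.eventually_lt hu h] with p hp
    rw [jump_of_pos g hp, jump_of_pos g h]

variable {N : Fin 3 → ℕ} (L : Labelling G N)

namespace Labelling

/-- The holonomy of a loop around the `k`-th band: to the back through the hole on its left and to
the front through the hole on its right. -/
def around (k : Fin 3) : G := L.hole (k - 1) * (L.hole k)⁻¹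

/-- The holonomy of a path across a part of the twisted plane of the `k`-th band. -/
def side (k : Fin 3) : Side → G
  | .left => (L.around k)⁻¹
  | .mid => L.hole k * L.lower⁻¹
  | .right => 1

/-- The gauges, meaningful on the generic set. In the chart of a band the last two factors
pass from the jumps on the plane `y = 0`, to the left and right of the band, to the jumps on the
twisted plane that the first factor describes. -/
def gauge : Piece → ℂ × ℝ → G
  | .hole r, x => jump (L.hole r) x.1.im
  | .upper, x => jump L.upper x.1.im
  | .lower, x => jump L.lower x.1.im
  | .band k s, x => jump (L.side k s) (-(untwist (halfTwists N k) k x).im) *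
      L.around k ^ turns (halfTwists N k) k x * jump (L.hole k) x.1.im

end Labelling

lemma continuous_im_fst : Continuous fun x : ℂ × ℝ => x.1.im :=
  Complex.continuous_im.comp continuous_fst

/-- Off the plane `y = 0` a jump is a locally constant multiple of a power of `around k` that counts
the deviation of the principal argument from a continuous branch. The next two lemmas treat the
points of this plane to the right and left of the band. -/
lemma exists_branch_out (k : Fin 3) (g : G) {x : ℂ × ℝ} (hx : x.1.im ≠ 0) :
    ∃ β : ℂ × ℝ → ℝ, ContinuousAt β x ∧ ∃ c : G, ∀ᶠ p in 𝓝 x, p.1.im ≠ 0 → ∃ A : ℤ,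
      (rel k p).arg = β p + 2 * π * A ∧
      jump g p.1.im = c * L.around k ^ A * jump (L.hole k) p.1.im := by
  refine ⟨fun p => (rel k p).arg, ?_, jump g x.1.im * (jump (L.hole k) x.1.im)⁻¹, ?_⟩
  · refine ContinuousAt.comp (Complex.continuousAt_arg ?_) (continuous_rel k).continuousAt
    exact Complex.mem_slitPlane_iff.2 (Or.inr (by rwa [rel_im]))
  · filter_upwards [jump_eventually g continuous_im_fst.continuousAt hx,
      jump_eventually (L.hole k) continuous_im_fst.continuousAt hx] with p h1 h2 _
    exact ⟨0, by simp, by simp [h1, h2]⟩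

lemma exists_branch_right (k : Fin 3) {x : ℂ × ℝ} (hx : 0 < (rel k x).re) :
    ∃ β : ℂ × ℝ → ℝ, ContinuousAt β x ∧ ∃ c : G, ∀ᶠ p in 𝓝 x, p.1.im ≠ 0 → ∃ A : ℤ,
      (rel k p).arg = β p + 2 * π * A ∧
      jump (L.hole k) p.1.im = c * L.around k ^ A * jump (L.hole k) p.1.im := by
  refine ⟨fun p => (rel k p).arg, ?_, 1, ?_⟩
  · refine ContinuousAt.comp (Complex.continuousAt_arg ?_) (continuous_rel k).continuousAt
    exact Complex.mem_slitPlane_iff.2 (Or.inl hx)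
  · exact Eventually.of_forall fun p _ => ⟨0, by simp, by simp⟩

lemma exists_branch_left (k : Fin 3) {x : ℂ × ℝ} (hx : (rel k x).re < 0) :
    ∃ β : ℂ × ℝ → ℝ, ContinuousAt β x ∧ ∃ c : G, ∀ᶠ p in 𝓝 x, p.1.im ≠ 0 → ∃ A : ℤ,
      (rel k p).arg = β p + 2 * π * A ∧
      jump (L.hole (k - 1)) p.1.im = c * L.around k ^ A * jump (L.hole k) p.1.im := by
  refine ⟨fun p => (-rel k p).arg + π, ?_, L.around k, ?_⟩
  · refine ContinuousAt.add ?_ continuousAt_const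
    refine ContinuousAt.comp (Complex.continuousAt_arg ?_) (continuous_rel k).neg.continuousAt
    exact Complex.mem_slitPlane_iff.2 (Or.inl (by simpa using hx))
  · refine Eventually.of_forall fun p hp => ?_
    rcases lt_or_gt_of_ne hp with h | h
    · refine ⟨-1, ?_, ?_⟩
      · beta_reduce
        rw [Complex.arg_neg_eq_arg_add_pi_of_im_neg (by rwa [rel_im] : (rel k p).im < 0)]
        push_cast; ring
      · simp [jump_of_neg _ h]
    · refine ⟨0, ?_, ?_⟩
      · beta_reduce
        rw [Complex.arg_neg_eq_arg_sub_pi_of_im_pos (by rwa [rel_im] : 0 < (rel k p).im)]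
        push_cast; ring
      · simp [jump_of_pos _ h, Labelling.around]

/-- The analogue for the jumps on the twisted plane of a band. -/
lemma exists_branch_band (n : ℕ) (k : Fin 3) (s : Side) {x : ℂ × ℝ}
    (hx : (untwist n k x).im ≠ 0 ∨ (s = .right ∧ 0 < (untwist n k x).re) ∨
      (s = .left ∧ (untwist n k x).re < 0)) :
    ∃ b : ℂ × ℝ → ℝ, ContinuousAt b x ∧ ∃ c : G, ∀ᶠ p in 𝓝 x, (untwist n k p).im ≠ 0 → ∃ B : ℤ,
      (untwist n k p).arg = b p + 2 * π * B ∧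
      jump (L.side k s) (-(untwist n k p).im) = c * L.around k ^ B := by
  have hv := continuous_untwist n k
  rcases hx with hx | ⟨rfl, hx⟩ | ⟨rfl, hx⟩
  · refine ⟨fun p => (untwist n k p).arg, ?_, jump (L.side k s) (-(untwist n k x).im), ?_⟩
    · exact ContinuousAt.comp (Complex.continuousAt_arg (Complex.mem_slitPlane_iff.2 (Or.inr hx)))
        hv.continuousAt
    · filter_upwards [jump_eventually (L.side k s)
        (Complex.continuous_im.comp hv).neg.continuousAt (neg_ne_zero.2 hx)] with p h1 _
      exact ⟨0, by simp, by simpa using h1⟩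
  · refine ⟨fun p => (untwist n k p).arg, ?_, 1, ?_⟩
    · exact ContinuousAt.comp (Complex.continuousAt_arg (Complex.mem_slitPlane_iff.2 (Or.inl hx)))
        hv.continuousAt
    · exact Eventually.of_forall fun p _ => ⟨0, by simp, by simp [Labelling.side]⟩
  · refine ⟨fun p => (-untwist n k p).arg + π, ?_, 1, ?_⟩
    · refine ContinuousAt.add ?_ continuousAt_const
      refine ContinuousAt.comp (Complex.continuousAt_arg ?_) hv.neg.continuousAt
      exact Complex.mem_slitPlane_iff.2 (Or.inl (by simpa using hx))
    · refine Eventually.of_forall fun p hp => ?_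
      rcases lt_or_gt_of_ne hp with h | h
      · refine ⟨-1, ?_, ?_⟩
        · beta_reduce
          rw [Complex.arg_neg_eq_arg_add_pi_of_im_neg h]; push_cast; ring
        · simp [jump_of_pos _ (neg_pos.2 h), Labelling.side]
      · refine ⟨0, ?_, ?_⟩
        · beta_reduce
          rw [Complex.arg_neg_eq_arg_sub_pi_of_im_pos h]; push_cast; ring
        · simp [jump_of_neg _ (neg_lt_zero.2 h)]

/-- Local branches for the jumps on the plane `y = 0` and on the twisted plane give agreement with
the gauge of the band up to a constant. -/
lemma exists_gauge_eq_of_branches (k : Fin 3) (s : Side) (g : G) {x : ℂ × ℝ}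
    (h₁ : ∃ β : ℂ × ℝ → ℝ, ContinuousAt β x ∧ ∃ c : G, ∀ᶠ p in 𝓝 x, p.1.im ≠ 0 → ∃ A : ℤ,
      (rel k p).arg = β p + 2 * π * A ∧
      jump g p.1.im = c * L.around k ^ A * jump (L.hole k) p.1.im)
    (h₂ : ∃ b : ℂ × ℝ → ℝ, ContinuousAt b x ∧ ∃ c : G, ∀ᶠ p in 𝓝 x,
      (untwist (halfTwists N k) k p).im ≠ 0 → ∃ B : ℤ,
      (untwist (halfTwists N k) k p).arg = b p + 2 * π * B ∧
      jump (L.side k s) (-(untwist (halfTwists N k) k p).im) = c * L.around k ^ B) :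
    ∃ c, ∀ᶠ p in 𝓝 x, p.1.im ≠ 0 → (untwist (halfTwists N k) k p).im ≠ 0 →
      jump g p.1.im = c * L.gauge (.band k s) p := by
  obtain ⟨β, hβ, c₁, h₁⟩ := h₁
  obtain ⟨b, hb, c₂, h₂⟩ := h₂
  obtain ⟨C, hC⟩ := exists_turns_eq (halfTwists N k) k hβ hb
  refine ⟨c₁ * L.around k ^ (-C) * c₂⁻¹, ?_⟩
  filter_upwards [h₁, h₂, hC] with p h1 h2 hC hp hp'
  obtain ⟨A, hA, hA'⟩ := h1 hp
  obtain ⟨B, hB, hB'⟩ := h2 hp'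
  have h0 : rel k p ≠ 0 := fun h => hp (by rw [← rel_im k p, h]; rfl)
  rw [Labelling.gauge, hA', hB', hC A B h0 hA hB]
  have : A - B + C = -B + (C + A) := by ring
  rw [this, zpow_add, zpow_add, zpow_neg, zpow_neg]
  group

end gauges

/-! ### Compatibility of the gauges -/

variable {G : Type*} [Group G] {N : Fin 3 → ℕ} (L : Labelling G N)

/-- In the plane `y = 0` near the `k`-th band, the holes are those to its right and left. -/
lemma holeRegion_near {r k : Fin 3} {x : ℂ × ℝ} (h : x ∈ holeRegion r) (hk : ‖rel k x‖ < 2)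
    (hd : gap x.2 < 1) : (r = k ∧ 0 < (rel k x).re) ∨ (r = k - 1 ∧ (rel k x).re < 0) := by
  have h1 := (Complex.abs_re_le_norm (rel k x)).trans_lt hk
  rw [rel_re, abs_lt] at h1
  rw [rel_re]
  have h0 := gap_nonneg x.2
  revert h h1 h0 hd
  generalize he : gap x.2 = d
  generalize hu : x.1.re = u
  intro h hd h1 h0
  have h2 : (2 : Fin 3) = -1 := rfl
  fin_cases r <;> fin_cases k <;> simp [holeRegion, sqDist, he, hu, h2] at h h1 ⊢ <;>
    nlinarith

lemma holeRegion_not_mid {r k : Fin 3} {x : ℂ × ℝ} (h : x ∈ holeRegion r)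
    (hk : |(rel k x).re| < 1 - gap x.2) : False := by
  rw [rel_re, abs_lt] at hk
  have h0 := gap_nonneg x.2
  revert h hk h0
  generalize hd : gap x.2 = d
  generalize hu : x.1.re = u
  intro h hk h0
  fin_cases r <;> fin_cases k <;> simp [holeRegion, sqDist, hd, hu] at h hk <;> nlinarith

lemma discRegion_mid {k : Fin 3} {x : ℂ × ℝ} (h : x ∈ discRegion) (hk : ‖rel k x‖ < 2)
    (hd : 0 < gap x.2) (hd' : gap x.2 < 1) : |(rel k x).re| ≤ 1 + gap x.2 := by
  have h1 := (Complex.abs_re_le_norm (rel k x)).trans_lt hk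
  rw [rel_re, abs_lt] at h1
  rw [rel_re, abs_le]
  obtain ⟨h2, h3, h4⟩ := h
  simp only [sqDist] at h2 h3 h4
  set d := gap x.2
  set u := x.1.re
  fin_cases k <;> simp at h1 ⊢ <;> constructor <;> nlinarith

lemma holeRegion_disjoint {r r' : Fin 3} {x : ℂ × ℝ} (h : x ∈ holeRegion r)
    (h' : x ∈ holeRegion r') : r = r' := by
  fin_cases r <;> fin_cases r' <;> simp [holeRegion, sqDist] at h h' ⊢ <;> nlinarith

lemma holeRegion_discRegion {r : Fin 3} {x : ℂ × ℝ} (h : x ∈ holeRegion r)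
    (h' : x ∈ discRegion) : False := by
  obtain ⟨h2, h3, h4⟩ := h'
  fin_cases r <;> simp [holeRegion] at h <;> linarith

/-- Above a band its gauge agrees with that of the upper disc, up to a constant; this is the
relation of the labelling. -/
lemma exists_upper_mid (k : Fin 3) {x : ℂ × ℝ} (hx : 1 < x.2) :
    ∀ᶠ p in 𝓝 x, p.1.im ≠ 0 →
      jump L.upper p.1.im = (L.around k ^ N k)⁻¹ * L.gauge (.band k .mid) p := by
  have hpi := Real.pi_pos
  filter_upwards [continuous_snd.continuousAt.eventually (lt_mem_nhds hx)] with p hp hp'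
  have hu := untwist_of_one_le (odd_halfTwists N k) k (le_of_lt hp)
  rw [Labelling.gauge, hu, turns, hu, clamp_of_one_le hp.le]
  rcases lt_or_gt_of_ne hp' with h | h
  · rw [Complex.arg_neg_eq_arg_add_pi_of_im_neg (by rwa [rel_im] : (rel k p).im < 0)]
    have : ((rel k p).arg - ((rel k p).arg + π) + π * (halfTwists N k : ℕ) * 1) / (2 * π) =
        (N k : ℤ) := by
      simp only [halfTwists]; field_simp; push_cast; ring
    rw [this, round_intCast, Complex.neg_im, neg_neg, rel_im]
    simp [jump_of_neg _ h]
  · rw [Complex.arg_neg_eq_arg_sub_pi_of_im_pos (by rwa [rel_im] : 0 < (rel k p).im)]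
    have : ((rel k p).arg - ((rel k p).arg - π) + π * (halfTwists N k : ℕ) * 1) / (2 * π) =
        ((N k + 1 : ℕ) : ℤ) := by
      simp only [halfTwists]; field_simp; push_cast; ring
    rw [this, round_intCast, Complex.neg_im, neg_neg, rel_im, zpow_natCast]
    simp only [jump_of_pos _ h, Labelling.side]
    rw [L.rel k]
    simp only [Labelling.around]
    group

/-- The relation is not needed below the bands, where the twisted planes start. -/
lemma exists_lower_mid (k : Fin 3) {x : ℂ × ℝ} (hx : x.2 < 0) :
    ∀ᶠ p in 𝓝 x, p.1.im ≠ 0 →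
      jump L.lower p.1.im = (L.hole k * L.lower⁻¹)⁻¹ * L.gauge (.band k .mid) p := by
  filter_upwards [continuous_snd.continuousAt.eventually (gt_mem_nhds hx)] with p hp hp'
  have hu := untwist_of_nonpos (halfTwists N k) k (le_of_lt hp)
  rw [Labelling.gauge, hu, turns, hu, clamp_of_nonpos hp.le]
  simp only [sub_self, mul_zero, add_zero, zero_div, round_zero, zpow_zero, mul_one,
    rel_im]
  rcases lt_or_gt_of_ne hp' with h | h
  · simp [jump_of_neg _ h, jump_of_pos _ (neg_pos.2 h), Labelling.side]
  · simp [jump_of_pos _ h, jump_of_neg _ (neg_lt_zero.2 h)]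

/-- Two gauges differ by a constant near `x`, on the generic set. -/
def Agree (i j : Piece) (x : ℂ × ℝ) : Prop :=
  ∃ g, ∀ᶠ p in 𝓝 x, p ∈ generic (halfTwists N) → L.gauge i p = g * L.gauge j p

variable {L}

lemma Agree.symm {i j : Piece} {x : ℂ × ℝ} (h : Agree L i j x) : Agree L j i x := by
  obtain ⟨g, h⟩ := h
  refine ⟨g⁻¹, ?_⟩
  filter_upwards [h] with p hp hp'
  rw [hp hp']; group

lemma agree_jump {i j : Piece} {g g' : G} {x : ℂ × ℝ} (hx : x.1.im ≠ 0)
    (hi : ∀ p, L.gauge i p = jump g p.1.im) (hj : ∀ p, L.gauge j p = jump g' p.1.im) :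
    Agree L i j x := by
  refine ⟨jump g x.1.im * (jump g' x.1.im)⁻¹, ?_⟩
  filter_upwards [jump_eventually g continuous_im_fst.continuousAt hx,
    jump_eventually g' continuous_im_fst.continuousAt hx] with p h1 h2 _
  rw [hi, hj, h1, h2]; group

lemma agree_refl {i j : Piece} (h : i = j) (x : ℂ × ℝ) : Agree L i j x :=
  ⟨1, Eventually.of_forall fun p _ => by rw [h, one_mul]⟩

lemma agree_hole_band {r k : Fin 3} {s : Side} {x : ℂ × ℝ}
    (hr : x ∈ pieceSet (halfTwists N) (.hole r)) (hk : x ∈ pieceSet (halfTwists N) (.band k s)) :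
    Agree L (.hole r) (.band k s) x := by
  obtain ⟨hr, hc⟩ := hr
  obtain ⟨h2, hd, hs⟩ := hk
  have hout : ∃ β : ℂ × ℝ → ℝ, ContinuousAt β x ∧ ∃ c : G, ∀ᶠ p in 𝓝 x, p.1.im ≠ 0 → ∃ A : ℤ,
      (rel k p).arg = β p + 2 * π * A ∧
      jump (L.hole r) p.1.im = c * L.around k ^ A * jump (L.hole k) p.1.im := by
    by_cases hy : x.1.im = 0
    · rcases holeRegion_near (hr.resolve_left (not_not.2 hy)) h2 hd with ⟨rfl, h⟩ | ⟨rfl, h⟩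
      · exact exists_branch_right L _ h
      · exact exists_branch_left L _ h
    · exact exists_branch_out L k _ hy
  have hin := exists_branch_band L (halfTwists N k) k s (x := x) (by
    by_cases hv : (untwist (halfTwists N k) k x).im = 0
    · right
      have hs' := hs.resolve_left (not_not.2 hv)
      have h0 := gap_nonneg x.2
      cases s with
      | left =>
        simp only [sideRegion, Set.mem_ofPred_eq] at hs'
        exact Or.inr ⟨rfl, hs'.trans (by linarith)⟩
      | right =>
        simp only [sideRegion, Set.mem_ofPred_eq] at hs'
        exact Or.inl ⟨rfl, lt_trans (by linarith) hs'⟩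
      | mid =>
        exfalso
        simp only [sideRegion, Set.mem_ofPred_eq] at hs'
        have hn : ‖rel k x‖ < 1 - gap x.2 := by
          rw [← norm_untwist (halfTwists N k), ← Complex.abs_re_eq_norm.2 hv]
          exact hs'
        have hz : ¬ (0 ≤ x.2 ∧ x.2 ≤ 1) := fun hz => hc ⟨k, by linarith, hz⟩
        have hn' := (Complex.abs_re_le_norm _).trans_lt hn
        have hy : x.1.im = 0 := by
          rw [not_and_or, not_le, not_le] at hz
          rcases hz with hz | hz
          · rw [untwist_of_nonpos _ _ hz.le, rel_im] at hv
            exact hv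
          · rw [untwist_of_one_le (odd_halfTwists N k) _ hz.le, Complex.neg_im, rel_im, neg_eq_zero] at hv
            exact hv
        exact holeRegion_not_mid (hr.resolve_left (not_not.2 hy)) hn'
    · exact Or.inl hv)
  obtain ⟨c, hc'⟩ := exists_gauge_eq_of_branches L k s _ hout hin
  exact ⟨c, hc'.mono fun p hp hg => hp hg.1 (hg.2 k)⟩

lemma agree_disc_band {g : G} {i : Piece} {k : Fin 3} {s : Side} {x : ℂ × ℝ}
    (hi : ∀ p, L.gauge i p = jump g p.1.im)
    (hx : x.1.im ≠ 0 ∨ x ∈ discRegion) (hz : ¬ (0 ≤ x.2 ∧ x.2 ≤ 1))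
    (hmid : Agree L i (.band k .mid) x)
    (hk : x ∈ pieceSet (halfTwists N) (.band k s)) :
    Agree L i (.band k s) x := by
  obtain ⟨h2, hd, hs⟩ := hk
  have hv : |(rel k x).re| = |(untwist (halfTwists N k) k x).re| ∧
      |x.1.im| = |(untwist (halfTwists N k) k x).im| := by
    rw [not_and_or, not_le, not_le] at hz
    rcases hz with hz | hz
    · rw [untwist_of_nonpos _ _ hz.le, rel_im]; simp
    · rw [untwist_of_one_le (odd_halfTwists N k) _ hz.le, Complex.neg_im, Complex.neg_re, rel_im]
      simp
  by_cases hy : x.1.im = 0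
  · have hv0 : (untwist (halfTwists N k) k x).im = 0 := by
      have := hv.2
      rwa [hy, abs_zero, eq_comm, abs_eq_zero] at this
    have hs' := hs.resolve_left (not_not.2 hv0)
    have h3 := discRegion_mid (hx.resolve_left (not_not.2 hy)) h2 (gap_pos hz) hd
    rw [hv.1] at h3
    cases s with
    | mid => exact hmid
    | left =>
      simp only [sideRegion, Set.mem_ofPred_eq] at hs'
      rw [abs_le] at h3; linarith
    | right =>
      simp only [sideRegion, Set.mem_ofPred_eq] at hs'
      rw [abs_le] at h3; linarith
  · have hv0 : (untwist (halfTwists N k) k x).im ≠ 0 := by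
      intro h
      have := hv.2
      rw [h, abs_zero, abs_eq_zero] at this
      exact hy this
    obtain ⟨c, hc⟩ := exists_gauge_eq_of_branches L k s g (exists_branch_out L k g hy)
      (exists_branch_band L (halfTwists N k) k s (Or.inl hv0))
    exact ⟨c, hc.mono fun p hp hg => by rw [hi]; exact hp hg.1 (hg.2 k)⟩

lemma agree_band_band {k k' : Fin 3} {s s' : Side} {x : ℂ × ℝ}
    (hk : x ∈ pieceSet (halfTwists N) (.band k s))
    (hk' : x ∈ pieceSet (halfTwists N) (.band k' s')) :
    Agree L (.band k s) (.band k' s') x := by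
  obtain ⟨h2, hd, hs⟩ := hk
  obtain ⟨h2', hd', hs'⟩ := hk'
  have hkk : k = k' := by
    have h1 := (Complex.abs_re_le_norm (rel k x)).trans_lt h2
    have h1' := (Complex.abs_re_le_norm (rel k' x)).trans_lt h2'
    rw [rel_re, abs_lt] at h1 h1'
    fin_cases k <;> fin_cases k' <;> simp at h1 h1' ⊢ <;> linarith
  subst hkk
  have h0 := gap_nonneg x.2
  by_cases hv : (untwist (halfTwists N k) k x).im = 0
  · have h3 := hs.resolve_left (not_not.2 hv)
    have h3' := hs'.resolve_left (not_not.2 hv)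
    refine agree_refl ?_ x
    congr 1
    cases s <;> cases s' <;>
      simp only [sideRegion, Set.mem_ofPred_eq, abs_lt] at h3 h3' <;>
      first | rfl | (exfalso; linarith)
  · have hc := (Complex.continuous_im.comp (continuous_untwist (halfTwists N k) k)).neg
    refine ⟨jump (L.side k s) (-(untwist (halfTwists N k) k x).im) *
      (jump (L.side k s') (-(untwist (halfTwists N k) k x).im))⁻¹, ?_⟩
    filter_upwards [jump_eventually (L.side k s) hc.continuousAt (neg_ne_zero.2 hv),
      jump_eventually (L.side k s') hc.continuousAt (neg_ne_zero.2 hv)] with p h1 h1' _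
    simp only [Labelling.gauge]
    simp only [Pi.neg_apply, Function.comp_apply] at h1 h1'
    rw [h1, h1']; group

lemma agree (i j : Piece) {x : ℂ × ℝ} (hi : x ∈ pieceSet (halfTwists N) i)
    (hj : x ∈ pieceSet (halfTwists N) j) : Agree L i j x := by
  have hu : ∀ {k s}, x ∈ pieceSet (halfTwists N) .upper →
      x ∈ pieceSet (halfTwists N) (.band k s) → Agree L .upper (.band k s) x := by
    intro k s hi hj
    refine agree_disc_band (g := L.upper) (fun _ => rfl) hi.1 (fun h => ?_) ?_ hj
    · exact absurd hi.2 (not_lt.2 h.2)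
    · exact ⟨_, (exists_upper_mid L k hi.2).mono fun p hp hg => hp hg.1⟩
  have hl : ∀ {k s}, x ∈ pieceSet (halfTwists N) .lower →
      x ∈ pieceSet (halfTwists N) (.band k s) → Agree L .lower (.band k s) x := by
    intro k s hi hj
    refine agree_disc_band (g := L.lower) (fun _ => rfl) hi.1 (fun h => ?_) ?_ hj
    · exact absurd hi.2 (not_lt.2 h.1)
    · exact ⟨_, (exists_lower_mid L k hi.2).mono fun p hp hg => hp hg.1⟩
  have hh : ∀ {r}, x ∈ pieceSet (halfTwists N) (.hole r) → x ∈ discRegion ∨ x.1.im ≠ 0 →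
      x.1.im ≠ 0 := by
    intro r h h' h0
    exact holeRegion_discRegion (h.1.resolve_left (not_not.2 h0)) (h'.resolve_right (not_not.2 h0))
  cases i with
  | hole r =>
    cases j with
    | hole r' =>
      by_cases hy : x.1.im = 0
      · refine agree_refl ?_ x
        rw [holeRegion_disjoint (hi.1.resolve_left (not_not.2 hy)) (hj.1.resolve_left (not_not.2 hy))]
      · exact agree_jump hy (fun _ => rfl) (fun _ => rfl)
    | upper => exact agree_jump (hh hi hj.1.symm) (fun _ => rfl) (fun _ => rfl)
    | lower => exact agree_jump (hh hi hj.1.symm) (fun _ => rfl) (fun _ => rfl)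
    | band k s => exact agree_hole_band hi hj
  | upper =>
    cases j with
    | hole r' => exact agree_jump (hh hj hi.1.symm) (fun _ => rfl) (fun _ => rfl)
    | upper => exact agree_refl rfl x
    | lower => exact absurd (hi.2.trans hj.2) (by norm_num)
    | band k s => exact hu hi hj
  | lower =>
    cases j with
    | hole r' => exact agree_jump (hh hj hi.1.symm) (fun _ => rfl) (fun _ => rfl)
    | lower => exact agree_refl rfl x
    | upper => exact absurd (hj.2.trans hi.2) (by norm_num)
    | band k s => exact hl hi hj
  | band k s =>
    cases j with
    | hole r' => exact (agree_hole_band hj hi).symm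
    | upper => exact (hu hj hi).symm
    | lower => exact (hl hj hi).symm
    | band k s => exact agree_band_band hi hj

/-! ### The flat structure of a labelling -/

variable {G : Type*} [Group G] {N : Fin 3 → ℕ}

/-- The charts in the sphere; the point at infinity belongs to the unbounded hole. -/
def pieceChart (n : Fin 3 → ℕ) (i : Piece) : Set (OnePoint (ℂ × ℝ)) :=
  {x | (∃ p ∈ pieceSet n i, (p : OnePoint (ℂ × ℝ)) = x) ∨ (x = OnePoint.infty ∧ i = .hole 2)}

lemma coe_mem_pieceChart {n : Fin 3 → ℕ} {i : Piece} {p : ℂ × ℝ} :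
    (p : OnePoint (ℂ × ℝ)) ∈ pieceChart n i ↔ p ∈ pieceSet n i := by
  constructor
  · rintro (⟨q, hq, h⟩ | ⟨h, -⟩)
    · rwa [← OnePoint.coe_injective h]
    · exact absurd h (OnePoint.coe_ne_infty p)
  · exact fun h => Or.inl ⟨p, h, rfl⟩

lemma isCompact_compl_hole_two (n : Fin 3 → ℕ) : IsCompact (pieceSet n (.hole 2))ᶜ := by
  refine (isCompact_closedBall (0 : ℂ × ℝ) 10).of_isClosed_subset
    (isOpen_pieceSet n _).isClosed_compl fun x hx => ?_
  rw [mem_closedBall_zero_iff, Prod.norm_def, max_le_iff]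
  simp only [pieceSet, holeRegion, Set.mem_compl_iff, Set.mem_ofPred_eq, not_and_or, not_not,
    not_or] at hx
  rcases hx with ⟨hy, hx⟩ | ⟨k, hk, hz⟩
  · rw [not_lt, sqDist] at hx
    have h1 : |x.1.re - 4| ≤ 5 := abs_le_of_sq_le_sq (by nlinarith [sq_nonneg (gap x.2)]) (by norm_num)
    have h2 : gap x.2 ≤ 5 := by nlinarith [sq_nonneg (x.1.re - 4), gap_nonneg x.2]
    have h3 : x.2 - 1 ≤ gap x.2 := le_max_left _ _
    have h4 : -x.2 ≤ gap x.2 := (le_max_left _ _).trans (le_max_right _ _)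
    rw [abs_le] at h1
    refine ⟨?_, by rw [Real.norm_eq_abs, abs_le]; constructor <;> linarith⟩
    have := Complex.abs_re_eq_norm.2 hy
    rw [← this, abs_le]; constructor <;> linarith
  · refine ⟨?_, by rw [Real.norm_eq_abs, abs_le]; constructor <;> linarith [hz.1, hz.2]⟩
    have h1 : ‖x.1‖ ≤ ‖rel k x‖ + ‖(4 * ((k : ℕ) : ℂ))‖ := by
      have : x.1 = rel k x + 4 * ((k : ℕ) : ℂ) := by simp [rel]
      rw [this]; exact (norm_add_le _ _)
    have h2 : ‖(4 * ((k : ℕ) : ℂ))‖ ≤ 8 := by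
      rw [norm_mul, Complex.norm_natCast, Complex.norm_ofNat]
      have : ((k : ℕ) : ℝ) ≤ 2 := by exact_mod_cast Nat.lt_succ_iff.1 k.2
      linarith
    linarith

lemma isOpen_pieceChart (n : Fin 3 → ℕ) (i : Piece) : IsOpen (pieceChart n i) := by
  have hpre : ((↑) : ℂ × ℝ → OnePoint (ℂ × ℝ)) ⁻¹' pieceChart n i = pieceSet n i := by
    ext p; exact coe_mem_pieceChart
  by_cases hi : i = .hole 2
  · rw [OnePoint.isOpen_iff_of_mem (by exact Or.inr ⟨rfl, hi⟩), hpre]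
    subst hi
    exact ⟨(isOpen_pieceSet n _).isClosed_compl, isCompact_compl_hole_two n⟩
  · rw [OnePoint.isOpen_iff_of_notMem, hpre]
    · exact isOpen_pieceSet n i
    · rintro (⟨q, -, h⟩ | ⟨-, h⟩)
      · exact OnePoint.coe_ne_infty q h
      · exact hi h

/-- A flat structure on the complement of the pretzel knot whose transition functions are those of
the gauges of a labelling. -/
structure IsPretzelAtlas (L : Labelling G N) (A : FlatAtlas G (OnePoint (ℂ × ℝ)) Piece) : Prop where
  chart_eq : A.chart = pieceChart (halfTwists N)
  transition : ∀ i j (p : ℂ × ℝ) g, p ∈ pieceSet (halfTwists N) i → p ∈ pieceSet (halfTwists N) j →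
    (∀ᶠ q in 𝓝 p, q ∈ generic (halfTwists N) → L.gauge i q = g * L.gauge j q) →
    A.gauge i p * (A.gauge j p)⁻¹ = g

theorem exists_isPretzelAtlas (L : Labelling G N) : ∃ A, IsPretzelAtlas L A := by
  let D : Set (OnePoint (ℂ × ℝ)) := (↑) '' generic (halfTwists N)
  let f : Piece → OnePoint (ℂ × ℝ) → G := fun i x => x.elim 1 (L.gauge i)
  have hD : Dense D := OnePoint.denseRange_coe.dense_image OnePoint.continuous_coe (dense_generic _)
  have hev : ∀ i j (p : ℂ × ℝ) g,
      (∀ᶠ q in 𝓝 p, q ∈ generic (halfTwists N) → L.gauge i q = g * L.gauge j q) →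
      ∀ᶠ y in 𝓝[D] (p : OnePoint (ℂ × ℝ)), f i y = g * f j y := by
    intro i j p g h
    rw [eventually_nhdsWithin_iff, ← OnePoint.isOpenEmbedding_coe.map_nhds_eq, eventually_map]
    filter_upwards [h] with q hq hqD
    obtain ⟨q', hq', he⟩ := hqD
    rw [OnePoint.coe_injective he] at hq'
    exact hq hq'
  obtain ⟨A, hA, hg⟩ := FlatAtlas.exists_of_dense (isOpen_pieceChart (halfTwists N)) hD f (by
    rintro i j x hi hj
    induction x using OnePoint.rec with
    | infty =>
      have : ∀ {i}, OnePoint.infty ∈ pieceChart (halfTwists N) i → i = .hole 2 := by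
        rintro i (⟨q, -, h⟩ | ⟨-, h⟩)
        · exact absurd h (OnePoint.coe_ne_infty q)
        · exact h
      rw [this hi, this hj]
      exact ⟨1, Eventually.of_forall fun y => (one_mul _).symm⟩
    | coe p =>
      obtain ⟨g, h⟩ := agree (L := L) i j (coe_mem_pieceChart.1 hi) (coe_mem_pieceChart.1 hj)
      exact ⟨g, hev i j p g h⟩)
  exact ⟨A, hA, fun i j p g hi hj h => hg i j p g (coe_mem_pieceChart.2 hi)
    (coe_mem_pieceChart.2 hj) (hev i j p g h)⟩

/-! ### The tube -/

/-- The index of the band through which the knot runs in the `j`-th sixth of its period. -/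
def bandIndex (j : ℤ) : Fin 3 := Fin.ofNat 3 (j % 3).toNat

lemma bandIndex_add_one (j : ℤ) : bandIndex (j + 1) = bandIndex j + 1 := by
  have h : j % 3 = 0 ∨ j % 3 = 1 ∨ j % 3 = 2 := by omega
  unfold bandIndex
  rcases h with h | h | h
  · rw [h, show (j + 1) % 3 = 1 by omega]; rfl
  · rw [h, show (j + 1) % 3 = 2 by omega]; rfl
  · rw [h, show (j + 1) % 3 = 0 by omega]; rfl

lemma bandIndex_add_six (j : ℤ) : bandIndex (j + 6) = bandIndex j := by
  unfold bandIndex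
  rw [show (j + 6) % 3 = j % 3 by omega]

/-- For odd `j` the half-turn, and the identity otherwise. -/
def turnIf (j : ℤ) (x : ℂ × ℝ) : ℂ × ℝ := if Even j then x else halfTurn x

lemma halfTurn_halfTurn (x : ℂ × ℝ) : halfTurn (halfTurn x) = x := by
  simp [halfTurn]

lemma turnIf_even {j : ℤ} (h : Even j) (x : ℂ × ℝ) : turnIf j x = x := if_pos h

lemma turnIf_odd {j : ℤ} (h : ¬ Even j) (x : ℂ × ℝ) : turnIf j x = halfTurn x := if_neg h

lemma turnIf_add_one (j : ℤ) (x : ℂ × ℝ) : turnIf (j + 1) x = turnIf j (halfTurn x) := by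
  by_cases h : Even j
  · rw [turnIf_even h, turnIf_odd (by rwa [Int.even_add_one, not_not])]
  · rw [turnIf_odd h, turnIf_even (by rwa [Int.even_add_one]), halfTurn_halfTurn]

lemma continuous_turnIf (j : ℤ) : Continuous (turnIf j) := by
  unfold turnIf halfTurn
  split_ifs
  · exact continuous_id
  · fun_prop

/-- The part of the tube that follows the `j`-th passage through a band, `0 ≤ t ≤ 1`, and the arc
after it, `1 ≤ t ≤ 2`. -/
def leg (n : Fin 3 → ℕ) (j : ℤ) (t : ℝ) (w : ℂ) : ℂ × ℝ :=
  turnIf j (if t ≤ 1 then strand (n (bandIndex j)) (bandIndex j) t w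
    else arc (bandIndex j) (t - 1) w)

variable {n : Fin 3 → ℕ}

lemma leg_of_le (j : ℤ) {t : ℝ} (ht : t ≤ 1) (w : ℂ) :
    leg n j t w = turnIf j (strand (n (bandIndex j)) (bandIndex j) t w) := by
  rw [leg, if_pos ht]

lemma leg_of_lt (j : ℤ) {t : ℝ} (ht : 1 < t) (w : ℂ) :
    leg n j t w = turnIf j (arc (bandIndex j) (t - 1) w) := by
  rw [leg, if_neg ht.not_ge]

lemma exp_neg_odd {m : ℕ} (hm : Odd m) : Complex.exp (-(π * m : ℝ) * I) = -1 := by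
  obtain ⟨N, rfl⟩ := hm
  have : (-((π * (2 * N + 1 : ℕ) : ℝ) : ℂ)) * I = -((N : ℂ) * (2 * π * I) + π * I) := by
    push_cast; ring
  rw [this, Complex.exp_neg, Complex.exp_add, Complex.exp_nat_mul_two_pi_mul_I,
    Complex.exp_pi_mul_I]
  norm_num

lemma strand_one {m : ℕ} (hm : Odd m) (k : Fin 3) (w : ℂ) : strand m k 1 w = arc k 0 w := by
  rw [strand, arc, mul_one, exp_neg_odd hm]
  simp only [mul_zero, Real.cos_zero, Real.sin_zero, add_zero, mul_one, mul_neg_one]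
  ext
  · apply Complex.ext
    · simp; ring
    · simp
  · rfl

lemma arc_one (m : ℕ) (k : Fin 3) (w : ℂ) : arc k 1 w = halfTurn (strand m (k + 1) 0 w) := by
  rw [strand, arc, halfTurn]
  ext
  · apply Complex.ext
    · simp [Complex.conj_ofNat]; ring
    · simp [Complex.conj_ofNat, neg_div]
  · simp

lemma leg_two (n : Fin 3 → ℕ) (j : ℤ) (w : ℂ) : leg n j 2 w = leg n (j + 1) 0 w := by
  rw [leg_of_lt j one_lt_two, leg_of_le (j + 1) zero_le_one, bandIndex_add_one, turnIf_add_one,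
    ← arc_one]
  norm_num

lemma continuous_leg (hn : ∀ k, Odd (n k)) (j : ℤ) :
    Continuous fun x : ℝ × ℂ => leg n j x.1 x.2 := by
  refine (continuous_turnIf j).comp (Continuous.if_le ?_ ?_ continuous_fst continuous_const ?_)
  · unfold strand; fun_prop
  · unfold arc
    simp only [Complex.mk_eq_add_mul_I]
    fun_prop
  · intro x hx
    rw [hx, strand_one (hn _), sub_self]

lemma pretzelTube_eq_leg (n : Fin 3 → ℕ) (s : ℝ) (w : ℂ) :
    pretzelTube n s w = leg n ⌊6 * s⌋ (2 * Int.fract (6 * s)) w := rfl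

/-- On the closed `j`-th sixth of the period the tube is given by the `j`-th leg. -/
lemma pretzelTube_eq {j : ℤ} {s : ℝ} (h₀ : j ≤ 6 * s) (h₁ : 6 * s ≤ j + 1) (w : ℂ) :
    pretzelTube n s w = leg n j (12 * s - 2 * j) w := by
  rw [pretzelTube_eq_leg]
  rcases h₁.lt_or_eq with h | h
  · rw [Int.fract, Int.floor_eq_iff.2 ⟨h₀, h⟩]
    congr 1; ring
  · have hf : ⌊6 * s⌋ = j + 1 := by rw [h]; exact_mod_cast Int.floor_intCast (j + 1)
    rw [Int.fract, hf, h, ← (by linarith : (2 : ℝ) = 12 * s - 2 * j), leg_two]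
    push_cast; congr 1; ring

lemma pretzelTube_add_one (n : Fin 3 → ℕ) (s : ℝ) (w : ℂ) :
    pretzelTube n (s + 1) w = pretzelTube n s w := by
  have h : 6 * (s + 1) = 6 * s + (6 : ℤ) := by push_cast; ring
  rw [pretzelTube_eq_leg, pretzelTube_eq_leg, h, Int.fract_add_intCast, Int.floor_add_intCast]
  have he : Even (⌊6 * s⌋ + 6) ↔ Even ⌊6 * s⌋ := by
    rw [Int.even_add]; simp [show Even (6 : ℤ) by decide]
  simp only [leg, bandIndex_add_six, turnIf, he]

lemma continuous_pretzelTube (hn : ∀ k, Odd (n k)) :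
    Continuous fun x : ℝ × ℂ => pretzelTube n x.1 x.2 := by
  rw [continuous_iff_continuousAt]
  rintro ⟨s₀, w₀⟩
  set j := ⌊6 * s₀⌋ with hj
  have h0 : (j : ℝ) ≤ 6 * s₀ := Int.floor_le _
  have h1 : 6 * s₀ < j + 1 := Int.lt_floor_add_one _
  have hc : Continuous fun x : ℝ × ℂ => if 6 * x.1 ≤ j then leg n (j - 1) (12 * x.1 - 2 * (j - 1 : ℤ)) x.2
      else leg n j (12 * x.1 - 2 * j) x.2 := by
    refine Continuous.if_le ?_ ?_ (by fun_prop) continuous_const ?_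
    · exact (continuous_leg hn (j - 1)).comp
        (f := fun x : ℝ × ℂ => (12 * x.1 - 2 * (j - 1 : ℤ), x.2)) (by fun_prop)
    · exact (continuous_leg hn j).comp
        (f := fun x : ℝ × ℂ => (12 * x.1 - 2 * (j : ℝ), x.2)) (by fun_prop)
    · intro x hx
      have e1 : 12 * x.1 - 2 * (j - 1 : ℤ) = 2 := by push_cast; linarith
      have e2 : 12 * x.1 - 2 * (j : ℝ) = 0 := by linarith
      rw [e1, e2, leg_two, sub_add_cancel]
  refine hc.continuousAt.congr ?_
  have hcf : Continuous fun x : ℝ × ℂ => 6 * x.1 := by fun_prop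
  filter_upwards [hcf.continuousAt.eventually (lt_mem_nhds (show (j : ℝ) - 1 < 6 * s₀ by linarith)),
    hcf.continuousAt.eventually (gt_mem_nhds h1)] with x hx hx'
  split_ifs with h
  · exact (pretzelTube_eq (by push_cast; exact hx.le) (by push_cast; linarith) _).symm
  · exact (pretzelTube_eq (le_of_not_ge h) hx'.le _).symm

/-- The coordinate of the tube along a band in the rotating frame. -/
lemma untwist_turnIf_strand {m : ℕ} (hm : Odd m) (j : ℤ) (k : Fin 3) {t : ℝ} (h₀ : 0 ≤ t)
    (h₁ : t ≤ 1) (w : ℂ) :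
    untwist m k (turnIf j (strand m k t w)) = if Even j then -(1 - w / 4) else 1 - conj w / 4 := by
  split_ifs with h
  · rw [turnIf_even h, untwist, rel, strand, clamp_of_mem h₀ h₁]
    simp only [sub_sub_cancel_left]
    rw [mul_neg, mul_left_comm, ← Complex.exp_add]
    simp
  · rw [turnIf_odd h, untwist, rel, strand, halfTurn, clamp_of_mem (by simpa) (by simpa)]
    simp only [map_sub, map_mul, map_one, map_div₀, Complex.conj_ofNat, Complex.conj_natCast,
      ← Complex.exp_conj, map_neg, Complex.conj_I, Complex.conj_ofReal, sub_sub_cancel_left]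
    rw [mul_neg, mul_left_comm, ← Complex.exp_add]
    have : ((π * m * (1 - t) : ℝ) : ℂ) * I + -((π * m * t : ℝ) : ℂ) * -I = -(-((π * m : ℝ) : ℂ) * I) := by
      push_cast; ring
    rw [this, Complex.exp_neg, exp_neg_odd hm]
    norm_num

lemma snd_turnIf (j : ℤ) (x : ℂ × ℝ) : (turnIf j x).2 = if Even j then x.2 else 1 - x.2 := by
  unfold turnIf
  split_ifs <;> rfl

lemma gap_one_sub (z : ℝ) : gap (1 - z) = gap z := by
  unfold gap
  rw [← max_assoc, ← max_assoc, max_comm (1 - z - 1)]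
  congr 2 <;> ring_nf

lemma re_turnIf (j : ℤ) (x : ℂ × ℝ) : (turnIf j x).1.re = x.1.re := by
  unfold turnIf halfTurn
  split_ifs <;> simp

lemma im_turnIf (j : ℤ) (x : ℂ × ℝ) :
    (turnIf j x).1.im = if Even j then x.1.im else -x.1.im := by
  unfold turnIf halfTurn
  split_ifs <;> simp

lemma gap_turnIf (j : ℤ) (x : ℂ × ℝ) : gap (turnIf j x).2 = gap x.2 := by
  rw [snd_turnIf]
  split_ifs
  · rfl
  · rw [gap_one_sub]

lemma sqDist_turnIf (c : ℝ) (j : ℤ) (x : ℂ × ℝ) : sqDist c (turnIf j x) = sqDist c x := by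
  rw [sqDist, sqDist, gap_turnIf, re_turnIf]

lemma norm_rel_turnIf (k : Fin 3) (j : ℤ) (x : ℂ × ℝ) : ‖rel k (turnIf j x)‖ = ‖rel k x‖ := by
  unfold turnIf halfTurn
  split_ifs
  · rfl
  · rw [← RCLike.norm_conj (rel k x)]
    simp [rel, Complex.conj_ofNat]

lemma holeRegion_turnIf {r : Fin 3} {j : ℤ} {x : ℂ × ℝ} :
    turnIf j x ∈ holeRegion r ↔ x ∈ holeRegion r := by
  fin_cases r <;> simp [holeRegion, sqDist_turnIf]

lemma discRegion_turnIf {j : ℤ} {x : ℂ × ℝ} : turnIf j x ∈ discRegion ↔ x ∈ discRegion := by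
  simp [discRegion, sqDist_turnIf]

lemma cylinders_turnIf {j : ℤ} {x : ℂ × ℝ} : turnIf j x ∈ cylinders ↔ x ∈ cylinders := by
  simp only [cylinders, Set.mem_ofPred_eq, norm_rel_turnIf, snd_turnIf]
  refine exists_congr fun k => ?_
  split_ifs
  · rfl
  · constructor <;> rintro ⟨h1, h2, h3⟩ <;> exact ⟨h1, by linarith, by linarith⟩

lemma im_turnIf_ne {j : ℤ} {x : ℂ × ℝ} : (turnIf j x).1.im ≠ 0 ↔ x.1.im ≠ 0 := by
  rw [im_turnIf]
  split_ifs <;> simp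

/-- The piece around the disc on the level of the `j`-th arc. -/
def discPiece (j : ℤ) : Piece := if Even j then .upper else .lower

lemma mem_discPiece {j : ℤ} {x : ℂ × ℝ} :
    turnIf j x ∈ pieceSet n (discPiece j) ↔ (x.1.im ≠ 0 ∨ x ∈ discRegion) ∧ 1 < x.2 := by
  have h2 := snd_turnIf j x
  rw [← im_turnIf_ne (j := j), ← discRegion_turnIf (j := j)]
  unfold discPiece
  split_ifs at h2 ⊢
  · simp only [pieceSet, Set.mem_ofPred_eq, h2]
  · simp only [pieceSet, Set.mem_ofPred_eq, h2]
    constructor <;> rintro ⟨h, h'⟩ <;> exact ⟨h, by linarith⟩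

lemma mem_band {k : Fin 3} {s : Side} {x : ℂ × ℝ} (h₀ : 0 ≤ x.2) (h₁ : x.2 ≤ 1)
    (hu : ‖untwist (n k) k x‖ < 2)
    (h : (untwist (n k) k x).im ≠ 0 ∨ untwist (n k) k x ∈ sideRegion 0 s) :
    x ∈ pieceSet n (.band k s) := by
  have hg := gap_of_mem h₀ h₁
  refine ⟨by rwa [norm_untwist] at hu, by rw [hg]; norm_num, by rwa [hg]⟩

lemma snd_turnIf_strand_mem (m : ℕ) (j : ℤ) (k : Fin 3) {t : ℝ} (h₀ : 0 ≤ t) (h₁ : t ≤ 1) (w : ℂ) :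
    0 ≤ (turnIf j (strand m k t w)).2 ∧ (turnIf j (strand m k t w)).2 ≤ 1 := by
  rw [snd_turnIf, strand]
  split_ifs <;> constructor <;> simpa

lemma norm_untwist_strand {m : ℕ} (hm : Odd m) (j : ℤ) (k : Fin 3) {t : ℝ} (h₀ : 0 ≤ t)
    (h₁ : t ≤ 1) {w : ℂ} (hw : ‖w‖ = 1) : ‖untwist m k (turnIf j (strand m k t w))‖ < 2 := by
  have key : ∀ u : ℂ, ‖u‖ = 1 → ‖1 - u / 4‖ < 2 := fun u hu => by
    have h1 := norm_sub_le 1 (u / 4)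
    rw [norm_one, norm_div, hu, Complex.norm_ofNat] at h1
    linarith
  rw [untwist_turnIf_strand hm j k h₀ h₁]
  split_ifs
  · rw [norm_neg]; exact key w hw
  · exact key _ (by rwa [RCLike.norm_conj])

lemma strand_mem_mid (hn : ∀ k, Odd (n k)) (j : ℤ) (k : Fin 3) {t : ℝ} (h₀ : 0 ≤ t) (h₁ : t ≤ 1) :
    turnIf j (strand (n k) k t 1) ∈ pieceSet n (.band k .mid) := by
  obtain ⟨h2, h3⟩ := snd_turnIf_strand_mem (n k) j k h₀ h₁ 1
  refine mem_band h2 h3 (norm_untwist_strand (hn k) j k h₀ h₁ norm_one) (Or.inr ?_)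
  rw [untwist_turnIf_strand (hn k) j k h₀ h₁]
  rw [sideRegion, Set.mem_ofPred_eq, abs_lt]
  split_ifs <;> simp <;> norm_num

lemma eq_one_or_neg_one_of_im_eq_zero {w : ℂ} (hw : ‖w‖ = 1) (h : w.im = 0) :
    w = 1 ∨ w = -1 := by
  have h1 := Complex.abs_re_eq_norm.2 h
  rw [hw] at h1
  rcases eq_or_eq_neg_of_abs_eq h1 with h2 | h2
  · exact Or.inl (Complex.ext (by simp [h2]) (by simp [h]))
  · exact Or.inr (Complex.ext (by simp [h2]) (by simp [h]))

lemma exists_strand_mem (hn : ∀ k, Odd (n k)) (j : ℤ) (k : Fin 3) {t : ℝ} (h₀ : 0 ≤ t)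
    (h₁ : t ≤ 1) {w : ℂ} (hw : ‖w‖ = 1) :
    ∃ s, turnIf j (strand (n k) k t w) ∈ pieceSet n (.band k s) := by
  obtain ⟨h2, h3⟩ := snd_turnIf_strand_mem (n k) j k h₀ h₁ w
  have h4 := norm_untwist_strand (hn k) j k h₀ h₁ hw
  have h5 := untwist_turnIf_strand (hn k) j k h₀ h₁ w
  by_cases him : w.im = 0
  · rcases eq_one_or_neg_one_of_im_eq_zero hw him with rfl | rfl
    · exact ⟨.mid, strand_mem_mid hn j k h₀ h₁⟩
    · by_cases he : Even j
      · refine ⟨.left, mem_band h2 h3 h4 (Or.inr ?_)⟩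
        rw [h5, if_pos he, sideRegion, Set.mem_ofPred_eq]
        simp; norm_num
      · refine ⟨.right, mem_band h2 h3 h4 (Or.inr ?_)⟩
        rw [h5, if_neg he, sideRegion, Set.mem_ofPred_eq]
        simp; norm_num
  · refine ⟨.mid, mem_band h2 h3 h4 (Or.inl ?_)⟩
    rw [h5]
    split_ifs <;> simpa using him

/-- The abscissa of the centre of an arc. -/
def arcCenter (k : Fin 3) : ℝ := 2 * ((k : ℕ) : ℝ) + 2 * (((k + 1 : Fin 3) : ℕ) : ℝ)

/-- The abscissa, relative to the centre, of the starting point of a curve parallel to an arc. -/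
def arcStart (k : Fin 3) (w : ℂ) : ℝ := 4 * ((k : ℕ) : ℝ) + 1 - w.re / 4 - arcCenter k

lemma arc_eq (k : Fin 3) (t : ℝ) (w : ℂ) :
    arc k t w = (⟨arcCenter k + arcStart k w * Real.cos (π * t), -(w.im / 4)⟩,
      1 + |arcStart k w| * Real.sin (π * t)) := rfl

lemma arcCenter_values : arcCenter 0 = 2 ∧ arcCenter 1 = 6 ∧ arcCenter 2 = 4 := by
  refine ⟨?_, ?_, ?_⟩ <;> simp [arcCenter] <;> norm_num

lemma arcStart_values (w : ℂ) : arcStart 0 w = -1 - w.re / 4 ∧ arcStart 1 w = -1 - w.re / 4 ∧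
    arcStart 2 w = 5 - w.re / 4 := by
  obtain ⟨h0, h1, h2⟩ := arcCenter_values
  refine ⟨?_, ?_, ?_⟩ <;> simp [arcStart, h0, h1, h2] <;> ring

lemma arcStart_ne {k : Fin 3} {w : ℂ} (hw : ‖w‖ ≤ 1) : arcStart k w ≠ 0 := by
  obtain ⟨h0, h1, h2⟩ := arcStart_values w
  have := abs_le.1 ((Complex.abs_re_le_norm w).trans hw)
  fin_cases k <;> simp only [Fin.zero_eta, Fin.mk_one, Fin.reduceFinMk, h0, h1, h2] <;>
    intro h <;> linarith

lemma one_lt_snd_arc {k : Fin 3} {t : ℝ} (h₀ : 0 < t) (h₁ : t < 1) {w : ℂ} (hw : ‖w‖ ≤ 1) :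
    1 < (arc k t w).2 := by
  rw [arc_eq]
  have h1 : 0 < Real.sin (π * t) :=
    Real.sin_pos_of_pos_of_lt_pi (by positivity) (by nlinarith [Real.pi_pos])
  have h2 := abs_pos.2 (arcStart_ne (k := k) hw)
  simp only
  nlinarith [mul_pos h2 h1]

lemma sqDist_arc (k : Fin 3) {t : ℝ} (h₀ : 0 < t) (h₁ : t < 1) {w : ℂ} (hw : ‖w‖ ≤ 1) (c : ℝ) :
    sqDist c (arc k t w) = arcStart k w ^ 2 + (arcCenter k - c) ^ 2 +
      2 * (arcCenter k - c) * arcStart k w * Real.cos (π * t) := by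
  rw [sqDist, gap_of_one_le (one_lt_snd_arc h₀ h₁ hw).le, arc_eq]
  simp only [add_sub_cancel_left]
  rw [mul_pow, sq_abs, Real.sin_sq]
  ring

lemma arc_mem_discRegion (k : Fin 3) {t : ℝ} (h₀ : 0 < t) (h₁ : t < 1) :
    arc k t 1 ∈ discRegion := by
  have hw : ‖(1 : ℂ)‖ ≤ 1 := norm_one.le
  have h1 := Real.neg_one_le_cos (π * t)
  have h2 := Real.cos_le_one (π * t)
  obtain ⟨c0, c1, c2⟩ := arcCenter_values
  obtain ⟨s0, s1, s2⟩ := arcStart_values 1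
  rw [Complex.one_re] at s0 s1 s2
  rw [discRegion, Set.mem_ofPred_eq, sqDist_arc k h₀ h₁ hw, sqDist_arc k h₀ h₁ hw,
    sqDist_arc k h₀ h₁ hw]
  fin_cases k <;> simp only [Fin.zero_eta, Fin.mk_one, Fin.reduceFinMk, c0, c1, c2, s0, s1, s2] <;>
    refine ⟨?_, ?_, ?_⟩ <;> nlinarith

lemma arc_mem_holeRegion (k : Fin 3) {t : ℝ} (h₀ : 0 < t) (h₁ : t < 1) :
    arc k t (-1) ∈ holeRegion k := by
  have hw : ‖(-1 : ℂ)‖ ≤ 1 := by simp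
  obtain ⟨c0, c1, c2⟩ := arcCenter_values
  obtain ⟨s0, s1, s2⟩ := arcStart_values (-1)
  rw [Complex.neg_re, Complex.one_re] at s0 s1 s2
  fin_cases k <;> simp only [Fin.zero_eta, Fin.mk_one, Fin.reduceFinMk, holeRegion,
    Set.mem_ofPred_eq] <;> rw [sqDist_arc _ h₀ h₁ hw]
  · rw [c0, s0]; norm_num
  · rw [c1, s1]; norm_num
  · rw [c2, s2]; norm_num

lemma exists_arc_mem (j : ℤ) (k : Fin 3) {t : ℝ} (h₀ : 0 < t) (h₁ : t < 1) {w : ℂ}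
    (hw : ‖w‖ = 1) : ∃ i, turnIf j (arc k t w) ∈ pieceSet n i := by
  have hz := one_lt_snd_arc (k := k) h₀ h₁ hw.le
  by_cases him : w.im = 0
  · rcases eq_one_or_neg_one_of_im_eq_zero hw him with rfl | rfl
    · exact ⟨discPiece j, mem_discPiece.2 ⟨Or.inr (arc_mem_discRegion k h₀ h₁), hz⟩⟩
    · refine ⟨.hole k, Or.inr (holeRegion_turnIf.2 (arc_mem_holeRegion k h₀ h₁)), ?_⟩
      rw [cylinders_turnIf]
      rintro ⟨k', -, -, h⟩
      linarith
  · exact ⟨discPiece j, mem_discPiece.2 ⟨Or.inl (by simpa [arc_eq] using him), hz⟩⟩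

lemma exists_floor_le (s : ℝ) : ∃ j : ℤ, (j : ℝ) ≤ 6 * s ∧ 6 * s ≤ j + 1 :=
  ⟨⌊6 * s⌋, Int.floor_le _, (Int.lt_floor_add_one _).le⟩

lemma pretzelTube_strand (j : ℤ) {t : ℝ} (h₀ : 0 ≤ t) (h₁ : t ≤ 1) (w : ℂ) :
    pretzelTube n ((2 * j + t) / 12) w = turnIf j (strand (n (bandIndex j)) (bandIndex j) t w) := by
  rw [pretzelTube_eq (j := j) (by linarith) (by linarith), ← leg_of_le j h₁]
  congr 1; ring

lemma pretzelTube_arc (j : ℤ) {t : ℝ} (h₀ : 0 < t) (h₁ : t ≤ 1) (w : ℂ) :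
    pretzelTube n ((2 * j + 1 + t) / 12) w = turnIf j (arc (bandIndex j) t w) := by
  have ht : 1 < 1 + t := by linarith
  have := leg_of_lt (n := n) j ht w
  rw [add_sub_cancel_left] at this
  rw [pretzelTube_eq (j := j) (by linarith) (by linarith), ← this]
  congr 1; ring

/-- A cross-section of the tube belongs to a strand in a band or to the interior of an arc. -/
lemma exists_strand_or_arc (n : Fin 3 → ℕ) (s : ℝ) : ∃ (j : ℤ) (k : Fin 3) (t : ℝ),
    (0 ≤ t ∧ t ≤ 1 ∧ ∀ w, pretzelTube n s w = turnIf j (strand (n k) k t w)) ∨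
    (0 < t ∧ t < 1 ∧ ∀ w, pretzelTube n s w = turnIf j (arc k t w)) := by
  obtain ⟨j, h0, h1⟩ := exists_floor_le s
  rcases le_or_gt (12 * s - 2 * j) 1 with ht | ht
  · refine ⟨j, bandIndex j, 12 * s - 2 * j, Or.inl ⟨by linarith, ht, fun w => ?_⟩⟩
    rw [← pretzelTube_strand j (by linarith) ht]
    congr 1; ring
  · rcases (show 12 * s - 2 * j ≤ 2 by linarith).lt_or_eq with ht' | ht'
    · refine ⟨j, bandIndex j, 12 * s - 2 * j - 1,
        Or.inr ⟨by linarith, by linarith, fun w => ?_⟩⟩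
      rw [← pretzelTube_arc j (by linarith) (by linarith)]
      congr 1; ring
    · refine ⟨j + 1, bandIndex (j + 1), 0, Or.inl ⟨le_rfl, zero_le_one, fun w => ?_⟩⟩
      rw [← pretzelTube_strand (j + 1) le_rfl zero_le_one]
      congr 1; push_cast; linarith

/-- The boundary torus of the tube is covered by the charts. -/
lemma exists_pretzelTube_mem (hn : ∀ k, Odd (n k)) (s : ℝ) {w : ℂ} (hw : ‖w‖ = 1) :
    ∃ i, pretzelTube n s w ∈ pieceSet n i := by
  obtain ⟨j, k, t, ⟨h0, h1, h⟩ | ⟨h0, h1, h⟩⟩ := exists_strand_or_arc n s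
  · rw [h]
    obtain ⟨s', h'⟩ := exists_strand_mem hn j k h0 h1 hw
    exact ⟨_, h'⟩
  · rw [h]
    exact exists_arc_mem j k h0 h1 hw

lemma exists_bandIndex_eq (k : Fin 3) (b : Prop) : ∃ j : ℤ, bandIndex j = k ∧ (Even j ↔ b) := by
  by_cases hb : b
  · fin_cases k
    · exact ⟨0, rfl, by simp [hb]⟩
    · exact ⟨4, rfl, by simp [hb]; decide⟩
    · exact ⟨2, rfl, by simp [hb]⟩
  · fin_cases k
    · exact ⟨3, rfl, by simp [hb]; decide⟩
    · exact ⟨1, rfl, by simp [hb]⟩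
    · exact ⟨5, rfl, by simp [hb]; decide⟩

lemma exists_arc_eq (k : Fin 3) {x : ℂ × ℝ} (hy : x.1.im = 0) (hz : 1 < x.2)
    (h : sqDist (arcCenter k) x = arcStart k 0 ^ 2) : ∃ t, 0 < t ∧ t ≤ 1 ∧ arc k t 0 = x := by
  have hu := arcStart_ne (k := k) (w := 0) (by simp)
  set u := arcStart k 0 with hu'
  set X := x.1.re - arcCenter k with hX
  rw [sqDist, gap_of_one_le hz.le, ← hX] at h
  have hpi := Real.pi_pos
  have h1 : (X / u) ^ 2 < 1 := by
    rw [div_pow, div_lt_one (by positivity)]; nlinarith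
  have h2 : |X / u| < 1 := by rwa [sq_lt_one_iff_abs_lt_one] at h1
  rw [abs_lt] at h2
  have hcos := Real.cos_arccos h2.1.le h2.2.le
  have hsin := Real.sin_arccos (X / u)
  have e : π * (Real.arccos (X / u) / π) = Real.arccos (X / u) := by field_simp
  have h3 : 1 - (X / u) ^ 2 = ((x.2 - 1) / |u|) ^ 2 := by
    rw [div_pow, div_pow, sq_abs]; field_simp; linarith
  rw [h3, Real.sqrt_sq (div_nonneg (by linarith) (abs_nonneg _))] at hsin
  refine ⟨Real.arccos (X / u) / π, div_pos (Real.arccos_pos.2 h2.2) hpi,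
    (div_le_one hpi).2 (Real.arccos_le_pi _), ?_⟩
  rw [arc_eq, e, hcos, hsin, ← hu']
  have hu2 := abs_ne_zero.2 hu
  ext
  · apply Complex.ext
    · simp only; rw [mul_div_cancel₀ _ hu, hX]; ring
    · simp [hy]
  · simp only; rw [mul_div_cancel₀ _ hu2]; ring

lemma exists_core_of_arc (k : Fin 3) {x : ℂ × ℝ} (hy : x.1.im = 0) (hz : ¬ (0 ≤ x.2 ∧ x.2 ≤ 1))
    (h : sqDist (arcCenter k) x = arcStart k 0 ^ 2) : ∃ s, x = pretzelTube n s 0 := by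
  obtain ⟨j, hj, he⟩ := exists_bandIndex_eq k (1 < x.2)
  obtain ⟨t, h0, h1, ht⟩ := exists_arc_eq k (x := turnIf j x)
    (by rw [im_turnIf, hy]; simp) (by
      rw [snd_turnIf]
      by_cases h : 1 < x.2
      · rwa [if_pos (he.2 h)]
      · rw [if_neg (mt he.1 h)]
        have : ¬ 0 ≤ x.2 := fun h' => hz ⟨h', not_lt.1 h⟩
        linarith)
    (by rwa [sqDist_turnIf])
  refine ⟨(2 * j + 1 + t) / 12, ?_⟩
  rw [pretzelTube_arc j h0 h1, hj, ht]
  unfold turnIf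
  split_ifs
  · rfl
  · rw [halfTurn_halfTurn]

lemma exists_core_of_strand (hn : ∀ k, Odd (n k)) (k : Fin 3) {x : ℂ × ℝ}
    (hz : 0 ≤ x.2 ∧ x.2 ≤ 1) (hy : (untwist (n k) k x).im = 0)
    (hx : |(untwist (n k) k x).re| = 1) : ∃ s, x = pretzelTube n s 0 := by
  set u := untwist (n k) k x with hu
  obtain ⟨j, hj, he⟩ := exists_bandIndex_eq k (u.re = -1)
  let t := if Even j then x.2 else 1 - x.2
  have ht : 0 ≤ t ∧ t ≤ 1 := by
    simp only [t]; split_ifs <;> constructor <;> linarith [hz.1, hz.2]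
  refine ⟨(2 * j + t) / 12, ?_⟩
  rw [pretzelTube_strand j ht.1 ht.2, hj]
  set y := turnIf j (strand (n k) k t 0) with hyd
  have h2 : y.2 = x.2 := by
    rw [hyd, snd_turnIf, strand]
    simp only [t]; split_ifs <;> ring
  have huy : untwist (n k) k y = u := by
    rw [hyd, untwist_turnIf_strand (hn k) j k ht.1 ht.2]
    by_cases h : u.re = -1
    · rw [if_pos (he.2 h)]
      apply Complex.ext <;> simp [h, hy]
    · rw [if_neg (mt he.1 h)]
      have := (eq_or_eq_neg_of_abs_eq hx).resolve_right h
      apply Complex.ext <;> simp [this, hy]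
  rw [hu, untwist, untwist, h2] at huy
  have h3 := mul_left_cancel₀ (Complex.exp_ne_zero _) huy
  ext1
  · exact (sub_left_injective h3).symm
  · exact h2.symm

/-- Every point outside the charts lies on the core of the tube. -/
lemma exists_mem_or_core (hn : ∀ k, Odd (n k)) (x : ℂ × ℝ) :
    (∃ i, x ∈ pieceSet n i) ∨ ∃ s, x = pretzelTube n s 0 := by
  by_cases hc : x ∈ cylinders
  · obtain ⟨k, hk, hz⟩ := hc
    have h2 : ‖untwist (n k) k x‖ < 2 := by rw [norm_untwist]; linarith
    by_cases hy : (untwist (n k) k x).im = 0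
    · rcases lt_trichotomy |(untwist (n k) k x).re| 1 with h | h | h
      · exact Or.inl ⟨.band k .mid, mem_band hz.1 hz.2 h2 (Or.inr (by simpa [sideRegion] using h))⟩
      · exact Or.inr (exists_core_of_strand hn k hz hy h)
      · rcases lt_abs.1 h with h | h
        · exact Or.inl ⟨.band k .right,
            mem_band hz.1 hz.2 h2 (Or.inr (by simpa [sideRegion] using h))⟩
        · exact Or.inl ⟨.band k .left,
            mem_band hz.1 hz.2 h2 (Or.inr (by simp only [sideRegion, Set.mem_ofPred_eq]; linarith))⟩
    · exact Or.inl ⟨.band k .mid, mem_band hz.1 hz.2 h2 (Or.inl hy)⟩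
  by_cases hy : x.1.im = 0
  swap
  · exact Or.inl ⟨.hole 0, Or.inl hy, hc⟩
  by_cases hh : ∃ r, x ∈ holeRegion r
  · obtain ⟨r, hr⟩ := hh
    exact Or.inl ⟨.hole r, Or.inr hr, hc⟩
  push Not at hh
  have h0 : 1 ≤ sqDist 2 x := not_lt.1 (hh 0)
  have h1 : 1 ≤ sqDist 6 x := not_lt.1 (hh 1)
  have h2 : sqDist 4 x ≤ 25 := not_lt.1 (hh 2)
  by_cases hz : 0 ≤ x.2 ∧ x.2 ≤ 1
  · exfalso
    simp only [sqDist, gap_of_mem hz.1 hz.2] at h0 h1 h2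
    have key : ∃ k, ‖rel k x‖ ≤ 3 / 2 := by
      simp only [← Complex.abs_re_eq_norm.2 ((rel_im _ x).trans hy), rel_re]
      by_contra! h
      have a0 := lt_abs.1 (h 0)
      have a1 := lt_abs.1 (h 1)
      have a2 := lt_abs.1 (h 2)
      simp at a0 a1 a2
      rcases a0 with a0 | a0 <;> rcases a1 with a1 | a1 <;> rcases a2 with a2 | a2 <;> nlinarith
    obtain ⟨k, hk⟩ := key
    exact hc ⟨k, hk, hz⟩
  · obtain ⟨c0, c1, c2⟩ := arcCenter_values
    obtain ⟨s0, s1, s2⟩ := arcStart_values 0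
    rcases h0.lt_or_eq with h0 | h0
    swap
    · exact Or.inr (exists_core_of_arc 0 hy hz (by rw [c0, s0, ← h0]; norm_num))
    rcases h1.lt_or_eq with h1 | h1
    swap
    · exact Or.inr (exists_core_of_arc 1 hy hz (by rw [c1, s1, ← h1]; norm_num))
    rcases h2.lt_or_eq with h2 | h2
    swap
    · exact Or.inr (exists_core_of_arc 2 hy hz (by rw [c2, s2, h2]; norm_num))
    have hd : x ∈ discRegion := ⟨h0, h1, h2⟩
    rcases lt_or_ge x.2 0 with hz' | hz'
    · exact Or.inl ⟨.lower, Or.inr hd, hz'⟩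
    · exact Or.inl ⟨.upper, Or.inr hd, lt_of_not_ge fun h => hz ⟨hz', h⟩⟩

/-- Strands of different bands do not meet, nor do the two strands of one band. -/
lemma eq_of_strand_eq (hn : ∀ k, Odd (n k)) {j j' : ℤ} {k k' : Fin 3} {t t' : ℝ} (h₀ : 0 ≤ t)
    (h₁ : t ≤ 1) (h₀' : 0 ≤ t') (h₁' : t' ≤ 1) {w w' : ℂ} (hw : ‖w‖ ≤ 1) (hw' : ‖w'‖ ≤ 1)
    (h : turnIf j (strand (n k) k t w) = turnIf j' (strand (n k') k' t' w')) : w = w' := by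
  have re4 : ∀ {u : ℂ}, ‖u‖ ≤ 1 → u.re ≤ 1 ∧ -1 ≤ u.re := fun {u} hu => by
    have := abs_le.1 ((Complex.abs_re_le_norm u).trans hu)
    exact ⟨this.2, this.1⟩
  have hrel : ∀ {j : ℤ} {k : Fin 3} {t : ℝ} {w : ℂ}, 0 ≤ t → t ≤ 1 → ‖w‖ ≤ 1 →
      ‖rel k (turnIf j (strand (n k) k t w))‖ ≤ 5 / 4 := by
    intro j k t w h0 h1 hw
    have key : ∀ u : ℂ, ‖u‖ ≤ 1 → ‖1 - u / 4‖ ≤ 5 / 4 := fun u hu => by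
      have h1 := norm_sub_le 1 (u / 4)
      rw [norm_one, norm_div, Complex.norm_ofNat] at h1
      linarith
    rw [← norm_untwist (n k), untwist_turnIf_strand (hn k) j k h0 h1]
    split_ifs
    · rw [norm_neg]; exact key w hw
    · exact key _ (by rwa [RCLike.norm_conj])
  have hk : k = k' := by
    have e1 := abs_le.1 ((Complex.abs_re_le_norm _).trans (hrel (j := j) (k := k) h₀ h₁ hw))
    have e2 := abs_le.1 ((Complex.abs_re_le_norm _).trans (hrel (j := j') (k := k') h₀' h₁' hw'))
    rw [← h, rel_re] at e2
    rw [rel_re] at e1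
    generalize (turnIf j (strand (n k) k t w)).1.re = x at e1 e2
    fin_cases k <;> fin_cases k' <;> simp at e1 e2 ⊢ <;> linarith
  subst hk
  have hu := congrArg (untwist (n k) k) h
  rw [untwist_turnIf_strand (hn k) j k h₀ h₁, untwist_turnIf_strand (hn k) j' k h₀' h₁'] at hu
  have hre := congrArg Complex.re hu
  split_ifs at hu hre
  · linear_combination 4 * hu
  · exfalso
    simp at hre
    linarith [(re4 hw).1, (re4 hw').1]
  · exfalso
    simp at hre
    linarith [(re4 hw).1, (re4 hw').1]
  · apply (starRingEnd ℂ).injective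
    linear_combination -4 * hu

lemma eq_of_arc_eq {j j' : ℤ} {k k' : Fin 3} {t t' : ℝ} (h₀ : 0 < t)
    (h₁ : t < 1) (h₀' : 0 < t') (h₁' : t' < 1) {w w' : ℂ} (hw : ‖w‖ ≤ 1) (hw' : ‖w'‖ ≤ 1)
    (h : turnIf j (arc k t w) = turnIf j' (arc k' t' w')) : w = w' := by
  obtain ⟨c0, c1, c2⟩ := arcCenter_values
  obtain ⟨s0, s1, s2⟩ := arcStart_values w
  obtain ⟨s0', s1', s2'⟩ := arcStart_values w'
  have r1 := abs_le.1 ((Complex.abs_re_le_norm w).trans hw)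
  have r1' := abs_le.1 ((Complex.abs_re_le_norm w').trans hw')
  have a1 := Real.neg_one_le_cos (π * t)
  have a2 := Real.cos_le_one (π * t)
  have a1' := Real.neg_one_le_cos (π * t')
  have a2' := Real.cos_le_one (π * t')
  have hsq : ∀ c, sqDist c (arc k t w) = sqDist c (arc k' t' w') := fun c => by
    rw [← sqDist_turnIf c j, h, sqDist_turnIf]
  have hz := one_lt_snd_arc (k := k) h₀ h₁ hw
  have hz' := one_lt_snd_arc (k := k') h₀' h₁' hw'
  have hj : Even j ↔ Even j' := by
    have := congrArg Prod.snd h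
    rw [snd_turnIf, snd_turnIf] at this
    split_ifs at this with h1 h2 h2
    · simp [h1, h2]
    · linarith
    · linarith
    · simp [h1, h2]
  have him : w.im = w'.im := by
    have := congrArg (fun x => x.1.im) h
    simp only [im_turnIf, hj, arc_eq] at this
    split_ifs at this <;> linarith
  have d0 := hsq (arcCenter k)
  have d1 := hsq (arcCenter k')
  rw [sqDist_arc k h₀ h₁ hw, sqDist_arc k' h₀' h₁' hw'] at d0 d1
  have hk : k = k' := by
    have q1 : |arcStart k w * Real.cos (π * t)| ≤ |arcStart k w| := by
      rw [abs_mul]; exact mul_le_of_le_one_right (abs_nonneg _) (Real.abs_cos_le_one _)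
    have q1' : |arcStart k' w' * Real.cos (π * t')| ≤ |arcStart k' w'| := by
      rw [abs_mul]; exact mul_le_of_le_one_right (abs_nonneg _) (Real.abs_cos_le_one _)
    rw [mul_assoc] at d0 d1
    rw [mul_assoc _ (arcStart k' w')] at d0 d1
    generalize arcStart k w * Real.cos (π * t) = q at d0 d1 q1
    generalize arcStart k' w' * Real.cos (π * t') = q' at d0 d1 q1'
    clear hsq hz hz' him hj h a1 a2 a1' a2' hw hw'
    fin_cases k <;> fin_cases k' <;>
      simp only [Fin.zero_eta, Fin.mk_one, Fin.reduceFinMk, c0, c1, c2, s0, s1, s2, s0', s1', s2']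
        at d0 d1 q1 q1' ⊢ <;> exfalso
    · rw [abs_of_neg (by linarith : -1 - w.re / 4 < 0), abs_le] at q1
      nlinarith
    · rw [abs_of_pos (by linarith : 0 < 5 - w'.re / 4), abs_le] at q1'
      nlinarith
    · rw [abs_of_neg (by linarith : -1 - w.re / 4 < 0), abs_le] at q1
      nlinarith
    · rw [abs_of_pos (by linarith : 0 < 5 - w'.re / 4), abs_le] at q1'
      nlinarith
    · rw [abs_of_pos (by linarith : 0 < 5 - w.re / 4), abs_le] at q1
      nlinarith
    · rw [abs_of_pos (by linarith : 0 < 5 - w.re / 4), abs_le] at q1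
      nlinarith
  subst hk
  have d2 : arcStart k w ^ 2 = arcStart k w' ^ 2 := by linear_combination d0
  refine Complex.ext ?_ him
  clear hsq hz hz' him hj h a1 a2 a1' a2' hw hw' d0 d1
  fin_cases k <;> simp only [Fin.zero_eta, Fin.mk_one, Fin.reduceFinMk, s0, s1, s2, s0', s1', s2']
    at d2 <;> nlinarith

/-- The tubular neighbourhoods of different radii do not meet. -/
lemma eq_of_pretzelTube_eq (hn : ∀ k, Odd (n k)) {s s' : ℝ} {w w' : ℂ} (hw : ‖w‖ ≤ 1)
    (hw' : ‖w'‖ ≤ 1) (h : pretzelTube n s w = pretzelTube n s' w') : w = w' := by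
  have key : ∀ {j j' : ℤ} {k k' : Fin 3} {t t' : ℝ} {w w' : ℂ}, 0 ≤ t → t ≤ 1 → 0 < t' → t' < 1 →
      ‖w'‖ ≤ 1 → turnIf j (strand (n k) k t w) ≠ turnIf j' (arc k' t' w') := by
    intro j j' k k' t t' w w' h0 h1 h0' h1' hw' he
    have hz := snd_turnIf_strand_mem (n k) j k h0 h1 w
    have hz' := one_lt_snd_arc (k := k') h0' h1' hw'
    rw [he, snd_turnIf] at hz
    split_ifs at hz <;> linarith [hz.1, hz.2]
  obtain ⟨j, k, t, ⟨h0, h1, e⟩ | ⟨h0, h1, e⟩⟩ := exists_strand_or_arc n s <;>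
  obtain ⟨j', k', t', ⟨h0', h1', e'⟩ | ⟨h0', h1', e'⟩⟩ := exists_strand_or_arc n s' <;>
  rw [e, e'] at h
  · exact eq_of_strand_eq hn h0 h1 h0' h1' hw hw' h
  · exact absurd h (key h0 h1 h0' h1' hw')
  · exact absurd h.symm (key h0' h1' h0 h1 hw)
  · exact eq_of_arc_eq h0 h1 h0' h1' hw hw' h

/-! ### Longitude and meridian -/

section
variable {G : Type*} [Group G]

namespace FlatAtlas
variable {Y Z ι : Type*} [TopologicalSpace Y] [TopologicalSpace Z] {A : FlatAtlas G Y ι}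

/-- Relative to a gauge, a primitive is constant along connected sets that stay in the chart. -/
lemma IsPrimitive.eq_of_isPreconnected {φ : Z → Y} {P : Z → G} (h : A.IsPrimitive φ P) {i : ι}
    {S : Set Z} (hS : IsPreconnected S) (hi : ∀ z ∈ S, φ z ∈ A.chart i) {z z' : Z} (hz : z ∈ S)
    (hz' : z' ∈ S) : P z * (A.gauge i (φ z))⁻¹ = P z' * (A.gauge i (φ z'))⁻¹ := by
  have : PreconnectedSpace S := Subtype.preconnectedSpace hS
  have hl : IsLocallyConstant fun x : S => P x * (A.gauge i (φ x))⁻¹ := by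
    rw [IsLocallyConstant.iff_eventually_eq]
    exact fun x => continuous_subtype_val.continuousAt.eventually (h x i (hi x x.2))
  exact hl.apply_eq_of_preconnectedSpace ⟨z, hz⟩ ⟨z', hz'⟩

lemma change_gauge (p : G) (y : Y) {i j : ι} {g : G} (hg : A.gauge i y * (A.gauge j y)⁻¹ = g) :
    p * (A.gauge j y)⁻¹ = p * (A.gauge i y)⁻¹ * g := by
  rw [← hg]; group

end FlatAtlas

variable {N : Fin 3 → ℕ} {L : Labelling G N} {A : FlatAtlas G (OnePoint (ℂ × ℝ)) Piece}

lemma IsPretzelAtlas.mem_chart (hA : IsPretzelAtlas L A) {i : Piece} {p : ℂ × ℝ} :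
    (p : OnePoint (ℂ × ℝ)) ∈ A.chart i ↔ p ∈ pieceSet (halfTwists N) i := by
  rw [hA.chart_eq, coe_mem_pieceChart]

/-- The transition from the disc on the level of the `j`-th arc to the `k`-th band. -/
def Labelling.discBand (L : Labelling G N) (j : ℤ) (k : Fin 3) : G :=
  if Even j then L.around k ^ N k else L.hole k * L.lower⁻¹

lemma IsPretzelAtlas.discPiece_mid (hA : IsPretzelAtlas L A) (j : ℤ) (k : Fin 3) {p : ℂ × ℝ}
    (h : p ∈ pieceSet (halfTwists N) (discPiece j))
    (h' : p ∈ pieceSet (halfTwists N) (.band k .mid)) :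
    A.gauge (discPiece j) p * (A.gauge (.band k .mid) p)⁻¹ = (L.discBand j k)⁻¹ := by
  refine hA.transition _ _ _ _ h h' ?_
  unfold Labelling.discBand discPiece at *
  split_ifs at h ⊢
  · filter_upwards [exists_upper_mid L k h.2] with q hq hq'
    exact hq hq'.1
  · filter_upwards [exists_lower_mid L k h.2] with q hq hq'
    exact hq hq'.1

lemma bandChart_of_strand (hA : IsPretzelAtlas L A) (j : ℤ) {s : ℝ} (h₀ : (j : ℝ) / 6 ≤ s)
    (h₁ : s ≤ j / 6 + 1 / 12) :
    (pretzelTube (halfTwists N) s 1 : OnePoint (ℂ × ℝ)) ∈ A.chart (.band (bandIndex j) .mid) := by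
  have e : s = (2 * j + (12 * s - 2 * j)) / 12 := by ring
  rw [hA.mem_chart, e, pretzelTube_strand j (by linarith) (by linarith)]
  exact strand_mem_mid (odd_halfTwists N) j _ (by linarith) (by linarith)

lemma discChart_of_arc (hA : IsPretzelAtlas L A) (j : ℤ) {s : ℝ} (h₀ : (j : ℝ) / 6 + 1 / 12 < s)
    (h₁ : s < (j + 1) / 6) :
    (pretzelTube (halfTwists N) s 1 : OnePoint (ℂ × ℝ)) ∈ A.chart (discPiece j) := by
  have e : s = (2 * j + 1 + (12 * s - 2 * j - 1)) / 12 := by ring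
  rw [hA.mem_chart, e, pretzelTube_arc j (by linarith) (by linarith), mem_discPiece]
  exact ⟨Or.inr (arc_mem_discRegion _ (by linarith) (by linarith)),
    one_lt_snd_arc (by linarith) (by linarith) norm_one.le⟩

/-- How a primitive along the longitude changes from a passage through a band to the next. -/
lemma longitude_step (hA : IsPretzelAtlas L A) {Q : ℝ → G}
    (hQ : A.IsPrimitive (fun s : ℝ => (pretzelTube (halfTwists N) s 1 : OnePoint (ℂ × ℝ))) Q)
    (j : ℤ) : Q ((j + 1 : ℤ) / 6) * (A.gauge (.band (bandIndex (j + 1)) .mid)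
        (pretzelTube (halfTwists N) ((j + 1 : ℤ) / 6) 1))⁻¹ =
      Q (j / 6) * (A.gauge (.band (bandIndex j) .mid)
        (pretzelTube (halfTwists N) (j / 6) 1))⁻¹ *
        (L.discBand j (bandIndex j) * (L.discBand j (bandIndex j + 1))⁻¹) := by
  set c : ℝ → OnePoint (ℂ × ℝ) := fun s => (pretzelTube (halfTwists N) s 1 : OnePoint (ℂ × ℝ))
    with hc
  have hcc : Continuous c := OnePoint.continuous_coe.comp
    ((continuous_pretzelTube (odd_halfTwists N)).comp (by fun_prop : Continuous fun s : ℝ => (s, (1:ℂ))))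
  set k := bandIndex j
  rw [bandIndex_add_one]
  have hm : ∀ s : ℝ, (j : ℝ) / 6 ≤ s → s ≤ j / 6 + 1 / 12 → c s ∈ A.chart (.band k .mid) :=
    fun s h h' => bandChart_of_strand hA j h h'
  have hm' : c ((j + 1 : ℤ) / 6) ∈ A.chart (.band (k + 1) .mid) := by
    rw [← bandIndex_add_one]
    exact bandChart_of_strand hA (j + 1) le_rfl (by linarith)
  have hd : ∀ s ∈ Set.Ioo ((j : ℝ) / 6 + 1 / 12) ((j + 1) / 6), c s ∈ A.chart (discPiece j) :=
    fun s hs => discChart_of_arc hA j hs.1 hs.2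
  -- a point of the arc near its beginning, still in the chart of the band
  obtain ⟨s₂, ⟨h2, h2'⟩, h2r⟩ : ∃ s, (c s ∈ A.chart (.band k .mid) ∧
      Q s * (A.gauge (.band k .mid) (c s))⁻¹ = Q (j / 6 + 1 / 12) *
        (A.gauge (.band k .mid) (c (j / 6 + 1 / 12)))⁻¹) ∧
      s ∈ Set.Ioo ((j : ℝ) / 6 + 1 / 12) ((j + 1) / 6) := by
    have hmem := hm (j / 6 + 1 / 12) (by linarith) le_rfl
    have h := (hcc.continuousAt.eventually ((A.isOpen_chart _).mem_nhds hmem)).and (hQ _ _ hmem)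
    have h' := h.filter_mono (nhdsWithin_le_nhds (s := Set.Ioi ((j : ℝ) / 6 + 1 / 12)))
    exact (h'.and (Ioo_mem_nhdsGT (by linarith))).exists
  -- and one near its end
  obtain ⟨s₃, ⟨h3, h3'⟩, h3r⟩ : ∃ s, (c s ∈ A.chart (.band (k + 1) .mid) ∧
      Q s * (A.gauge (.band (k + 1) .mid) (c s))⁻¹ = Q ((j + 1 : ℤ) / 6) *
        (A.gauge (.band (k + 1) .mid) (c ((j + 1 : ℤ) / 6)))⁻¹) ∧
      s ∈ Set.Ioo ((j : ℝ) / 6 + 1 / 12) ((j + 1) / 6) := by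
    have h := (hcc.continuousAt.eventually ((A.isOpen_chart _).mem_nhds hm')).and (hQ _ _ hm')
    have h' := h.filter_mono (nhdsWithin_le_nhds (s := Set.Iio (((j + 1 : ℤ) : ℝ) / 6)))
    obtain ⟨s, h4, h5⟩ := (h'.and (Ioo_mem_nhdsLT
      (show (j : ℝ) / 6 + 1 / 12 < ((j + 1 : ℤ) : ℝ) / 6 by push_cast; linarith))).exists
    exact ⟨s, h4, by push_cast at h5; exact h5⟩
  have e1 := hQ.eq_of_isPreconnected (i := .band k .mid) (isPreconnected_Icc (a := (j : ℝ) / 6)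
    (b := j / 6 + 1 / 12)) (fun z hz => hm z hz.1 hz.2) (Set.left_mem_Icc.2 (by linarith))
    (Set.right_mem_Icc.2 (by linarith))
  have e2 := hQ.eq_of_isPreconnected isPreconnected_Ioo hd h2r h3r
  have t2 := hA.discPiece_mid j k (hA.mem_chart.1 (hd _ h2r)) (hA.mem_chart.1 h2)
  have t3 := hA.discPiece_mid j (k + 1) (hA.mem_chart.1 (hd _ h3r)) (hA.mem_chart.1 h3)
  have t2' := FlatAtlas.change_gauge (Q s₂) (c s₂) t2
  have t3' := FlatAtlas.change_gauge (Q s₃) (c s₃) t3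
  change _ = Q (j / 6) * (A.gauge (.band k .mid) (c (j / 6)))⁻¹ * _
  calc _ = _ := h3'.symm
    _ = _ := t3'
    _ = Q s₂ * (A.gauge (discPiece j) (c s₂))⁻¹ * (L.discBand j (k + 1))⁻¹ := by rw [e2]
    _ = Q s₂ * (A.gauge (.band k .mid) (c s₂))⁻¹ * L.discBand j k *
        (L.discBand j (k + 1))⁻¹ := by rw [t2']; group
    _ = _ := by rw [h2', ← e1]; group

/-- The value of a labelling on the longitude, up to conjugation. -/
def Labelling.longitude (L : Labelling G N) : G :=
  (L.around 0 ^ N 0 * (L.around 1 ^ N 1)⁻¹) * (L.hole 1 * (L.hole 2)⁻¹) *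
  (L.around 2 ^ N 2 * (L.around 0 ^ N 0)⁻¹) * (L.hole 0 * (L.hole 1)⁻¹) *
  (L.around 1 ^ N 1 * (L.around 2 ^ N 2)⁻¹) * (L.hole 2 * (L.hole 0)⁻¹)

/-- The value of a labelling on the meridian, up to conjugation by the same element. -/
def Labelling.meridian (L : Labelling G N) : G := (L.around 0)⁻¹ * (L.hole 0 * L.lower⁻¹)⁻¹

/-- The longitude runs six times through a band and an arc; the steps multiply to the value of the
labelling. -/
lemma longitude_eq (hA : IsPretzelAtlas L A) {Q : ℝ → G}
    (hQ : A.IsPrimitive (fun s : ℝ => (pretzelTube (halfTwists N) s 1 : OnePoint (ℂ × ℝ))) Q)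
    (hQ0 : Q 0 = 1) : Q 1 = (A.gauge (.band 0 .mid) (pretzelTube (halfTwists N) 0 1))⁻¹ *
      L.longitude * A.gauge (.band 0 .mid) (pretzelTube (halfTwists N) 0 1) := by
  let B : ℤ → G := fun j => Q (j / 6) * (A.gauge (.band (bandIndex j) .mid)
        (pretzelTube (halfTwists N) (j / 6) 1))⁻¹
  have h (j : ℤ) : B (j + 1) = B j *
      (L.discBand j (bandIndex j) * (L.discBand j (bandIndex j + 1))⁻¹) := longitude_step hA hQ j
  have ev : Even (0 : ℤ) ∧ ¬ Even (1 : ℤ) ∧ Even (2 : ℤ) ∧ ¬ Even (3 : ℤ) ∧ Even (4 : ℤ) ∧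
    ¬ Even (5 : ℤ) := by decide
  obtain ⟨v0, v1, v2, v3, v4, v5⟩ := ev
  have h0 : B 1 = B 0 * (L.discBand 0 0 * (L.discBand 0 1)⁻¹) := h 0
  have h1 : B 2 = B 1 * (L.discBand 1 1 * (L.discBand 1 2)⁻¹) := h 1
  have h2 : B 3 = B 2 * (L.discBand 2 2 * (L.discBand 2 0)⁻¹) := h 2
  have h3 : B 4 = B 3 * (L.discBand 3 0 * (L.discBand 3 1)⁻¹) := h 3
  have h4 : B 5 = B 4 * (L.discBand 4 1 * (L.discBand 4 2)⁻¹) := h 4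
  have h5 : B 6 = B 5 * (L.discBand 5 2 * (L.discBand 5 0)⁻¹) := h 5
  have hp : pretzelTube (halfTwists N) 1 1 = pretzelTube (halfTwists N) 0 1 := by
    rw [← pretzelTube_add_one _ 0, zero_add]
  have b0 : B 0 = (A.gauge (.band 0 .mid) (pretzelTube (halfTwists N) 0 1))⁻¹ := by
    have : bandIndex 0 = 0 := rfl
    simp [B, hQ0, this]
  have b6 : B 6 = Q 1 * (A.gauge (.band 0 .mid) (pretzelTube (halfTwists N) 0 1))⁻¹ := by
    have : bandIndex 6 = 0 := rfl
    simp [B, hp, this]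
  have key : B 6 = B 0 * L.longitude := by
    rw [h5, h4, h3, h2, h1, h0]
    simp only [Labelling.discBand, v0, v1, v2, v3, v4, v5, if_true, if_false, Labelling.longitude]
    group
  rw [b0, b6] at key
  rw [← key]
  group

lemma untwist_pretzelTube_zero (N : Fin 3 → ℕ) (w : ℂ) :
    untwist (halfTwists N 0) 0 (pretzelTube (halfTwists N) 0 w) = -(1 - w / 4) := by
  have h := pretzelTube_strand (n := halfTwists N) 0 le_rfl zero_le_one w
  have b0 : bandIndex 0 = 0 := rfl
  rw [Int.cast_zero, mul_zero, add_zero, zero_div, b0] at h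
  rw [h, untwist_turnIf_strand (odd_halfTwists N 0) 0 0 le_rfl zero_le_one, if_pos (by decide)]

lemma pretzelTube_zero_mem_band (N : Fin 3 → ℕ) {s : Side} {w : ℂ} (hw : ‖w‖ = 1)
    (h : w.im ≠ 0 ∨ -(1 - w / 4) ∈ sideRegion 0 s) :
    pretzelTube (halfTwists N) 0 w ∈ pieceSet (halfTwists N) (.band 0 s) := by
  have h1 := pretzelTube_strand (n := halfTwists N) 0 le_rfl zero_le_one w
  have b0 : bandIndex 0 = 0 := rfl
  rw [Int.cast_zero, mul_zero, add_zero, zero_div, b0] at h1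
  obtain ⟨h2, h3⟩ := snd_turnIf_strand_mem (halfTwists N 0) 0 0 le_rfl zero_le_one w
  have h4 := norm_untwist_strand (odd_halfTwists N 0) 0 0 le_rfl zero_le_one hw
  rw [← h1] at h2 h3 h4
  refine mem_band h2 h3 h4 ?_
  rw [untwist_pretzelTube_zero]
  refine h.imp (fun h => ?_) id
  simpa using h

/-- The point of the unit circle with angular coordinate `φ`, in full turns. -/
def circlePoint (φ : ℝ) : ℂ := Complex.exp (2 * π * φ * I)

lemma circlePoint_eq (φ : ℝ) : circlePoint φ = Complex.exp ((2 * π * φ : ℝ) * I) := by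
  simp [circlePoint]

lemma norm_circlePoint (φ : ℝ) : ‖circlePoint φ‖ = 1 := by
  rw [circlePoint_eq, Complex.norm_exp_ofReal_mul_I]

lemma circlePoint_re (φ : ℝ) : (circlePoint φ).re = Real.cos (2 * π * φ) := by
  rw [circlePoint_eq, Complex.exp_ofReal_mul_I_re]

lemma circlePoint_im (φ : ℝ) : (circlePoint φ).im = Real.sin (2 * π * φ) := by
  rw [circlePoint_eq, Complex.exp_ofReal_mul_I_im]

lemma continuous_circlePoint : Continuous circlePoint := by
  unfold circlePoint; fun_prop

lemma circlePoint_zero : circlePoint 0 = 1 := by simp [circlePoint]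

lemma circlePoint_add_one (φ : ℝ) : circlePoint (φ + 1) = circlePoint φ := by
  rw [circlePoint, circlePoint, ← Complex.exp_periodic (2 * π * φ * I)]
  congr 1; push_cast; ring

lemma circlePoint_one : circlePoint 1 = 1 := by
  rw [← zero_add (1 : ℝ), circlePoint_add_one, circlePoint_zero]

/-- The meridian at the lower left corner of the band `0` leaves the chart of the middle part of
this band once, for that of the left part. -/
lemma meridian_eq (hA : IsPretzelAtlas L A) {Q : ℝ → G}
    (hQ : A.IsPrimitive (fun φ : ℝ => (pretzelTube (halfTwists N) 0 (circlePoint φ) :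
      OnePoint (ℂ × ℝ))) Q)
    (hQ0 : Q 0 = 1) : Q 1 = (A.gauge (.band 0 .mid) (pretzelTube (halfTwists N) 0 1))⁻¹ *
      L.meridian * A.gauge (.band 0 .mid) (pretzelTube (halfTwists N) 0 1) := by
  have hpi := Real.pi_pos
  let c : ℝ → OnePoint (ℂ × ℝ) := fun φ => (pretzelTube (halfTwists N) 0 (circlePoint φ) :
      OnePoint (ℂ × ℝ))
  have hQ : A.IsPrimitive c Q := hQ
  have hm : ∀ φ : ℝ, 0 < Real.cos (2 * π * φ) ∨ Real.sin (2 * π * φ) ≠ 0 →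
      c φ ∈ A.chart (.band 0 .mid) := by
    refine fun φ h => hA.mem_chart.2 (pretzelTube_zero_mem_band N (norm_circlePoint φ) ?_)
    rw [circlePoint_im]
    refine h.symm.imp_right fun h => ?_
    rw [← circlePoint_re] at h
    have := (Complex.abs_re_le_norm (circlePoint φ)).trans (norm_circlePoint φ).le
    rw [abs_le] at this
    simp only [sideRegion, Set.mem_ofPred_eq, abs_lt]
    simp
    constructor <;> linarith
  have hl : ∀ φ : ℝ, Real.cos (2 * π * φ) < 0 ∨ Real.sin (2 * π * φ) ≠ 0 →
      c φ ∈ A.chart (.band 0 .left) := by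
    refine fun φ h => hA.mem_chart.2 (pretzelTube_zero_mem_band N (norm_circlePoint φ) ?_)
    rw [circlePoint_im]
    refine h.symm.imp_right fun h => ?_
    rw [← circlePoint_re] at h
    simp only [sideRegion, Set.mem_ofPred_eq]
    simp
    linarith
  have s1 : Real.sin (2 * π * (1 / 4)) = 1 := by
    rw [show 2 * π * (1 / 4) = π / 2 by ring, Real.sin_pi_div_two]
  have s3 : Real.sin (2 * π * (3 / 4)) = -1 := by
    rw [show 2 * π * (3 / 4) = π / 2 + π by ring, Real.sin_add_pi, Real.sin_pi_div_two]
  have e1 := hQ.eq_of_isPreconnected (i := .band 0 .mid) (z := 0) (z' := 1 / 4)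
    (isPreconnected_Icc (a := (0 : ℝ)) (b := 1 / 4))
    (fun φ hφ => hm φ (by
      rcases hφ.2.lt_or_eq with h | h
      · exact Or.inl (Real.cos_pos_of_mem_Ioo ⟨by nlinarith [hφ.1], by nlinarith⟩)
      · rw [h, s1]; norm_num)) (by norm_num) (by norm_num)
  have e2 := hQ.eq_of_isPreconnected (i := .band 0 .left) (z := 1 / 4) (z' := 3 / 4)
    (isPreconnected_Icc (a := (1 / 4 : ℝ)) (b := 3 / 4))
    (fun φ hφ => hl φ (by
      rcases hφ.1.lt_or_eq with h | h
      · rcases hφ.2.lt_or_eq with h' | h'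
        · exact Or.inl (Real.cos_neg_of_pi_div_two_lt_of_lt (by nlinarith) (by nlinarith))
        · rw [h', s3]; norm_num
      · rw [← h, s1]; norm_num)) (by norm_num) (by norm_num)
  have e3 := hQ.eq_of_isPreconnected (i := .band 0 .mid) (z := 3 / 4) (z' := 1)
    (isPreconnected_Icc (a := (3 / 4 : ℝ)) (b := 1))
    (fun φ hφ => hm φ (by
      rcases hφ.1.lt_or_eq with h | h
      · refine Or.inl ?_
        rw [← Real.cos_sub_two_pi]
        exact Real.cos_pos_of_mem_Ioo ⟨by nlinarith, by nlinarith [hφ.2]⟩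
      · rw [← h, s3]; norm_num)) (by norm_num) (by norm_num)
  have t1 : A.gauge (.band 0 .left) (c (1 / 4)) * (A.gauge (.band 0 .mid) (c (1 / 4)))⁻¹ = 1 := by
    refine hA.transition _ _ _ _ (hA.mem_chart.1 (hl _ (by rw [s1]; norm_num)))
      (hA.mem_chart.1 (hm _ (by rw [s1]; norm_num))) ?_
    have h0 : 0 < (untwist (halfTwists N 0) 0
        (pretzelTube (halfTwists N) 0 (circlePoint (1 / 4)))).im := by
      have : (circlePoint (1 / 4)).im = 1 := (circlePoint_im _).trans s1
      rw [untwist_pretzelTube_zero]; simp [-one_div, this]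
    filter_upwards [(Complex.continuous_im.comp
      (continuous_untwist (halfTwists N 0) 0)).continuousAt.eventually (lt_mem_nhds h0)]
      with q hq _
    have hq' : -(untwist (halfTwists N 0) 0 q).im < 0 := neg_lt_zero.2 hq
    rw [Labelling.gauge, Labelling.gauge, jump_of_neg _ hq', jump_of_neg _ hq', one_mul, one_mul]
  have t3 : A.gauge (.band 0 .left) (c (3 / 4)) * (A.gauge (.band 0 .mid) (c (3 / 4)))⁻¹ =
      L.meridian := by
    refine hA.transition _ _ _ _ (hA.mem_chart.1 (hl _ (by rw [s3]; norm_num)))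
      (hA.mem_chart.1 (hm _ (by rw [s3]; norm_num))) ?_
    have h0 : (untwist (halfTwists N 0) 0
        (pretzelTube (halfTwists N) 0 (circlePoint (3 / 4)))).im < 0 := by
      have : (circlePoint (3 / 4)).im = -1 := (circlePoint_im _).trans s3
      rw [untwist_pretzelTube_zero]; simp [this]; norm_num
    filter_upwards [(Complex.continuous_im.comp
      (continuous_untwist (halfTwists N 0) 0)).continuousAt.eventually (gt_mem_nhds h0)]
      with q hq _
    have hq' : 0 < -(untwist (halfTwists N 0) 0 q).im := neg_pos.2 hq
    rw [Labelling.gauge, Labelling.gauge, jump_of_pos _ hq', jump_of_pos _ hq', Labelling.meridian]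
    simp only [Labelling.side]
    group
  have c0 : c 0 = (pretzelTube (halfTwists N) 0 1 : OnePoint (ℂ × ℝ)) := by
    simp [c, circlePoint_zero]
  have c1 : c 1 = (pretzelTube (halfTwists N) 0 1 : OnePoint (ℂ × ℝ)) := by
    simp [c, circlePoint_one]
  have t1' := FlatAtlas.change_gauge (Q (1 / 4)) (c (1 / 4)) t1
  have t3' := FlatAtlas.change_gauge (Q (3 / 4)) (c (3 / 4)) t3
  rw [hQ0, one_mul, t1', mul_one, e2, c0] at e1
  rw [t3', ← e1, c1] at e3
  rw [e3]
  group

/-- The boundary torus of the tube, with angular coordinates in full turns. -/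
def torusPoint (n : Fin 3 → ℕ) (x : ℝ × ℝ) : OnePoint (ℂ × ℝ) :=
  (pretzelTube n x.1 (circlePoint x.2) : OnePoint (ℂ × ℝ))

lemma continuous_torusPoint {n : Fin 3 → ℕ} (hn : ∀ k, Odd (n k)) : Continuous (torusPoint n) :=
  OnePoint.continuous_coe.comp ((continuous_pretzelTube hn).comp
    (continuous_fst.prodMk (continuous_circlePoint.comp continuous_snd)))

lemma torusPoint_add_left (n : Fin 3 → ℕ) (x : ℝ × ℝ) : torusPoint n (x + (1, 0)) = torusPoint n x := by
  simp [torusPoint, pretzelTube_add_one]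

lemma torusPoint_add_right (n : Fin 3 → ℕ) (x : ℝ × ℝ) :
    torusPoint n (x + (0, 1)) = torusPoint n x := by
  simp [torusPoint, circlePoint_add_one]

lemma IsPretzelAtlas.exists_torusPoint_mem (hA : IsPretzelAtlas L A) (x : ℝ × ℝ) :
    ∃ i, torusPoint (halfTwists N) x ∈ A.chart i := by
  obtain ⟨i, hi⟩ := exists_pretzelTube_mem (odd_halfTwists N) x.1 (norm_circlePoint x.2)
  exact ⟨i, hA.mem_chart.2 hi⟩

/-- The primitive of the boundary torus: its periods are, up to a common conjugation, the values of
the labelling on longitude and meridian. -/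
theorem exists_torus_primitive (hA : IsPretzelAtlas L A) :
    ∃ (P : ℝ × ℝ → G) (g : G), A.IsPrimitive (torusPoint (halfTwists N)) P ∧
      (∀ x, P (x + (1, 0)) = g⁻¹ * L.longitude * g * P x) ∧
      ∀ x, P (x + (0, 1)) = g⁻¹ * L.meridian * g * P x := by
  have hc := continuous_torusPoint (odd_halfTwists N)
  obtain ⟨P, hP0, hP⟩ := FlatAtlas.exists_isPrimitive_of_forall_mem (A := A)
    ⟨torusPoint (halfTwists N), hc⟩ hA.exists_torusPoint_mem 0
  have hP : A.IsPrimitive (torusPoint (halfTwists N)) P := hP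
  refine ⟨P, A.gauge (.band 0 .mid) (pretzelTube (halfTwists N) 0 1), hP, ?_, ?_⟩
  · have h1 := hP.comp (c := fun s : ℝ => (s, (0 : ℝ))) (by fun_prop)
    have e : torusPoint (halfTwists N) ∘ (fun s : ℝ => (s, (0 : ℝ))) =
        fun s => (pretzelTube (halfTwists N) s 1 : OnePoint (ℂ × ℝ)) := by
      funext s; simp [torusPoint, circlePoint_zero]
    rw [e] at h1
    rw [← longitude_eq hA h1 hP0]
    have h2 := hP.comp (c := fun x : ℝ × ℝ => x + (1, 0)) (by fun_prop)
    have e2 : torusPoint (halfTwists N) ∘ (fun x : ℝ × ℝ => x + (1, 0)) = torusPoint (halfTwists N) :=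
      funext (torusPoint_add_left _)
    rw [e2] at h2
    intro x
    have h3 := h2.mul_inv_eq hA.exists_torusPoint_mem hP x 0
    simp only [Function.comp_apply, zero_add, hP0, inv_one, mul_one] at h3 ⊢
    rw [← h3]; group
  · have h1 := hP.comp (c := fun s : ℝ => ((0 : ℝ), s)) (by fun_prop)
    rw [← meridian_eq hA h1 hP0]
    have h2 := hP.comp (c := fun x : ℝ × ℝ => x + (0, 1)) (by fun_prop)
    have e2 : torusPoint (halfTwists N) ∘ (fun x : ℝ × ℝ => x + (0, 1)) = torusPoint (halfTwists N) :=
      funext (torusPoint_add_right _)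
    rw [e2] at h2
    intro x
    have h3 := h2.mul_inv_eq hA.exists_torusPoint_mem hP x 0
    simp only [Function.comp_apply, zero_add, hP0, inv_one, mul_one] at h3 ⊢
    rw [← h3]; group

end

/-! ### Dehn surgery -/

lemma torusPoint_add_int (n : Fin 3 → ℕ) (x : ℝ × ℝ) (a b : ℤ) :
    torusPoint n (x + ((a : ℝ), (b : ℝ))) = torusPoint n x := by
  have h1 : Function.Periodic (torusPoint n) (1, 0) := torusPoint_add_left n
  have h2 : Function.Periodic (torusPoint n) (0, 1) := torusPoint_add_right n
  have e : ((a : ℝ), (b : ℝ)) = a • ((1 : ℝ), (0 : ℝ)) + b • ((0 : ℝ), (1 : ℝ)) := by simp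
  rw [e, ← add_assoc, (h2.zsmul b) _, (h1.zsmul a) _]

/-- The argument of a complex number, in full turns. -/
def angle (z : ℂ) : ℝ := z.arg / (2 * π)

/-- An angle with values in `(0, 1]`; it is continuous away from the positive half-line. -/
def angle' (z : ℂ) : ℝ := angle (-z) + 1 / 2

lemma circlePoint_angle {z : ℂ} (h : ‖z‖ = 1) : circlePoint (angle z) = z := by
  have hpi := Real.pi_ne_zero
  rw [circlePoint_eq, angle, show 2 * π * (z.arg / (2 * π)) = z.arg by field_simp]
  simpa [h] using Complex.norm_mul_exp_arg_mul_I z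

lemma exists_angle_circlePoint (φ : ℝ) : ∃ k : ℤ, angle (circlePoint φ) = φ + k := by
  have hpi := Real.pi_ne_zero
  have h : ((circlePoint φ).arg : Real.Angle) = ((2 * π * φ : ℝ) : Real.Angle) := by
    rw [circlePoint_eq, Complex.arg_exp_mul_I, Real.Angle.coe_toIocMod]
  rw [Real.Angle.angle_eq_iff_two_pi_dvd_sub] at h
  obtain ⟨k, hk⟩ := h
  refine ⟨k, ?_⟩
  rw [angle, show (circlePoint φ).arg = 2 * π * φ + 2 * π * k by linarith]
  field_simp

lemma exists_angle'_eq (z : ℂ) (hz : z ≠ 0) : ∃ k : ℤ, angle' z = angle z + k := by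
  have hpi := Real.pi_ne_zero
  have h : (((-z).arg + π : ℝ) : Real.Angle) = (z.arg : Real.Angle) := by
    rw [Real.Angle.coe_add, Complex.arg_neg_coe_angle hz, add_assoc, ← Real.Angle.coe_add,
      ← two_mul, Real.Angle.coe_two_pi, add_zero]
  rw [Real.Angle.angle_eq_iff_two_pi_dvd_sub] at h
  obtain ⟨k, hk⟩ := h
  refine ⟨k, ?_⟩
  rw [angle', angle, angle, show (-z).arg = z.arg - π + 2 * π * k by linarith]
  field_simp
  ring

/-- Near every point of the punctured plane there is a continuous branch of the angle. -/
lemma exists_angle_branch {z₀ : ℂ} (h₀ : z₀ ≠ 0) : ∃ b : ℂ → ℝ, ContinuousAt b z₀ ∧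
    ∀ z ≠ 0, ∃ k : ℤ, angle z = b z + k := by
  have hpi := Real.pi_ne_zero
  refine ⟨fun z => ((z / z₀).arg + z₀.arg) / (2 * π), ?_, fun z hz => ?_⟩
  · refine ContinuousAt.div_const (ContinuousAt.add ?_ continuousAt_const) _
    refine ContinuousAt.comp (f := fun z => z / z₀) (Complex.continuousAt_arg ?_) (by fun_prop)
    rw [div_self h₀]
    exact Complex.one_mem_slitPlane
  · have h : (z.arg : Real.Angle) = (((z / z₀).arg + z₀.arg : ℝ) : Real.Angle) := by
      rw [Real.Angle.coe_add, ← Complex.arg_mul_coe_angle (div_ne_zero hz h₀) h₀,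
        div_mul_cancel₀ _ h₀]
    rw [Real.Angle.angle_eq_iff_two_pi_dvd_sub] at h
    obtain ⟨k, hk⟩ := h
    refine ⟨k, ?_⟩
    simp only [angle]
    rw [show z.arg = (z / z₀).arg + z₀.arg + 2 * π * k by linarith]
    field_simp

lemma continuousAt_angle {z : ℂ} (h : z ∈ Complex.slitPlane) : ContinuousAt angle z :=
  (Complex.continuousAt_arg h).div_const _

lemma continuousAt_angle' {z : ℂ} (h : -z ∈ Complex.slitPlane) : ContinuousAt angle' z :=
  ((continuousAt_angle h).comp (f := fun z : ℂ => -z) continuous_neg.continuousAt).add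
    continuousAt_const

lemma ContinuousAt.eventually_int_eq {X : Type*} [TopologicalSpace X] {f : X → ℝ} {x : X}
    (hf : ContinuousAt f x) (h : ∀ y, ∃ k : ℤ, f y = k) : ∀ᶠ y in 𝓝 x, f y = f x := by
  obtain ⟨k, hk⟩ := h x
  filter_upwards [hf.eventually (lt_mem_nhds (show (k : ℝ) - 1 < f x by linarith)),
    hf.eventually (gt_mem_nhds (show f x < (k : ℝ) + 1 by linarith))] with y h1 h2
  obtain ⟨k', hk'⟩ := h y
  rw [hk'] at h1 h2
  have h3 : k - 1 < k' := by exact_mod_cast h1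
  have h4 : k' < k + 1 := by exact_mod_cast h2
  rw [hk', hk, show k' = k by omega]

section
variable {N : ℝ → ℂ → ℂ × ℝ} {m l p q : ℤ}

/-- The part of the surgered manifold that is the interior of the solid torus, as a partial
inverse of its inclusion. -/
def toSolidTorus : DehnSurgery N m l p q → Option SolidTorus :=
  Quot.lift (Sum.elim (fun _ => none) fun v => by
      classical exact if ‖(v.2 : ℂ)‖ < 1 then some v else none) (by
    rintro _ _ ⟨α, β, x, v, -, -, hv⟩
    have : ¬ ‖(v.2 : ℂ)‖ < 1 := by
      have h := norm_circlePoint β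
      rw [circlePoint, ← hv] at h
      rw [h]; exact lt_irrefl _
    simp [this])

lemma toSolidTorus_inl (x : exterior N) :
    toSolidTorus (Quot.mk _ (Sum.inl x) : DehnSurgery N m l p q) = none := rfl

lemma toSolidTorus_inr {v : SolidTorus} (hv : ‖(v.2 : ℂ)‖ < 1) :
    toSolidTorus (Quot.mk _ (Sum.inr v) : DehnSurgery N m l p q) = some v := by
  classical
  change (if ‖(v.2 : ℂ)‖ < 1 then some v else none) = some v
  rw [if_pos hv]

lemma toSolidTorus_inr_eq {v v' : SolidTorus}
    (h : toSolidTorus (Quot.mk _ (Sum.inr v) : DehnSurgery N m l p q) = some v') : v = v' := by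
  classical
  change (if ‖(v.2 : ℂ)‖ < 1 then some v else none) = some v' at h
  split_ifs at h
  exact Option.some_injective _ h

variable (N m l p q) in
/-- The inclusion of the solid torus. -/
def ofSolidTorus (v : SolidTorus) : DehnSurgery N m l p q := Quot.mk _ (Sum.inr v)

lemma continuous_ofSolidTorus : Continuous (ofSolidTorus N m l p q) :=
  continuous_quot_mk.comp continuous_inr

lemma isOpen_image_ofSolidTorus {O : Set SolidTorus} (hO : IsOpen O)
    (h : ∀ v ∈ O, ‖(v.2 : ℂ)‖ < 1) : IsOpen (ofSolidTorus N m l p q '' O) := by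
  rw [← isQuotientMap_quot_mk.isOpen_preimage, isOpen_sum_iff]
  constructor
  · convert isOpen_empty
    rw [Set.eq_empty_iff_forall_notMem]
    rintro x ⟨v, hv, hx⟩
    have := congrArg toSolidTorus hx
    rw [toSolidTorus_inl, ofSolidTorus, toSolidTorus_inr (h v hv)] at this
    exact Option.some_ne_none _ this
  · convert hO
    ext v
    constructor
    · rintro ⟨v', hv', hx⟩
      have := congrArg toSolidTorus hx
      rw [ofSolidTorus, toSolidTorus_inr (h v' hv')] at this
      rwa [toSolidTorus_inr_eq this.symm]
    · exact fun hv => ⟨v, hv, rfl⟩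

lemma continuous_snd_coe : Continuous fun v : SolidTorus => (v.2 : ℂ) :=
  continuous_subtype_val.comp continuous_snd

lemma continuous_fst_coe : Continuous fun v : SolidTorus => (v.1 : ℂ) :=
  continuous_subtype_val.comp continuous_fst

lemma isOpen_interior_solidTorus : IsOpen {v : SolidTorus | ‖(v.2 : ℂ)‖ < 1} :=
  isOpen_lt continuous_snd_coe.norm continuous_const

/-- Neighbourhoods of interior points of the solid torus. -/
lemma nhds_ofSolidTorus {v : SolidTorus} (hv : ‖(v.2 : ℂ)‖ < 1) :
    𝓝 (ofSolidTorus N m l p q v) = map (ofSolidTorus N m l p q) (𝓝 v) := by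
  refine le_antisymm (fun s hs => ?_) continuous_ofSolidTorus.continuousAt
  obtain ⟨t, ht, hto, hvt⟩ := mem_nhds_iff.1 (mem_map.1 hs)
  refine mem_nhds_iff.2 ⟨_, ?_, isOpen_image_ofSolidTorus
    (hto.inter isOpen_interior_solidTorus) fun v hv => hv.2, ⟨v, ⟨hvt, hv⟩, rfl⟩⟩
  rintro _ ⟨v', hv', rfl⟩
  exact ht hv'.1

end

section
variable (n : Fin 3 → ℕ) (m l p q : ℤ)

/-- The gluing map in angular coordinates. -/
def glueAngles (α β : ℝ) : ℝ × ℝ := (l * β + q * α, m * β + p * α)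

lemma continuous_glueAngles : Continuous fun x : ℝ × ℝ => glueAngles m l p q x.1 x.2 := by
  unfold glueAngles; fun_prop

lemma torusPoint_glueAngles_add (α β : ℝ) (a b : ℤ) :
    torusPoint n (glueAngles m l p q (α + a) (β + b)) = torusPoint n (glueAngles m l p q α β) := by
  rw [← torusPoint_add_int n (glueAngles m l p q α β) (l * b + q * a) (m * b + p * a)]
  congr 1
  ext <;> simp [glueAngles] <;> ring

/-- The map from the solid torus, without its core, along the radii to the boundary torus. -/
def radial (v : SolidTorus) : OnePoint (ℂ × ℝ) :=
  torusPoint n (glueAngles m l p q (angle v.1) (angle v.2))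

lemma radial_eq {v : SolidTorus} {α β : ℝ} (h₁ : ∃ a : ℤ, angle v.1 = α + a)
    (h₂ : ∃ b : ℤ, angle v.2 = β + b) :
    radial n m l p q v = torusPoint n (glueAngles m l p q α β) := by
  obtain ⟨a, ha⟩ := h₁
  obtain ⟨b, hb⟩ := h₂
  rw [radial, ha, hb, torusPoint_glueAngles_add]

variable {n} in
lemma continuousAt_radial (hn : ∀ k, Odd (n k)) {v : SolidTorus} (hv : (v.2 : ℂ) ≠ 0) :
    ContinuousAt (radial n m l p q) v := by
  obtain ⟨a, ha, ha'⟩ := exists_angle_branch (Circle.coe_ne_zero v.1)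
  obtain ⟨b, hb, hb'⟩ := exists_angle_branch hv
  have h : ContinuousAt (fun v : SolidTorus =>
      torusPoint n (glueAngles m l p q (a v.1) (b v.2))) v :=
    ((continuous_torusPoint hn).comp (continuous_glueAngles m l p q)).continuousAt.comp
      (f := fun v : SolidTorus => (a v.1, b v.2))
      ((ha.comp (f := fun v : SolidTorus => (v.1 : ℂ)) continuous_fst_coe.continuousAt).prodMk
        (hb.comp (f := fun v : SolidTorus => (v.2 : ℂ)) continuous_snd_coe.continuousAt))
  refine h.congr ?_
  filter_upwards [continuous_snd_coe.continuousAt.eventually_ne hv] with v' hv'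
  exact (radial_eq n m l p q (ha' _ (Circle.coe_ne_zero v'.1)) (hb' _ hv')).symm

/-- The retraction of the surgered manifold, without the core of the solid torus, to the exterior of
the knot. -/
def retract : DehnSurgery (pretzelTube n) m l p q → OnePoint (ℂ × ℝ) :=
  Quot.lift (Sum.elim (fun x => (x : OnePoint (ℂ × ℝ))) (radial n m l p q)) (by
    rintro _ _ ⟨α, β, x, v, hx, hv₁, hv₂⟩
    change (x : OnePoint (ℂ × ℝ)) = radial n m l p q v
    rw [hx, radial_eq n m l p q (α := α) (β := β)]
    · simp [torusPoint, glueAngles, circlePoint]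
    · rw [hv₁, show ((Circle.exp (2 * π * α) : Circle) : ℂ) = circlePoint α by
        rw [circlePoint_eq]; simp]
      exact exists_angle_circlePoint α
    · rw [hv₂]
      exact exists_angle_circlePoint β)

/-- The complement of the core of the solid torus. -/
def offCore : Set (DehnSurgery (pretzelTube n) m l p q) :=
  {y | ∀ v, toSolidTorus y = some v → (v.2 : ℂ) ≠ 0}

variable {n m l p q}

lemma mk_inr_mem_offCore {v : SolidTorus} :
    ofSolidTorus (pretzelTube n) m l p q v ∈ offCore n m l p q ↔ (v.2 : ℂ) ≠ 0 := by
  constructor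
  · intro h h0
    exact h v (toSolidTorus_inr (by simp [h0])) h0
  · intro h v' hv'
    rwa [← toSolidTorus_inr_eq hv']

lemma isOpen_offCore_inter (hn : ∀ k, Odd (n k)) {O : Set (OnePoint (ℂ × ℝ))} (hO : IsOpen O) :
    IsOpen (offCore n m l p q ∩ retract n m l p q ⁻¹' O) := by
  rw [← isQuotientMap_quot_mk.isOpen_preimage, isOpen_sum_iff]
  constructor
  · convert hO.preimage (continuous_subtype_val (p := (· ∈ exterior (pretzelTube n)))) using 1
    ext x
    exact ⟨fun h => h.2, fun h => ⟨fun v hv => absurd hv (by simp [toSolidTorus_inl]), h⟩⟩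
  · rw [isOpen_iff_mem_nhds]
    rintro v ⟨h1, h2⟩
    have h1 : (v.2 : ℂ) ≠ 0 := mk_inr_mem_offCore.1 h1
    filter_upwards [(continuousAt_radial m l p q hn h1).eventually (hO.mem_nhds h2),
      continuous_snd_coe.continuousAt.eventually_ne h1] with v' h3 h4
    exact ⟨mk_inr_mem_offCore.2 h4, h3⟩

lemma continuousAt_retract (hn : ∀ k, Odd (n k)) {y : DehnSurgery (pretzelTube n) m l p q}
    (hy : y ∈ offCore n m l p q) : ContinuousAt (retract n m l p q) y := by
  intro s hs
  obtain ⟨t, ht, hto, hyt⟩ := mem_nhds_iff.1 hs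
  rw [mem_map]
  exact mem_of_superset ((isOpen_offCore_inter hn hto).mem_nhds ⟨hy, hyt⟩) fun y' hy' => ht hy'.2

end

section
variable {G : Type*} [Group G] {N : Fin 3 → ℕ} {L : Labelling G N}
  {A : FlatAtlas G (OnePoint (ℂ × ℝ)) Piece}

/-- Multiplicative periods in the coordinate directions extend to the lattice. -/
lemma zpow_periods {P : ℝ × ℝ → G} {Λ M : G} (h₁ : ∀ x, P (x + (1, 0)) = Λ * P x)
    (h₂ : ∀ x, P (x + (0, 1)) = M * P x) (a b : ℤ) (x : ℝ × ℝ) :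
    P (x + ((a : ℝ), (b : ℝ))) = Λ ^ a * M ^ b * P x := by
  have key : ∀ (e : ℝ × ℝ) (g : G), (∀ x, P (x + e) = g * P x) → ∀ (a : ℤ) x,
      P (x + a • e) = g ^ a * P x := by
    intro e g h a
    induction a using Int.induction_on with
    | zero => simp
    | succ a ih =>
      intro x
      rw [add_smul, one_smul, ← add_assoc, h, ih, zpow_add, zpow_one, ← mul_assoc,
        (Commute.refl g).zpow_right a |>.eq]
    | pred a ih =>
      intro x
      have := h (x + (-(a : ℤ) - 1) • e)
      rw [sub_smul, one_smul, add_assoc, sub_add_cancel, ih] at this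
      rw [sub_smul, one_smul, ← mul_right_inj g, ← this, ← mul_assoc, ← zpow_one_add]
      congr 2; ring
  have e : x + ((a : ℝ), (b : ℝ)) = x + b • ((0 : ℝ), (1 : ℝ)) + a • ((1 : ℝ), (0 : ℝ)) := by
    ext <;> simp
  rw [e, key _ _ h₁, key _ _ h₂, mul_assoc]

/-- Two branches of the angle, in full turns, whose domains of continuity cover the circle. -/
def branch : Bool → ℂ → ℝ
  | false => angle
  | true => angle'

/-- The points where a branch of the angle is continuous. -/
def branchDomain : Bool → Set ℂ
  | false => Complex.slitPlane
  | true => {z | -z ∈ Complex.slitPlane}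

lemma isOpen_branchDomain (b : Bool) : IsOpen (branchDomain b) := by
  cases b
  · exact Complex.isOpen_slitPlane
  · exact Complex.isOpen_slitPlane.preimage continuous_neg

lemma continuousAt_branch {b : Bool} {z : ℂ} (h : z ∈ branchDomain b) :
    ContinuousAt (branch b) z := by
  cases b
  · exact continuousAt_angle h
  · exact continuousAt_angle' h

lemma exists_branch_eq (b : Bool) {z : ℂ} (hz : z ≠ 0) : ∃ k : ℤ, branch b z = angle z + k := by
  cases b
  · exact ⟨0, by simp [branch]⟩
  · exact exists_angle'_eq z hz

lemma exists_mem_branchDomain {z : ℂ} (hz : z ≠ 0) : ∃ b, z ∈ branchDomain b := by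
  by_cases h : z ∈ Complex.slitPlane
  · exact ⟨false, h⟩
  · refine ⟨true, Complex.mem_slitPlane_iff.2 (Or.inl ?_)⟩
    rw [Complex.mem_slitPlane_iff, not_or, not_lt, not_not] at h
    refine lt_of_le_of_ne (by simpa using h.1) fun h0 => hz (Complex.ext ?_ h.2)
    simpa using h0.symm

variable {m l p q : ℤ} {P : ℝ × ℝ → G} {Λ M : G}

/-- The primitive of the boundary torus, transported to the interior of the solid torus: it depends
on a branch of the angular coordinate along the core only. -/
def solidGauge (m l p q : ℤ) (P : ℝ × ℝ → G) (b : Bool) (v : SolidTorus) : G :=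
  P (glueAngles m l p q (branch b v.1) (angle v.2))

lemma glueAngles_add_right (α β : ℝ) (k : ℤ) : glueAngles m l p q α (β + k) =
    glueAngles m l p q α β + (((k * l : ℤ) : ℝ), ((k * m : ℤ) : ℝ)) := by
  ext <;> simp [glueAngles] <;> ring

lemma glueAngles_add_left (α β : ℝ) (k : ℤ) : glueAngles m l p q (α + k) β =
    glueAngles m l p q α β + (((k * q : ℤ) : ℝ), ((k * p : ℤ) : ℝ)) := by
  ext <;> simp [glueAngles] <;> ring

lemma commute_of_periods (h₁ : ∀ x, P (x + (1, 0)) = Λ * P x)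
    (h₂ : ∀ x, P (x + (0, 1)) = M * P x) : Commute Λ M := by
  have e : P (0 + (1, 0) + (0, 1)) = P (0 + (0, 1) + (1, 0)) := by
    rw [add_assoc, add_comm ((1 : ℝ), (0 : ℝ)), ← add_assoc]
  rw [h₁, h₂, h₂, h₁, ← mul_assoc, ← mul_assoc] at e
  exact (mul_right_cancel e).symm

/-- The function on the boundary torus has period one in the direction that bounds a disc in the
solid torus. -/
lemma primitive_glueAngles_add_right (h₁ : ∀ x, P (x + (1, 0)) = Λ * P x)
    (h₂ : ∀ x, P (x + (0, 1)) = M * P x) (h : Λ ^ l * M ^ m = 1) (α β : ℝ) (k : ℤ) :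
    P (glueAngles m l p q α (β + k)) = P (glueAngles m l p q α β) := by
  have hc := commute_of_periods h₁ h₂
  have : Λ ^ (k * l) * M ^ (k * m) = 1 := by
    rw [mul_comm k, mul_comm k, zpow_mul, zpow_mul, ← ((hc.zpow_zpow l m).mul_zpow k), h,
      one_zpow]
  rw [glueAngles_add_right, zpow_periods h₁ h₂, this, one_mul]

lemma eventually_solidGauge_solidGauge (h₁ : ∀ x, P (x + (1, 0)) = Λ * P x)
    (h₂ : ∀ x, P (x + (0, 1)) = M * P x) (b b' : Bool) {v : SolidTorus}
    (hb : (v.1 : ℂ) ∈ branchDomain b) (hb' : (v.1 : ℂ) ∈ branchDomain b') :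
    ∀ᶠ v' in 𝓝 v, solidGauge m l p q P b v' * (solidGauge m l p q P b' v')⁻¹ =
      solidGauge m l p q P b v * (solidGauge m l p q P b' v)⁻¹ := by
  have hd : ∀ v : SolidTorus, ∃ k : ℤ, branch b v.1 - branch b' v.1 = k := by
    intro v
    obtain ⟨k, hk⟩ := exists_branch_eq b (Circle.coe_ne_zero v.1)
    obtain ⟨k', hk'⟩ := exists_branch_eq b' (Circle.coe_ne_zero v.1)
    exact ⟨k - k', by rw [hk, hk']; push_cast; ring⟩
  have hc : ContinuousAt (fun v : SolidTorus => branch b v.1 - branch b' v.1) v :=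
    ((continuousAt_branch hb).comp (f := fun v : SolidTorus => (v.1 : ℂ))
      continuous_fst_coe.continuousAt).sub
      ((continuousAt_branch hb').comp (f := fun v : SolidTorus => (v.1 : ℂ))
      continuous_fst_coe.continuousAt)
  obtain ⟨k, hk⟩ := hd v
  have key : ∀ v : SolidTorus, branch b v.1 - branch b' v.1 = k →
      solidGauge m l p q P b v * (solidGauge m l p q P b' v)⁻¹ = Λ ^ (k * q) * M ^ (k * p) := by
    intro v hv
    rw [solidGauge, solidGauge, show branch b v.1 = branch b' v.1 + k by linarith,
      glueAngles_add_left, zpow_periods h₁ h₂, mul_inv_cancel_right]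
  filter_upwards [ContinuousAt.eventually_int_eq hc hd] with v' hv'
  rw [key v hk, key v' (hv'.trans hk)]

lemma eventually_solidGauge_gauge (hP : A.IsPrimitive (torusPoint (halfTwists N)) P)
    (h₁ : ∀ x, P (x + (1, 0)) = Λ * P x)
    (h₂ : ∀ x, P (x + (0, 1)) = M * P x) (h : Λ ^ l * M ^ m = 1) (b : Bool) (i : Piece)
    {v : SolidTorus} (hb : (v.1 : ℂ) ∈ branchDomain b) (hv : (v.2 : ℂ) ≠ 0)
    (hi : radial (halfTwists N) m l p q v ∈ A.chart i) :
    ∀ᶠ v' in 𝓝 v, solidGauge m l p q P b v' *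
        (A.gauge i (radial (halfTwists N) m l p q v'))⁻¹ =
      solidGauge m l p q P b v * (A.gauge i (radial (halfTwists N) m l p q v))⁻¹ := by
  obtain ⟨c, hc, hc'⟩ := exists_angle_branch hv
  have hr : ∀ v : SolidTorus, (v.2 : ℂ) ≠ 0 → radial (halfTwists N) m l p q v =
      torusPoint (halfTwists N) (glueAngles m l p q (branch b v.1) (c v.2)) := by
    intro v hv
    refine radial_eq _ _ _ _ _ ?_ (hc' _ hv)
    obtain ⟨k, hk⟩ := exists_branch_eq b (Circle.coe_ne_zero v.1)
    exact ⟨-k, by rw [hk]; push_cast; ring⟩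
  have hs : ∀ v : SolidTorus, (v.2 : ℂ) ≠ 0 → solidGauge m l p q P b v =
      P (glueAngles m l p q (branch b v.1) (c v.2)) := by
    intro v hv
    obtain ⟨k, hk⟩ := hc' _ hv
    rw [solidGauge, hk, primitive_glueAngles_add_right h₁ h₂ h]
  have hcont : ContinuousAt (fun v : SolidTorus => glueAngles m l p q (branch b v.1) (c v.2)) v :=
    (continuous_glueAngles m l p q).continuousAt.comp
      (f := fun v : SolidTorus => (branch b v.1, c v.2))
      (((continuousAt_branch hb).comp (f := fun v : SolidTorus => (v.1 : ℂ))
        continuous_fst_coe.continuousAt).prodMk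
        (hc.comp (f := fun v : SolidTorus => (v.2 : ℂ)) continuous_snd_coe.continuousAt))
  rw [hr v hv] at hi
  filter_upwards [hcont.eventually (hP _ i hi), continuous_snd_coe.continuousAt.eventually_ne hv]
    with v' h3 h4
  rw [hr v hv, hr v' h4, hs v hv, hs v' h4, h3]

/-- The flat structure on the surgered manifold: the one of the knot complement, with the discs of
the solid torus filled in. -/
theorem exists_surgeryAtlas (hA : IsPretzelAtlas L A)
    (hP : A.IsPrimitive (torusPoint (halfTwists N)) P) (h₁ : ∀ x, P (x + (1, 0)) = Λ * P x)
    (h₂ : ∀ x, P (x + (0, 1)) = M * P x) (h : Λ ^ l * M ^ m = 1) :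
    ∃ B : FlatAtlas G (DehnSurgery (pretzelTube (halfTwists N)) m l p q) (Piece ⊕ Bool),
      (∀ i, B.chart (.inl i) = offCore (halfTwists N) m l p q ∩ retract _ m l p q ⁻¹' A.chart i) ∧
      (∀ i, B.gauge (.inl i) = A.gauge i ∘ retract _ m l p q) ∧
      (∀ b x, Quot.mk _ (Sum.inl x) ∉ B.chart (.inr b)) ∧ ∀ y, ∃ i, y ∈ B.chart i := by
  let O : Bool → Set SolidTorus := fun b => {v | ‖(v.2 : ℂ)‖ < 1 ∧ (v.1 : ℂ) ∈ branchDomain b}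
  have hO : ∀ b, IsOpen (O b) := fun b =>
    isOpen_interior_solidTorus.inter ((isOpen_branchDomain b).preimage continuous_fst_coe)
  have hn := odd_halfTwists N
  let chart : Piece ⊕ Bool → Set (DehnSurgery (pretzelTube (halfTwists N)) m l p q) :=
    Sum.elim (fun i => offCore (halfTwists N) m l p q ∩ retract _ m l p q ⁻¹' A.chart i)
      (fun b => ofSolidTorus _ m l p q '' O b)
  let gauge : Piece ⊕ Bool → DehnSurgery (pretzelTube (halfTwists N)) m l p q → G :=
    Sum.elim (fun i => A.gauge i ∘ retract _ m l p q)
      (fun b y => (toSolidTorus y).elim 1 (solidGauge m l p q P b))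
  have hsolid : ∀ b (v : SolidTorus), ‖(v.2 : ℂ)‖ < 1 →
      gauge (.inr b) (ofSolidTorus _ m l p q v) = solidGauge m l p q P b v := by
    intro b v hv
    change (toSolidTorus (ofSolidTorus _ m l p q v)).elim 1 _ = _
    rw [ofSolidTorus, toSolidTorus_inr hv]
    rfl
  have hmixed : ∀ b i y, y ∈ chart (.inr b) → y ∈ chart (.inl i) →
      ∀ᶠ y' in 𝓝 y, gauge (.inr b) y' * (gauge (.inl i) y')⁻¹ =
        gauge (.inr b) y * (gauge (.inl i) y)⁻¹ := by
    rintro b i _ ⟨v, hv, rfl⟩ ⟨h3, h4⟩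
    rw [nhds_ofSolidTorus hv.1, eventually_map]
    filter_upwards [eventually_solidGauge_gauge hP h₁ h₂ h b i hv.2
      (mk_inr_mem_offCore.1 h3) h4, isOpen_interior_solidTorus.mem_nhds hv.1] with v' h5 h6
    rw [hsolid b v hv.1, hsolid b v' h6]
    exact h5
  refine ⟨⟨chart, ?_, gauge, ?_⟩, fun i => rfl, fun i => rfl, ?_, ?_⟩
  · rintro (i | b)
    · exact isOpen_offCore_inter hn (A.isOpen_chart i)
    · exact isOpen_image_ofSolidTorus (hO b) fun v hv => hv.1
  · rintro (i | b) (j | b') y hi hj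
    · exact (continuousAt_retract hn hi.1).eventually (A.locConst i j _ hi.2 hj.2)
    · filter_upwards [hmixed b' i y hj hi] with y' hy'
      rw [← inv_inj, mul_inv_rev, mul_inv_rev, inv_inv, inv_inv, hy']
    · exact hmixed b j y hi hj
    · obtain ⟨v, hv, rfl⟩ := hi
      obtain ⟨v₂, hv₂, he⟩ := hj
      have := congrArg toSolidTorus he
      rw [ofSolidTorus, ofSolidTorus, toSolidTorus_inr hv.1, toSolidTorus_inr hv₂.1] at this
      obtain rfl := Option.some_injective _ this
      rw [nhds_ofSolidTorus hv.1, eventually_map]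
      filter_upwards [eventually_solidGauge_solidGauge (m := m) (l := l) (p := p) (q := q) h₁ h₂
        b b' hv.2 hv₂.2, isOpen_interior_solidTorus.mem_nhds hv.1] with v' h5 h6
      rw [hsolid b _ hv.1, hsolid b _ h6, hsolid b' _ hv.1, hsolid b' _ h6, h5]
  · rintro b x ⟨v, hv, hx⟩
    have := congrArg toSolidTorus hx
    rw [toSolidTorus_inl, ofSolidTorus, toSolidTorus_inr hv.1] at this
    exact Option.some_ne_none _ this
  · intro y
    induction y using Quot.inductionOn with | _ y => ?_
    rcases y with x | v
    · have : ∃ i, (x : OnePoint (ℂ × ℝ)) ∈ A.chart i := by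
        obtain ⟨x, hx⟩ := x
        induction x using OnePoint.rec with
        | infty => exact ⟨.hole 2, by rw [hA.chart_eq]; exact Or.inr ⟨rfl, rfl⟩⟩
        | coe z =>
          rcases exists_mem_or_core hn z with ⟨i, hi⟩ | ⟨s, hs⟩
          · exact ⟨i, hA.mem_chart.2 hi⟩
          · exact absurd (congrArg _ hs) (hx s 0 (by simp))
      obtain ⟨i, hi⟩ := this
      exact ⟨.inl i, fun v hv => absurd hv (by simp [toSolidTorus_inl]), hi⟩
    · by_cases hv : ‖(v.2 : ℂ)‖ < 1
      · obtain ⟨b, hb⟩ := exists_mem_branchDomain (Circle.coe_ne_zero v.1)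
        exact ⟨.inr b, v, ⟨hv, hb⟩, rfl⟩
      · obtain ⟨i, hi⟩ := hA.exists_torusPoint_mem (glueAngles m l p q (angle v.1) (angle v.2))
        refine ⟨.inl i, mk_inr_mem_offCore.2 fun h0 => hv ?_, hi⟩
        rw [h0, norm_zero]; exact one_pos

end

lemma mem_exterior_of_norm_eq_one {n : Fin 3 → ℕ} (hn : ∀ k, Odd (n k)) (s : ℝ) {w : ℂ}
    (hw : ‖w‖ = 1) : ((pretzelTube n s w : ℂ × ℝ) : OnePoint (ℂ × ℝ)) ∈ exterior (pretzelTube n) := by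
  intro s' w' hw' h
  have := eq_of_pretzelTube_eq hn hw.le hw'.le (OnePoint.coe_injective h)
  rw [← this, hw] at hw'
  exact lt_irrefl _ hw'

/-- A labelling that kills the filling slope gives a representation whose restriction to the
boundary torus has the inverse of the label of the meridian in its image, up to conjugation. -/
theorem exists_rep_of_labelling {G : Type*} [Group G] {N : Fin 3 → ℕ} (L : Labelling G N)
    {m l p q : ℤ} (h : L.longitude ^ l * L.meridian ^ m = 1)
    (x₀ : boundaryTorus (pretzelTube (halfTwists N))) :
    ∃ (ρ : FundamentalGroup (DehnSurgery (pretzelTube (halfTwists N)) m l p q)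
        (boundaryInclusion _ m l p q x₀) →* G) (g : G),
      g⁻¹ * L.meridian⁻¹ * g ∈ (ρ.comp (FundamentalGroup.map
        (boundaryInclusion (pretzelTube (halfTwists N)) m l p q) x₀)).range := by
  obtain ⟨A, hA⟩ := exists_isPretzelAtlas L
  obtain ⟨P, g, hP, h₁, h₂⟩ := exists_torus_primitive hA
  have hn := odd_halfTwists N
  have conj_zpow : ∀ (x : G) (k : ℤ), (g⁻¹ * x * g) ^ k = g⁻¹ * x ^ k * g := fun x k => by
    have := conj_zpow (i := k) (a := g⁻¹) (b := x)
    rwa [inv_inv] at this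
  have hk : (g⁻¹ * L.longitude * g) ^ l * (g⁻¹ * L.meridian * g) ^ m = 1 := by
    rw [conj_zpow, conj_zpow, show g⁻¹ * L.longitude ^ l * g * (g⁻¹ * L.meridian ^ m * g) =
      g⁻¹ * (L.longitude ^ l * L.meridian ^ m) * g by group, h]
    group
  obtain ⟨B, hB, hBg, hB', hcov⟩ := exists_surgeryAtlas (p := p) (q := q) hA hP h₁ h₂ hk
  obtain ⟨s, w, hw, hx⟩ := id x₀.2
  have hb : ∀ t : ℝ, ∃ x : boundaryTorus (pretzelTube (halfTwists N)),
      (x.1.1 : OnePoint (ℂ × ℝ)) = torusPoint (halfTwists N) (s, t) := fun t =>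
    ⟨⟨⟨_, mem_exterior_of_norm_eq_one hn s (norm_circlePoint t)⟩, s, _, norm_circlePoint t, rfl⟩, rfl⟩
  choose bt hbt using hb
  have hcb : Continuous bt := by
    rw [Topology.IsInducing.subtypeVal.continuous_iff, Topology.IsInducing.subtypeVal.continuous_iff]
    have : Subtype.val ∘ Subtype.val ∘ bt = fun t => torusPoint (halfTwists N) (s, t) := funext hbt
    rw [this]
    exact (continuous_torusPoint hn).comp (by fun_prop)
  have hinj : ∀ x y : boundaryTorus (pretzelTube (halfTwists N)),
      x.1.1 = y.1.1 → x = y :=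
    fun x y hxy => Subtype.ext (Subtype.ext hxy)
  have h0 : bt (angle w) = x₀ := hinj _ _ (by rw [hbt, hx, torusPoint, circlePoint_angle hw])
  have h1 : bt (angle w + 1) = x₀ := hinj _ _ (by
    rw [hbt, hx, torusPoint, circlePoint_add_one, circlePoint_angle hw])
  let γ : Path x₀ x₀ :=
    { toFun := fun t => bt (angle w + t)
      continuous_toFun := hcb.comp (by fun_prop)
      source' := by simp [h0]
      target' := by simp [h1] }
  let ι := boundaryInclusion (pretzelTube (halfTwists N)) m l p q
  let c : ℝ → ℝ := fun t => angle w + (Set.projIcc (0 : ℝ) 1 zero_le_one t : ℝ)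
  have hprim : B.IsPrimitive (γ.map ι.continuous).extend (fun t => P (s, c t)) := by
    have key : B.IsPrimitive (fun t => ι (bt t)) (fun t => P (s, t)) := by
      rintro t (i | b) hi
      · rw [hB] at hi
        have hr : ∀ t, retract (halfTwists N) m l p q (ι (bt t)) =
          torusPoint (halfTwists N) (s, t) := hbt
        simp only [hBg, Function.comp_apply, hr]
        have hi2 : retract (halfTwists N) m l p q (ι (bt t)) ∈ A.chart i := hi.2
        rw [hr] at hi2
        exact (hP.comp (c := fun t : ℝ => (s, t)) (by fun_prop)) t i hi2
      · exact absurd hi (hB' b _)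
    exact key.comp (c := c) (by fun_prop)
  refine ⟨B.holonomyRep hcov _, g * P (s, angle w), FundamentalGroup.fromPath
    (Path.Homotopic.Quotient.mk γ), ?_⟩
  have e : FundamentalGroup.map ι x₀ (FundamentalGroup.fromPath (Path.Homotopic.Quotient.mk γ)) =
    FundamentalGroup.fromPath (Path.Homotopic.Quotient.mk (γ.map ι.continuous)) := rfl
  rw [MonoidHom.comp_apply]
  erw [e, FlatAtlas.holonomyRep_mk, FlatAtlas.holonomy_eq hcov _ hprim]
  have hM := h₂ (s, angle w)
  have e0 : c 0 = angle w := by simp [c]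
  have e1 : (s, c 1) = (s, angle w) + (0, 1) := by simp [c]
  rw [e1, e0, hM]
  group

/-! ### Labellings from three conjugate elements of order four -/

section
variable {G : Type*} [Group G]

lemma central_mul_mul_inv {σ : G} (hσ : ∀ g, Commute σ g) (a b : G) :
    σ * a * (σ * b)⁻¹ = a * b⁻¹ := by
  rw [mul_inv_rev, ← mul_assoc, mul_assoc σ, (hσ _).eq, mul_inv_cancel_right]

/-- Labellings whose upper disc has the trivial label. The labels of the holes are the inverses of
the `X k`, up to a common central sign `σ`, which changes the meridian by this sign and not the
longitude. -/
def Labelling.ofElements {N : Fin 3 → ℕ} (X : Fin 3 → G) (Θ σ : G) (hσ : ∀ g, Commute σ g)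
    (hσ2 : σ * σ = 1)
    (h : ∀ k, X k * ((X (k - 1))⁻¹ * X k) ^ N k * X (k - 1) * (((X (k - 1))⁻¹ * X k) ^ N k)⁻¹ = Θ) :
    Labelling G N where
  hole k := σ * (X k)⁻¹
  upper := 1
  lower := Θ⁻¹
  rel k := by
    have e : σ * (X (k - 1))⁻¹ * (σ * (X k)⁻¹)⁻¹ = (X (k - 1))⁻¹ * X k := by
      rw [central_mul_mul_inv hσ, inv_inv]
    have hi : σ⁻¹ = σ := inv_eq_of_mul_eq_one_left hσ2
    rw [e, ← h k, pow_succ, mul_inv_rev σ, hi, inv_inv, inv_inv, mul_one]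
    generalize ((X (k - 1))⁻¹ * X k) ^ N k = w
    rw [← (hσ _).eq, ← mul_assoc w, ← (hσ w).eq]
    group

variable {N : Fin 3 → ℕ} {X : Fin 3 → G} {Θ σ : G} (hσ : ∀ g, Commute σ g) (hσ2 : σ * σ = 1)
    (h : ∀ k, X k * ((X (k - 1))⁻¹ * X k) ^ N k * X (k - 1) * (((X (k - 1))⁻¹ * X k) ^ N k)⁻¹ = Θ)

lemma Labelling.ofElements_around (k : Fin 3) :
    (Labelling.ofElements X Θ σ hσ hσ2 h).around k = (X (k - 1))⁻¹ * X k := by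
  change σ * (X (k - 1))⁻¹ * (σ * (X k)⁻¹)⁻¹ = (X (k - 1))⁻¹ * X k
  rw [central_mul_mul_inv hσ, inv_inv]

lemma Labelling.ofElements_meridian :
    (Labelling.ofElements X Θ σ hσ hσ2 h).meridian = (X 0)⁻¹ * (σ * (X 2 * Θ⁻¹)) * X 0 := by
  rw [Labelling.meridian, Labelling.ofElements_around]
  change ((X 2)⁻¹ * X 0)⁻¹ * (σ * (X 0)⁻¹ * Θ⁻¹⁻¹)⁻¹ = _
  have hi : σ⁻¹ = σ := inv_eq_of_mul_eq_one_left hσ2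
  have e : (σ * (X 0)⁻¹ * Θ⁻¹⁻¹)⁻¹ = σ * (Θ⁻¹ * X 0) := by
    rw [mul_assoc, mul_inv_rev, hi, ← (hσ _).eq]; group
  rw [e, mul_inv_rev, inv_inv, ← mul_assoc, mul_assoc _ _ σ, ← (hσ (X 2)).eq]
  group

lemma Labelling.ofElements_longitude (C : Fin 3 → G)
    (hC : ∀ k, C k = X k * ((X (k - 1))⁻¹ * X k) ^ N k) :
    (Labelling.ofElements X Θ σ hσ hσ2 h).longitude =
      (X 0)⁻¹ * (C 0 * (C 1)⁻¹ * C 2 * (C 0)⁻¹ * C 1 * (C 2)⁻¹) * X 0 := by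
  have hH : ∀ i j, (Labelling.ofElements X Θ σ hσ hσ2 h).hole i *
      ((Labelling.ofElements X Θ σ hσ hσ2 h).hole j)⁻¹ = (X i)⁻¹ * X j := by
    intro i j
    change σ * (X i)⁻¹ * (σ * (X j)⁻¹)⁻¹ = _
    rw [central_mul_mul_inv hσ, inv_inv]
  simp only [Labelling.longitude, hH, Labelling.ofElements_around, hC]
  generalize ((X (0 - 1))⁻¹ * X 0) ^ N 0 = w0
  generalize ((X (1 - 1))⁻¹ * X 1) ^ N 1 = w1
  generalize ((X (2 - 1))⁻¹ * X 2) ^ N 2 = w2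
  group

/-- The relation at a band, for two conjugates of `B`. -/
lemma band_relation {r t u B ζ : G} {n : ℕ} (hru : Commute r u) (hB : B * B = ζ)
    (hζ : ∀ g, Commute ζ g)
    (hc : t * B * t⁻¹ * (B⁻¹ * (t * B * t⁻¹)) ^ n * u = u * (B⁻¹ * (t * B * t⁻¹)) ^ n * B)
    {X X' : G} (hX : X = r * B * r⁻¹ * u) (hX' : X' = r * t * B * (r * t)⁻¹ * u) :
    X' * (X⁻¹ * X') ^ n * X * ((X⁻¹ * X') ^ n)⁻¹ = ζ * (u * u) ∧
      X' * (X⁻¹ * X') ^ n = r * (t * B * t⁻¹ * (B⁻¹ * (t * B * t⁻¹)) ^ n) * r⁻¹ * u := by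
  have e : X⁻¹ * X' = (u⁻¹ * r) * (B⁻¹ * (t * B * t⁻¹)) * (u⁻¹ * r)⁻¹ := by
    rw [hX, hX']; group
  have ep : (X⁻¹ * X') ^ n = (u⁻¹ * r) * (B⁻¹ * (t * B * t⁻¹)) ^ n * (u⁻¹ * r)⁻¹ := by
    rw [e, conj_pow]
  rw [ep]
  generalize (B⁻¹ * (t * B * t⁻¹)) ^ n = w at hc ⊢
  have h1 : r⁻¹ * u * r = u := by rw [mul_assoc, ← hru.eq]; group
  constructor
  · rw [hX, hX']
    calc _ = r * (t * B * t⁻¹ * w * (r⁻¹ * u * r)) * B * w⁻¹ * r⁻¹ * u := by group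
      _ = r * u * (w * (B * B) * w⁻¹) * r⁻¹ * u := by rw [h1, hc]; group
      _ = r * u * ζ * r⁻¹ * u := by rw [hB, ← (hζ w).eq]; group
      _ = ζ * (r * u * r⁻¹ * u) := by rw [← (hζ (r * u)).eq]; group
      _ = _ := by rw [hru.eq]; group
  · rw [hX']; group

/-- Labellings from a one-parameter group `T` of rotations and an element `B` of order four: the
labels of the holes are, up to inverse and sign, conjugates of `B` by rotations followed by a common
rotation. The meridian and the longitude lie in a second one-parameter group `E`, in which they have
the angles `θ` and, since the longitude is `ζ` times the square of the product of the conjugated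
`c k`, `π - 2 (η 0 + η 1 + η 2)`. -/
theorem exists_labelling_of_rotations (N : Fin 3 → ℕ) (T E : Multiplicative ℝ →* G) {ζ B σ : G}
    {ω θ : ℝ} {ψ η : Fin 3 → ℝ} (hζ : ∀ g, Commute ζ g) (hζ2 : ζ * ζ = 1)
    (hσ : ∀ g, Commute σ g) (hσ2 : σ * σ = 1) (hT : T (.ofAdd π) = ζ) (hE : E (.ofAdd π) = ζ)
    (hB : B * B = ζ) (hψ : ψ 0 + ψ 1 + ψ 2 = π) (c : Fin 3 → G)
    (hc : ∀ k, c k = T (.ofAdd (ψ k)) * B * (T (.ofAdd (ψ k)))⁻¹ *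
      (B⁻¹ * (T (.ofAdd (ψ k)) * B * (T (.ofAdd (ψ k)))⁻¹)) ^ N k)
    (hc2 : ∀ k, c k * c k = ζ)
    (hcu : ∀ k, c k * T (.ofAdd ω) = T (.ofAdd ω) *
      (B⁻¹ * (T (.ofAdd (ψ k)) * B * (T (.ofAdd (ψ k)))⁻¹)) ^ N k * B)
    (hcE : ∀ k, c k * T (.ofAdd (ψ k)) = E (.ofAdd (π - η k)))
    (hBE : B * (T (.ofAdd ω))⁻¹ = E (.ofAdd θ)) :
    ∃ (L : Labelling G N) (g : G), L.meridian = g⁻¹ * (σ * ζ * E (.ofAdd θ)) * g ∧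
      L.longitude = g⁻¹ * E (.ofAdd (π - 2 * (η 0 + η 1 + η 2))) * g := by
  set u := T (.ofAdd ω) with hu
  set t : Fin 3 → G := fun k => T (.ofAdd (ψ k)) with ht
  let r : Fin 3 → G := ![1, t 0, t 0 * t 1]
  let X : Fin 3 → G := fun k => r k * t k * B * (r k * t k)⁻¹ * u
  have hTT : ∀ x y, Commute (T x) (T y) := fun x y => (Commute.all x y).map T
  have hru : ∀ k, Commute (r k) u := by
    intro k
    fin_cases k
    · exact Commute.one_left u
    · exact hTT _ _
    · exact (hTT _ _).mul_left (hTT _ _)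
  have h3 : t 0 * t 1 * t 2 = ζ := by
    rw [← hT, ← hψ]
    simp only [ht, ofAdd_add, map_mul]
  have hX : ∀ k, X (k - 1) = r k * B * (r k)⁻¹ * u := by
    intro k
    fin_cases k
    · change t 0 * t 1 * t 2 * B * (t 0 * t 1 * t 2)⁻¹ * u = 1 * B * 1⁻¹ * u
      rw [h3, (hζ B).eq]; group
    · change 1 * t 0 * B * (1 * t 0)⁻¹ * u = t 0 * B * (t 0)⁻¹ * u
      simp
    · rfl
  have hcu' := hcu
  simp only [hc] at hcu'
  have hrel := fun k => band_relation (n := N k) (hru k) hB hζ (hcu' k) (hX k)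
    (rfl : X k = r k * t k * B * (r k * t k)⁻¹ * u)
  refine ⟨Labelling.ofElements X (ζ * (u * u)) σ hσ hσ2 fun k => (hrel k).1, X 0, ?_, ?_⟩
  · rw [Labelling.ofElements_meridian]
    congr 2
    have : X 2 = B * u := by
      change t 0 * t 1 * t 2 * B * (t 0 * t 1 * t 2)⁻¹ * u = _
      rw [h3, (hζ B).eq]; group
    have hi : ζ⁻¹ = ζ := inv_eq_of_mul_eq_one_left hζ2
    rw [this, ← hBE, mul_inv_rev, hi, ← (hζ _).eq, mul_assoc σ]
    congr 1
    rw [← mul_assoc, ← (hζ (B * u)).eq]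
    group
  · rw [Labelling.ofElements_longitude hσ hσ2 _ (fun k => X k * ((X (k - 1))⁻¹ * X k) ^ N k)
      fun k => rfl]
    congr 2
    have hC : ∀ k, X k * ((X (k - 1))⁻¹ * X k) ^ N k = r k * c k * (r k)⁻¹ * u := fun k => by
      rw [hc]; exact (hrel k).2
    simp only [hC]
    have hci : ∀ k, (r k * c k * (r k)⁻¹)⁻¹ = ζ * (r k * c k * (r k)⁻¹) := by
      intro k
      rw [inv_eq_iff_mul_eq_one, ← mul_assoc, ← (hζ _).eq, mul_assoc]
      have : r k * c k * (r k)⁻¹ * (r k * c k * (r k)⁻¹) = r k * (c k * c k) * (r k)⁻¹ := by group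
      rw [this, hc2, ← (hζ _).eq, mul_assoc, mul_inv_cancel, mul_one, hζ2]
    have hprod : (r 0 * c 0 * (r 0)⁻¹) * (r 1 * c 1 * (r 1)⁻¹) * (r 2 * c 2 * (r 2)⁻¹) =
        E (.ofAdd (4 * π - (η 0 + η 1 + η 2))) := by
      have h2 : t 2 = (t 0 * t 1)⁻¹ * ζ := by rw [← h3]; group
      have h2' : (t 0 * t 1)⁻¹ = t 2 * ζ := by
        rw [h2, mul_assoc, hζ2, mul_one]
      change (1 * c 0 * 1⁻¹) * (t 0 * c 1 * (t 0)⁻¹) * (t 0 * t 1 * c 2 * (t 0 * t 1)⁻¹) = _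
      calc _ = (c 0 * t 0) * (c 1 * t 1) * (c 2 * (t 0 * t 1)⁻¹) := by group
        _ = (c 0 * t 0) * (c 1 * t 1) * (c 2 * t 2) * ζ := by rw [h2']; group
        _ = _ := by
          rw [hcE 0, hcE 1, hcE 2, ← hE, ← map_mul, ← map_mul, ← map_mul, ← ofAdd_add,
            ← ofAdd_add, ← ofAdd_add]
          congr 2; ring
    have h0 := hci 0
    have h1 := hci 1
    have h2 := hci 2
    generalize r 0 * c 0 * (r 0)⁻¹ = x at *
    generalize r 1 * c 1 * (r 1)⁻¹ = y at *
    generalize r 2 * c 2 * (r 2)⁻¹ = z at *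
    calc _ = x * y⁻¹ * z * x⁻¹ * y * z⁻¹ := by group
      _ = x * (ζ * y) * z * (ζ * x) * y * (ζ * z) := by rw [h0, h1, h2]
      _ = ζ * (ζ * ζ) * ((x * y * z) * (x * y * z)) := by
        have hx : ∀ g, x * (ζ * g) = ζ * (x * g) := fun g => ((hζ x).left_comm g).symm
        have hy : ∀ g, y * (ζ * g) = ζ * (y * g) := fun g => ((hζ y).left_comm g).symm
        have hz : ∀ g, z * (ζ * g) = ζ * (z * g) := fun g => ((hζ z).left_comm g).symm
        simp only [mul_assoc, hx, hy, hz]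
      _ = E (.ofAdd (π - 2 * (η 0 + η 1 + η 2))) := by
        rw [hprod, hζ2, mul_one]
        have h8 : ζ = E (.ofAdd (-7 * π)) := by
          have : (-7 * π : ℝ) = (-7 : ℤ) • π := by simp
          rw [this, ofAdd_zsmul, map_zpow, hE]
          have h6 : ζ ^ (-7 : ℤ) = ζ ^ (2 * (-4) + 1 : ℤ) := by norm_num
          rw [h6, zpow_add, zpow_mul, zpow_ofNat, pow_two, hζ2]; simp
        rw [h8, ← map_mul, ← map_mul, ← ofAdd_add, ← ofAdd_add]
        congr 2; ring

end

/-! ### Real matrices as pairs of complex numbers -/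

/-- The real matrix of the map `x ↦ z x + w x̄` of the complex plane. -/
def mat (z w : ℂ) : Matrix (Fin 2) (Fin 2) ℝ :=
  !![z.re + w.re, w.im - z.im; w.im + z.im, z.re - w.re]

lemma mat_mul (z w z' w' : ℂ) :
    mat z w * mat z' w' = mat (z * z' + w * conj w') (z * w' + w * conj z') := by
  ext i j
  fin_cases i <;> fin_cases j <;> simp [mat, Matrix.mul_apply, Fin.sum_univ_two] <;> ring

lemma mat_one : mat 1 0 = 1 := by
  ext i j
  fin_cases i <;> fin_cases j <;> simp [mat]

lemma mat_neg (z w : ℂ) : -mat z w = mat (-z) (-w) := by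
  ext i j
  fin_cases i <;> fin_cases j <;> simp [mat] <;> ring

lemma det_mat (z w : ℂ) : (mat z w).det = Complex.normSq z - Complex.normSq w := by
  rw [mat, Matrix.det_fin_two_of, Complex.normSq_apply, Complex.normSq_apply]; ring

lemma trace_mat (z w : ℂ) : (mat z w).trace = 2 * z.re := by
  rw [mat, Matrix.trace_fin_two_of]; ring

/-- The element of `SL₂(ℝ)` with the given complex coordinates. -/
def slMat (z w : ℂ) (h : z * conj z - w * conj w = 1) : SL(2, ℝ) :=
  ⟨mat z w, by
    rw [Complex.mul_conj, Complex.mul_conj] at h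
    rw [det_mat]; exact_mod_cast h⟩

lemma slMat_mul {z w z' w' : ℂ} (h h') : slMat z w h * slMat z' w' h' =
    slMat (z * z' + w * conj w') (z * w' + w * conj z') (by
      simp only [map_add, map_mul, Complex.conj_conj]
      linear_combination (z' * conj z' - w' * conj w') * h + h') :=
  Subtype.ext (mat_mul z w z' w')

lemma slMat_congr {z w z' w' : ℂ} {h h'} (hz : z = z') (hw : w = w') :
    slMat z w h = slMat z' w' h' := by
  subst hz hw; rfl

lemma slMat_inv {z w : ℂ} (h) : (slMat z w h)⁻¹ = slMat (conj z) (-w) (by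
    simp only [Complex.conj_conj, map_neg]; linear_combination h) := by
  rw [inv_eq_iff_mul_eq_one, slMat_mul]
  refine Subtype.ext ?_
  change mat _ _ = 1
  rw [← mat_one]
  congr 1
  · simp only [map_neg]; linear_combination h
  · simp only [Complex.conj_conj]; ring

lemma slMat_one (h) : slMat 1 0 h = 1 := Subtype.ext mat_one

/-- The one-parameter group of elliptic elements `cos t + sin t J`, where `J` has the complex
coordinates `i α` and `δ` and the square `-1`. -/
def flow (α δ : ℝ) (h : α ^ 2 - δ ^ 2 = 1) : Multiplicative ℝ →* SL(2, ℝ) where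
  toFun t := slMat (Real.cos t.toAdd + I * (α * Real.sin t.toAdd)) (δ * Real.sin t.toAdd) (by
    have h1 : (α : ℂ) ^ 2 - (δ : ℂ) ^ 2 = 1 := by exact_mod_cast h
    have h2 : (Real.sin t.toAdd : ℂ) ^ 2 + (Real.cos t.toAdd : ℂ) ^ 2 = 1 := by
      exact_mod_cast Real.sin_sq_add_cos_sq _
    simp only [map_add, map_mul, Complex.conj_ofReal, Complex.conj_I]
    linear_combination h2 + (Real.sin t.toAdd : ℂ) ^ 2 * h1 -
      (α * Real.sin t.toAdd : ℂ) ^ 2 * Complex.I_sq)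
  map_one' := by
    rw [← slMat_one (by simp)]
    exact slMat_congr (by simp) (by simp)
  map_mul' s t := by
    have h1 : (α : ℂ) ^ 2 - (δ : ℂ) ^ 2 = 1 := by exact_mod_cast h
    rw [slMat_mul]
    refine slMat_congr ?_ ?_
    · simp only [toAdd_mul, Real.cos_add, Real.sin_add, map_mul, Complex.conj_ofReal,
        Complex.ofReal_add, Complex.ofReal_sub, Complex.ofReal_mul]
      linear_combination (-(Real.sin s.toAdd * Real.sin t.toAdd : ℂ)) * (-h1) -
        (α : ℂ) ^ 2 * (Real.sin s.toAdd * Real.sin t.toAdd : ℂ) * Complex.I_sq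
    · simp only [toAdd_mul, Real.sin_add, map_add, map_mul, Complex.conj_ofReal, Complex.conj_I,
        Complex.ofReal_add, Complex.ofReal_mul]
      ring

lemma flow_pi (α δ : ℝ) (h) : flow α δ h (.ofAdd π) = -1 := by
  refine Subtype.ext ?_
  change mat _ _ = -1
  rw [← mat_one, mat_neg]
  congr 1 <;> simp

/-- The numbers `(U, V)` with `sinh ((2 N + 1) u) = sinh u * U` and
`cosh ((2 N + 1) u) = cosh u * V`, as functions of `y = sinh u ^ 2`. -/
def chebyshev (y : ℝ) : ℕ → ℝ × ℝ
  | 0 => (1, 1)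
  | N + 1 => ((chebyshev y N).1 * (1 + 2 * y) + 2 * (1 + y) * (chebyshev y N).2,
      (chebyshev y N).2 * (1 + 2 * y) + 2 * y * (chebyshev y N).1)

lemma chebyshev_sq (y : ℝ) (N : ℕ) :
    (1 + y) * (chebyshev y N).2 ^ 2 - y * (chebyshev y N).1 ^ 2 = 1 := by
  induction N with
  | zero => simp [chebyshev]
  | succ N ih =>
    simp only [chebyshev]
    linear_combination ih

section powers
variable {q ρ c s : ℝ} {v : ℂ}

/-- Here `B = (i q, ρ v)` is conjugated by the rotation `c + i s` to `B'`, the base of the power is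
`B⁻¹ B'`, and the lemma computes `B' (B⁻¹ B') ^ N`. -/
lemma mat_mul_pow (hq : q ^ 2 = 1 + ρ ^ 2) (hv : v * conj v = 1) (hcs : c ^ 2 + s ^ 2 = 1) (N : ℕ) :
    mat (q * I) (ρ * v * (c + s * I) ^ 2) *
        mat (q ^ 2 - ρ ^ 2 * (c - s * I) ^ 2) (2 * q * ρ * v * (c + s * I) * s) ^ N =
      mat (q * (chebyshev (ρ ^ 2 * s ^ 2) N).2 * I) (ρ * v * (c + s * I) *
        ((chebyshev (ρ ^ 2 * s ^ 2) N).2 * c + (chebyshev (ρ ^ 2 * s ^ 2) N).1 * s * I)) := by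
  have hq' : (q : ℂ) ^ 2 = 1 + (ρ : ℂ) ^ 2 := by exact_mod_cast hq
  have hcs' : (c : ℂ) ^ 2 + (s : ℂ) ^ 2 = 1 := by exact_mod_cast hcs
  induction N with
  | zero =>
    rw [pow_zero, mul_one]
    congr 1 <;> simp [chebyshev]
    ring
  | succ N ih =>
    rw [pow_succ (mat _ _), ← mul_assoc, ih, mat_mul]
    simp only [chebyshev]
    generalize (chebyshev (ρ ^ 2 * s ^ 2) N).1 = U
    generalize (chebyshev (ρ ^ 2 * s ^ 2) N).2 = V
    congr 1
    · simp only [map_add, map_mul, Complex.conj_ofReal, Complex.conj_I, Complex.conj_ofNat]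
      push_cast
      linear_combination (2 * q * ρ ^ 2 * s * (c + s * I) * (c - s * I) * (V * c + U * s * I)) * hv +
        (-2 * q * ρ ^ 2 * s ^ 3 * (V * c + U * s * I) - ρ ^ 2 * s ^ 2 * q * V * I +
          2 * q * ρ ^ 2 * V * s * c) * Complex.I_sq +
        (2 * q * ρ ^ 2 * s * (V * c + U * s * I) - q * V * I * ρ ^ 2) * hcs' + q * V * I * hq'
    · simp only [map_mul, map_pow, map_sub, Complex.conj_ofReal, Complex.conj_I]
      push_cast
      linear_combination (ρ * v * (c + s * I)) * ((2 * V * s * I + (V * c + U * s * I)) * hq' +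
        (-ρ ^ 2 * s ^ 2 * (V * c + U * s * I) - 2 * ρ ^ 2 * U * s ^ 2 * c) * Complex.I_sq +
        (-ρ ^ 2 * (V * c + U * s * I) - 2 * ρ ^ 2 * V * s * I) * hcs')

/-- With the same notation, the value of `(B⁻¹ B') ^ N B`. -/
lemma mat_pow_mul (hq : q ^ 2 = 1 + ρ ^ 2) (hv : v * conj v = 1) (hcs : c ^ 2 + s ^ 2 = 1) (N : ℕ) :
    mat (q ^ 2 - ρ ^ 2 * (c - s * I) ^ 2) (2 * q * ρ * v * (c + s * I) * s) ^ N *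
        mat (q * I) (ρ * v) =
      mat (q * (chebyshev (ρ ^ 2 * s ^ 2) N).2 * I) (ρ * v * (c + s * I) *
        ((chebyshev (ρ ^ 2 * s ^ 2) N).2 * c - (chebyshev (ρ ^ 2 * s ^ 2) N).1 * s * I)) := by
  have hq' : (q : ℂ) ^ 2 = 1 + (ρ : ℂ) ^ 2 := by exact_mod_cast hq
  have hcs' : (c : ℂ) ^ 2 + (s : ℂ) ^ 2 = 1 := by exact_mod_cast hcs
  induction N with
  | zero =>
    rw [pow_zero, one_mul]
    congr 1
    · simp [chebyshev]
    · simp only [chebyshev, Complex.ofReal_one]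
      linear_combination (-ρ * v) * hcs' + ρ * v * s ^ 2 * Complex.I_sq
  | succ N ih =>
    rw [pow_succ' (mat _ _), mul_assoc, ih, mat_mul]
    simp only [chebyshev]
    generalize (chebyshev (ρ ^ 2 * s ^ 2) N).1 = U
    generalize (chebyshev (ρ ^ 2 * s ^ 2) N).2 = V
    congr 1
    · simp only [map_add, map_sub, map_mul, Complex.conj_ofReal, Complex.conj_I]
      push_cast
      linear_combination (2 * q * ρ ^ 2 * s * (c + s * I) * (c - s * I) * (V * c + U * s * I)) * hv +
        (-2 * q * ρ ^ 2 * s ^ 3 * (V * c + U * s * I) - ρ ^ 2 * s ^ 2 * q * V * I +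
          2 * q * ρ ^ 2 * V * s * c) * Complex.I_sq +
        (2 * q * ρ ^ 2 * s * (V * c + U * s * I) - q * V * I * ρ ^ 2) * hcs' + q * V * I * hq'
    · simp only [map_mul, Complex.conj_ofReal, Complex.conj_I]
      push_cast
      linear_combination (ρ * v * (c + s * I)) * ((-2 * V * s * I + (V * c - U * s * I)) * hq' +
        (-ρ ^ 2 * s ^ 2 * (V * c - U * s * I) - 2 * ρ ^ 2 * U * s ^ 2 * c) * Complex.I_sq +
        (-ρ ^ 2 * (V * c - U * s * I) + 2 * ρ ^ 2 * V * s * I) * hcs')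

end powers

/-! ### Labellings in `SL₂(ℝ)` -/

/-- The rotations of the complex plane. -/
def rotation : Multiplicative ℝ →* SL(2, ℝ) := flow 1 0 (by norm_num)

lemma rotation_apply (φ : ℝ) : ∃ h, rotation (.ofAdd φ) =
    slMat (Real.cos φ + Real.sin φ * I) 0 h := by
  have hcs : (Real.cos φ : ℂ) ^ 2 + (Real.sin φ : ℂ) ^ 2 = 1 := by
    exact_mod_cast Real.cos_sq_add_sin_sq φ
  refine ⟨?_, Subtype.ext ?_⟩
  · simp only [map_add, map_mul, Complex.conj_ofReal, Complex.conj_I, map_zero, mul_zero, sub_zero]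
    linear_combination hcs - (Real.sin φ : ℂ) ^ 2 * Complex.I_sq
  · change mat _ _ = mat _ _
    congr 1
    · simp [mul_comm]
    · simp

lemma neg_one_commute (g : SL(2, ℝ)) : Commute (-1) g := Commute.neg_one_left g

lemma slMat_sq {z w : ℂ} (h) (hz : conj z = -z) : slMat z w h * slMat z w h = -1 := by
  rw [slMat_mul]
  refine Subtype.ext ?_
  change mat _ _ = -1
  rw [← mat_one, mat_neg]
  congr 1
  · rw [hz] at h
    linear_combination -h
  · rw [hz]; ring

/-- Labellings in `SL₂(ℝ)` from solutions of trigonometric equations. Elements of order four act on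
the hyperbolic plane as half-turns about a point; `ρ` measures the distance of three such points
from the fixed point of the rotations, from which two consecutive ones are seen under the angle
`2 ψ k`. -/
theorem exists_labelling (N : Fin 3 → ℕ) {ρ q ω θ : ℝ} {ψ η κ U V : Fin 3 → ℝ}
    (hq : q ^ 2 = 1 + ρ ^ 2) (hθ : Real.sin θ ≠ 0) (hθω : Real.cos θ = q * Real.sin ω)
    (hU : ∀ k, U k = (chebyshev (ρ ^ 2 * Real.sin (ψ k) ^ 2) (N k)).1)
    (hV : ∀ k, V k = (chebyshev (ρ ^ 2 * Real.sin (ψ k) ^ 2) (N k)).2)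
    (hVκ : ∀ k, V k * Real.cos (ψ k) = κ k * Real.cos ω)
    (hUκ : ∀ k, U k * Real.sin (ψ k) = κ k * Real.sin ω)
    (hcos : ∀ k, Real.cos (η k) = q * V k * Real.sin (ψ k))
    (hsin : ∀ k, Real.sin (η k) = κ k * Real.sin θ) (hψ : ψ 0 + ψ 1 + ψ 2 = π)
    {σ : SL(2, ℝ)} (hσ : σ = 1 ∨ σ = -1) :
    ∃ (L : Labelling SL(2, ℝ) N) (α δ : ℝ) (h : α ^ 2 - δ ^ 2 = 1) (g : SL(2, ℝ)),
      L.meridian = g⁻¹ * (σ * -1 * flow α δ h (.ofAdd θ)) * g ∧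
      L.longitude = g⁻¹ * flow α δ h (.ofAdd (π - 2 * (η 0 + η 1 + η 2))) * g := by
  have hcω := Real.cos_sq_add_sin_sq ω
  have hcωC : (Real.cos ω : ℂ) ^ 2 + (Real.sin ω : ℂ) ^ 2 = 1 := by exact_mod_cast hcω
  set v : ℂ := Real.cos ω - Real.sin ω * I with hv
  have hvc : conj v = Real.cos ω + Real.sin ω * I := by
    simp only [hv, map_sub, map_mul, Complex.conj_ofReal, Complex.conj_I]; ring
  have hvv : v * conj v = 1 := by
    rw [hvc, hv]; linear_combination hcωC - (Real.sin ω : ℂ) ^ 2 * Complex.I_sq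
  clear_value v
  have hqC : (q : ℂ) ^ 2 = 1 + (ρ : ℂ) ^ 2 := by exact_mod_cast hq
  have hαδ : (q * Real.cos ω / Real.sin θ) ^ 2 - (ρ / Real.sin θ) ^ 2 = 1 := by
    have h1 := Real.sin_sq_add_cos_sq θ
    field_simp
    rw [hθω] at h1
    linear_combination q ^ 2 * hcω + hq - h1
  set α := q * Real.cos ω / Real.sin θ with hα
  set δ := ρ / Real.sin θ with hδ
  have hBdet : (q * I) * conj (q * I : ℂ) - (ρ * v) * conj (ρ * v : ℂ) = 1 := by
    simp only [map_mul, Complex.conj_ofReal, Complex.conj_I]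
    linear_combination hqC - (q : ℂ) ^ 2 * Complex.I_sq - (ρ : ℂ) ^ 2 * hvv
  let B : SL(2, ℝ) := slMat (q * I) (ρ * v) hBdet
  let c : Fin 3 → SL(2, ℝ) := fun k => rotation (.ofAdd (ψ k)) * B * (rotation (.ofAdd (ψ k)))⁻¹ *
      (B⁻¹ * (rotation (.ofAdd (ψ k)) * B * (rotation (.ofAdd (ψ k)))⁻¹)) ^ N k
  have hflow : ∀ t, (flow α δ hαδ (.ofAdd t) : Matrix (Fin 2) (Fin 2) ℝ) =
      mat (Real.cos t + I * (α * Real.sin t)) (δ * Real.sin t) := fun t => rfl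
  have hrot : ∀ φ, (rotation (.ofAdd φ) : Matrix (Fin 2) (Fin 2) ℝ) =
      mat (Real.cos φ + Real.sin φ * I) 0 := fun φ => by
    obtain ⟨h, e⟩ := rotation_apply φ
    rw [e]; rfl
  have hcs : ∀ k, (Real.cos (ψ k)) ^ 2 + (Real.sin (ψ k)) ^ 2 = 1 :=
    fun k => Real.cos_sq_add_sin_sq _
  have hcsC : ∀ k, (Real.cos (ψ k) : ℂ) ^ 2 + (Real.sin (ψ k) : ℂ) ^ 2 = 1 :=
    fun k => by exact_mod_cast hcs k
  have hB' : ∀ k, (rotation (.ofAdd (ψ k)) * B * (rotation (.ofAdd (ψ k)))⁻¹).1 =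
      mat (q * I) (ρ * v * (Real.cos (ψ k) + Real.sin (ψ k) * I) ^ 2) := by
    intro k
    obtain ⟨h, e⟩ := rotation_apply (ψ k)
    rw [e, slMat_mul, slMat_inv, slMat_mul]
    change mat _ _ = _
    congr 1
    · simp only [map_add, map_mul, map_neg, map_zero, Complex.conj_ofReal, Complex.conj_I]
      linear_combination q * I * (hcsC k) - q * I * (Real.sin (ψ k) : ℂ) ^ 2 * Complex.I_sq
    · simp only [Complex.conj_conj]
      ring
  have hW : ∀ k, (B⁻¹ * (rotation (.ofAdd (ψ k)) * B * (rotation (.ofAdd (ψ k)))⁻¹)).1 =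
      mat (q ^ 2 - ρ ^ 2 * (Real.cos (ψ k) - Real.sin (ψ k) * I) ^ 2)
        (2 * q * ρ * v * (Real.cos (ψ k) + Real.sin (ψ k) * I) * Real.sin (ψ k)) := by
    intro k
    rw [Matrix.SpecialLinearGroup.coe_mul, hB', slMat_inv]
    change mat _ _ * _ = _
    rw [mat_mul]
    congr 1
    · simp only [map_add, map_mul, map_pow, Complex.conj_ofReal, Complex.conj_I]
      linear_combination -(q : ℂ) ^ 2 * Complex.I_sq - (ρ : ℂ) ^ 2 *
        (Real.cos (ψ k) - Real.sin (ψ k) * I) ^ 2 * hvv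
    · simp only [map_mul, Complex.conj_ofReal, Complex.conj_I]
      linear_combination -q * ρ * v * I * (hcsC k) -
        q * ρ * v * (I * Real.sin (ψ k) ^ 2 + 2 * Real.sin (ψ k) * Real.cos (ψ k)) * Complex.I_sq
  have hcval : ∀ k, (c k).1 = mat (q * V k * I)
      (ρ * κ k * (Real.cos (ψ k) + Real.sin (ψ k) * I)) := by
    intro k
    have h1 := mat_mul_pow hq hvv (hcs k) (N k)
    rw [← hB' k, ← hW k, ← hU, ← hV] at h1
    change (_ * _ ^ N k : SL(2, ℝ)).1 = _
    rw [Matrix.SpecialLinearGroup.coe_mul, Matrix.SpecialLinearGroup.coe_pow, h1]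
    congr 1
    have e1 : (V k : ℂ) * Real.cos (ψ k) = κ k * Real.cos ω := by exact_mod_cast hVκ k
    have e2 : (U k : ℂ) * Real.sin (ψ k) = κ k * Real.sin ω := by exact_mod_cast hUκ k
    rw [hvc] at hvv
    linear_combination (ρ * v * (Real.cos (ψ k) + Real.sin (ψ k) * I)) * (e1 + I * e2) +
      ρ * κ k * (Real.cos (ψ k) + Real.sin (ψ k) * I) * hvv
  have f1 : (α : ℂ) * Real.sin θ = q * Real.cos ω := by
    rw [hα]; exact_mod_cast div_mul_cancel₀ _ hθ
  have f2 : (δ : ℂ) * Real.sin θ = ρ := by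
    rw [hδ]; exact_mod_cast div_mul_cancel₀ _ hθ
  have hB2 : B * B = -1 := slMat_sq hBdet (by simp)
  have hcdet : ∀ k, (q * V k) ^ 2 - (ρ * κ k) ^ 2 = 1 := by
    intro k
    have h := (c k).2
    rw [hcval, det_mat, Complex.normSq_apply, Complex.normSq_apply] at h
    simp [-Complex.ofReal_cos, -Complex.ofReal_sin] at h
    linear_combination h + (ρ * κ k) ^ 2 * hcs k
  have hc2 : ∀ k, c k * c k = -1 := by
    intro k
    refine Subtype.ext ?_
    rw [Matrix.SpecialLinearGroup.coe_mul, hcval, mat_mul]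
    change _ = -1
    rw [← mat_one, mat_neg]
    have h := hcdet k
    have h' : ((q : ℂ) * V k) ^ 2 - (ρ * κ k) ^ 2 = 1 := by exact_mod_cast h
    congr 1
    · simp only [map_mul, map_add, Complex.conj_ofReal, Complex.conj_I]
      linear_combination -h' + (q * V k : ℂ) ^ 2 * Complex.I_sq + (ρ * κ k : ℂ) ^ 2 * hcsC k -
        (ρ * κ k : ℂ) ^ 2 * (Real.sin (ψ k) : ℂ) ^ 2 * Complex.I_sq
    · simp only [map_mul, Complex.conj_ofReal, Complex.conj_I]
      ring
  have hcu : ∀ k, c k * rotation (.ofAdd ω) = rotation (.ofAdd ω) *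
      (B⁻¹ * (rotation (.ofAdd (ψ k)) * B * (rotation (.ofAdd (ψ k)))⁻¹)) ^ N k * B := by
    intro k
    have h1 := mat_pow_mul hq hvv (hcs k) (N k)
    rw [← hW k, ← hU, ← hV] at h1
    have hr : ((B⁻¹ * (rotation (.ofAdd (ψ k)) * B * (rotation (.ofAdd (ψ k)))⁻¹)) ^ N k * B).1 =
        mat (q * V k * I) (ρ * v * (Real.cos (ψ k) + Real.sin (ψ k) * I) *
          (V k * Real.cos (ψ k) - U k * Real.sin (ψ k) * I)) := by
      rw [Matrix.SpecialLinearGroup.coe_mul, Matrix.SpecialLinearGroup.coe_pow]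
      exact h1
    rw [mul_assoc (rotation _)]
    have hck := hcval k
    generalize c k = ck at hck
    generalize (B⁻¹ * _) ^ N k * B = R at hr
    refine Subtype.ext ?_
    rw [Matrix.SpecialLinearGroup.coe_mul, Matrix.SpecialLinearGroup.coe_mul, hr, hck, hrot,
      mat_mul, mat_mul]
    have e1 : (V k : ℂ) * Real.cos (ψ k) = κ k * Real.cos ω := by exact_mod_cast hVκ k
    have e2 : (U k : ℂ) * Real.sin (ψ k) = κ k * Real.sin ω := by exact_mod_cast hUκ k
    congr 1
    · simp only [map_zero]; ring
    · simp only [map_mul, map_add, Complex.conj_ofReal, Complex.conj_I]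
      rw [hvc] at hvv
      set e : ℂ := Real.cos (ψ k) + Real.sin (ψ k) * I
      linear_combination -ρ * κ k * e * hv - (Real.cos ω + Real.sin ω * I) * ρ * v * e *
        (e1 - I * e2) + (Real.cos ω + Real.sin ω * I) * ρ * v * e * κ k * hv -
        ρ * κ k * e * v * hvv
  have hcE : ∀ k, c k * rotation (.ofAdd (ψ k)) = flow α δ hαδ (.ofAdd (π - η k)) := by
    intro k
    refine Subtype.ext ?_
    rw [Matrix.SpecialLinearGroup.coe_mul, hcval, hrot, mat_mul, hflow, Real.cos_pi_sub,
      Real.sin_pi_sub, hcos, hsin]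
    have e1 : (V k : ℂ) * Real.cos (ψ k) = κ k * Real.cos ω := by exact_mod_cast hVκ k
    congr 1
    · simp only [map_zero]
      push_cast [-Complex.ofReal_cos, -Complex.ofReal_sin]
      linear_combination q * V k * Real.sin (ψ k) * Complex.I_sq + q * I * e1 - I * κ k * f1
    · simp only [map_mul, map_add, Complex.conj_ofReal, Complex.conj_I]
      push_cast [-Complex.ofReal_cos, -Complex.ofReal_sin]
      linear_combination ρ * κ k * hcsC k - ρ * κ k * Real.sin (ψ k) ^ 2 * Complex.I_sq - κ k * f2
  have hBE : B * (rotation (.ofAdd ω))⁻¹ = flow α δ hαδ (.ofAdd θ) := by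
    refine Subtype.ext ?_
    obtain ⟨h, e⟩ := rotation_apply ω
    rw [e, slMat_inv, slMat_mul, hflow]
    change mat _ _ = _
    have h3 : (Real.cos θ : ℂ) = q * Real.sin ω := by exact_mod_cast hθω
    congr 1
    · simp only [map_neg, map_zero, map_add, map_mul, Complex.conj_ofReal, Complex.conj_I]
      linear_combination -q * Real.sin ω * Complex.I_sq - h3 - I * f1
    · simp only [Complex.conj_conj]
      rw [hvc] at hvv
      linear_combination ρ * hvv - f2
  have hσc : ∀ g, Commute σ g := by
    rcases hσ with rfl | rfl
    exacts [Commute.one_left, neg_one_commute]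
  have hσ2 : σ * σ = 1 := by rcases hσ with rfl | rfl <;> simp
  obtain ⟨L, g, h1, h2⟩ := exists_labelling_of_rotations N rotation (flow α δ hαδ)
    neg_one_commute (by simp) hσc hσ2 (flow_pi _ _ _) (flow_pi _ _ _) hB2 hψ c
    (fun k => rfl) hc2 hcu hcE hBE
  exact ⟨L, α, δ, hαδ, g, h1, h2⟩

/-! ### The angles as functions of the distance -/

lemma continuous_chebyshev (N : ℕ) : Continuous fun y => chebyshev y N := by
  induction N with
  | zero => exact continuous_const
  | succ N ih =>
    simp only [chebyshev]
    fun_prop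

lemma chebyshev_le {y : ℝ} (hy : 0 ≤ y) (N : ℕ) :
    1 ≤ (chebyshev y N).2 ∧ (chebyshev y N).2 ≤ (chebyshev y N).1 := by
  induction N with
  | zero => simp [chebyshev]
  | succ N ih =>
    obtain ⟨h1, h2⟩ := ih
    simp only [chebyshev]
    constructor <;> nlinarith [mul_nonneg hy (zero_le_one.trans h1),
      mul_nonneg hy (zero_le_one.trans (h1.trans h2))]

lemma chebyshev_mono {y y' : ℝ} (hy : 0 ≤ y) (hyy : y ≤ y') (N : ℕ) :
    (chebyshev y N).1 ≤ (chebyshev y' N).1 ∧ (chebyshev y N).2 ≤ (chebyshev y' N).2 := by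
  induction N with
  | zero => simp [chebyshev]
  | succ N ih =>
    obtain ⟨h1, h2⟩ := ih
    obtain ⟨h3, h4⟩ := chebyshev_le hy N
    have h5 := zero_le_one.trans h3
    have h6 := h5.trans h4
    have h7 := h6.trans h1
    have h8 := h5.trans h2
    have h9 := hy.trans hyy
    simp only [chebyshev]
    constructor <;> gcongr

/-- The argument `ρ ^ 2 * sin ψ ^ 2` of the polynomials of `chebyshev`, in terms of `t = tan ψ`. -/
def halfChordSq (ρ t : ℝ) : ℝ := ρ ^ 2 * (t ^ 2 / (1 + t ^ 2))

/-- The quotient `U / V` at a band, in terms of `t = tan ψ`. -/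
def ratio (N : ℕ) (ρ t : ℝ) : ℝ :=
  (chebyshev (halfChordSq ρ t) N).1 / (chebyshev (halfChordSq ρ t) N).2

lemma halfChordSq_nonneg (ρ t : ℝ) : 0 ≤ halfChordSq ρ t := by
  unfold halfChordSq; positivity

lemma continuous_halfChordSq : Continuous fun x : ℝ × ℝ => halfChordSq x.1 x.2 := by
  unfold halfChordSq
  refine (continuous_fst.pow 2).mul (Continuous.div (by fun_prop) (by fun_prop) fun x => ?_)
  positivity

lemma continuous_ratio (N : ℕ) : Continuous fun x : ℝ × ℝ => ratio N x.1 x.2 := by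
  unfold ratio
  have h := (continuous_chebyshev N).comp continuous_halfChordSq
  refine h.fst.div h.snd fun x => ?_
  have := (chebyshev_le (halfChordSq_nonneg x.1 x.2) N).1
  exact (zero_lt_one.trans_le this).ne'

lemma one_le_ratio (N : ℕ) (ρ t : ℝ) : 1 ≤ ratio N ρ t := by
  obtain ⟨h1, h2⟩ := chebyshev_le (halfChordSq_nonneg ρ t) N
  exact (one_le_div (zero_lt_one.trans_le h1)).2 h2

lemma halfChordSq_mono (ρ : ℝ) {t t' : ℝ} (ht : 0 ≤ t) (h : t ≤ t') :
    halfChordSq ρ t ≤ halfChordSq ρ t' := by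
  unfold halfChordSq
  refine mul_le_mul_of_nonneg_left ?_ (sq_nonneg _)
  rw [div_le_div_iff₀ (by positivity) (by positivity)]
  nlinarith [mul_self_le_mul_self ht h]

lemma strictMonoOn_mul_ratio (N : ℕ) (ρ : ℝ) :
    StrictMonoOn (fun t => t * ratio N ρ t) (Set.Ici 0) := by
  intro t ht t' ht' htt
  rw [Set.mem_Ici] at ht ht'
  by_cases hρ : ρ = 0
  · subst hρ
    have : ∀ s, ratio N 0 s = ratio N 0 0 := fun s => by simp [ratio, halfChordSq]
    simp only [this t, this t']
    exact mul_lt_mul_of_pos_right htt (zero_lt_one.trans_le (one_le_ratio N 0 0))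
  -- by `chebyshev_sq` the square is a product of two increasing functions
  have key : ∀ s, ρ ^ 2 * (s * ratio N ρ s) ^ 2 = (1 + s ^ 2) * (1 + halfChordSq ρ s -
      ((chebyshev (halfChordSq ρ s) N).2 ^ 2)⁻¹) := by
    intro s
    have h1 := chebyshev_sq (halfChordSq ρ s) N
    have h2 : 0 < (chebyshev (halfChordSq ρ s) N).2 :=
      zero_lt_one.trans_le (chebyshev_le (halfChordSq_nonneg ρ s) N).1
    have h3 : ρ ^ 2 * s ^ 2 = (1 + s ^ 2) * halfChordSq ρ s := by
      unfold halfChordSq; field_simp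
    unfold ratio
    generalize (chebyshev (halfChordSq ρ s) N).1 = U at *
    generalize (chebyshev (halfChordSq ρ s) N).2 = V at *
    field_simp
    linear_combination U ^ 2 * h3 - (1 + s ^ 2) * h1
  have hpos : 0 < t' * ratio N ρ t' :=
    mul_pos (ht.trans_lt htt) (zero_lt_one.trans_le (one_le_ratio N ρ t'))
  refine lt_of_pow_lt_pow_left₀ 2 hpos.le ?_
  have hρ2 : 0 < ρ ^ 2 := by positivity
  refine lt_of_mul_lt_mul_left ?_ hρ2.le
  have hy := halfChordSq_mono ρ ht htt.le
  have h1 := (chebyshev_le (halfChordSq_nonneg ρ t) N).1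
  have hA : 1 + halfChordSq ρ t - ((chebyshev (halfChordSq ρ t) N).2 ^ 2)⁻¹ ≤
      1 + halfChordSq ρ t' - ((chebyshev (halfChordSq ρ t') N).2 ^ 2)⁻¹ := by
    have hV := (chebyshev_mono (halfChordSq_nonneg ρ t) hy N).2
    gcongr
  have hp : 0 < ρ ^ 2 * (t' * ratio N ρ t') ^ 2 := by positivity
  rw [key] at hp ⊢
  rw [key]
  have hA' := (pos_iff_pos_of_mul_pos hp).1 (by positivity)
  calc _ ≤ (1 + t ^ 2) * _ := mul_le_mul_of_nonneg_left hA (by positivity)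
    _ < _ := mul_lt_mul_of_pos_right (by gcongr) hA'

/-- The unique nonnegative root of a strictly increasing function depends continuously on the
function. -/
lemma continuous_root {X : Type*} [TopologicalSpace X] {F : X → ℝ → ℝ} {g : X → ℝ}
    (hF : ∀ t, 0 ≤ t → Continuous fun x => F x t) (hm : ∀ x, StrictMonoOn (F x) (Set.Ici 0))
    (hg : ∀ x, 0 ≤ g x) (h0 : ∀ x, F x (g x) = 0) : Continuous g := by
  rw [continuous_iff_continuousAt]
  intro x₀
  refine tendsto_order.2 ⟨fun a ha => ?_, fun b hb => ?_⟩
  · rcases lt_or_ge a 0 with h | h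
    · exact Eventually.of_forall fun x => h.trans_le (hg x)
    · have h1 : F x₀ a < 0 := by
        rw [← h0 x₀]; exact hm x₀ h (hg x₀) ha
      filter_upwards [(hF a h).continuousAt.eventually_lt continuousAt_const h1] with x hx
      rw [← h0 x] at hx
      exact ((hm x).lt_iff_lt h (hg x)).1 hx
  · have h := (hg x₀).trans hb.le
    have h1 : 0 < F x₀ b := by
      rw [← h0 x₀]; exact hm x₀ (hg x₀) h hb
    filter_upwards [continuousAt_const.eventually_lt (hF b h).continuousAt h1] with x hx
    rw [← h0 x] at hx
    exact ((hm x).lt_iff_lt (hg x) h).1 hx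

/-- The tangent `t` of half the angle at a band is a continuous function of `ρ` and of the value `T`
of `t * ratio N ρ t`. -/
lemma exists_tangent (N : ℕ) : ∃ τ : ℝ × ℝ → ℝ, Continuous τ ∧ (∀ x, 0 ≤ τ x) ∧
    ∀ ρ T, 0 ≤ T → τ (ρ, T) * ratio N ρ (τ (ρ, T)) = T := by
  have hc : ∀ ρ : ℝ, Continuous fun t => t * ratio N ρ t := fun ρ =>
    continuous_id.mul ((continuous_ratio N).comp (by fun_prop : Continuous fun t : ℝ => (ρ, t)))
  have h : ∀ x : ℝ × ℝ, ∃ t, 0 ≤ t ∧ t * ratio N x.1 t - max x.2 0 = 0 := by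
    intro x
    have h0 : (0 : ℝ) ≤ max x.2 0 := le_max_right _ _
    obtain ⟨t, ht, e⟩ := intermediate_value_Icc h0 (hc x.1).continuousOn
      (show max x.2 0 ∈ _ from ⟨by simp,
        le_mul_of_one_le_right h0 (one_le_ratio N x.1 _)⟩)
    exact ⟨t, ht.1, sub_eq_zero.2 e⟩
  choose τ h0 hτ using h
  refine ⟨τ, continuous_root (F := fun x t => t * ratio N x.1 t - max x.2 0) (fun t _ => ?_)
    (fun x => ?_) h0 hτ, h0, fun ρ T hT => ?_⟩
  · have := (continuous_ratio N).comp (by fun_prop : Continuous fun x : ℝ × ℝ => (x.1, t))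
    exact (continuous_const.mul this).sub (by fun_prop)
  · intro t ht t' ht' h
    exact sub_lt_sub_right (strictMonoOn_mul_ratio N x.1 ht ht' h) _
  · have := hτ (ρ, T)
    rwa [max_eq_left hT, sub_eq_zero] at this

/-- For every `ρ` there is a common value `T` at the three bands for which the angles add up to a
full turn; it depends continuously on `ρ`. -/
lemma exists_tangents (N : Fin 3 → ℕ) : ∃ (T : ℝ → ℝ) (t : Fin 3 → ℝ → ℝ), Continuous T ∧
    (∀ k, Continuous (t k)) ∧ (∀ ρ, 0 < T ρ) ∧ (∀ k ρ, 0 < t k ρ) ∧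
    (∀ k ρ, t k ρ * ratio (N k) ρ (t k ρ) = T ρ) ∧
    ∀ ρ, Real.arctan (t 0 ρ) + Real.arctan (t 1 ρ) + Real.arctan (t 2 ρ) = π := by
  choose τ hτc hτ0 hτ using fun k => exists_tangent (N k)
  have hinj : ∀ k ρ {x y : ℝ}, 0 ≤ x → 0 ≤ y → x * ratio (N k) ρ x < y * ratio (N k) ρ y → x < y :=
    fun k ρ x y hx hy h => ((strictMonoOn_mul_ratio (N k) ρ).lt_iff_lt hx hy).1 h
  have hmono : ∀ k ρ {x y : ℝ}, 0 ≤ x → x < y → τ k (ρ, x) < τ k (ρ, y) := by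
    intro k ρ x y hx hxy
    refine hinj k ρ (hτ0 k _) (hτ0 k _) ?_
    rw [hτ k ρ x hx, hτ k ρ y (hx.trans hxy.le)]
    exact hxy
  let F : ℝ → ℝ → ℝ := fun ρ T => Real.arctan (τ 0 (ρ, T)) + Real.arctan (τ 1 (ρ, T)) +
    Real.arctan (τ 2 (ρ, T)) - π
  have hFc : Continuous fun x : ℝ × ℝ => F x.1 x.2 := by
    have := hτc 0
    have := hτc 1
    have := hτc 2
    simp only [F]
    fun_prop
  have hFm : ∀ ρ, StrictMonoOn (F ρ) (Set.Ici 0) := by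
    intro ρ x hx y hy hxy
    have h := fun k => Real.arctan_strictMono (hmono k ρ hx hxy)
    exact sub_lt_sub_right (add_lt_add (add_lt_add (h 0) (h 1)) (h 2)) _
  have hτz : ∀ k ρ, τ k (ρ, 0) = 0 := by
    intro k ρ
    have := hτ k ρ 0 le_rfl
    rcases mul_eq_zero.1 this with h | h
    · exact h
    · exact absurd h (zero_lt_one.trans_le (one_le_ratio _ _ _)).ne'
  have hFz : ∀ ρ, F ρ 0 = -π := fun ρ => by simp [F, hτz]
  have hex : ∀ ρ, ∃ T, 0 ≤ T ∧ F ρ T = 0 := by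
    intro ρ
    -- for this `M` every half-angle is at least `π / 3`
    set s : Fin 3 → ℝ := fun k => √3 * ratio (N k) ρ √3 with hs
    have hs0 : ∀ k, 0 ≤ s k := fun k =>
      mul_nonneg (Real.sqrt_nonneg _) (zero_le_one.trans (one_le_ratio _ _ _))
    set M := s 0 + s 1 + s 2 with hM
    have hsM : ∀ k, s k ≤ M := by
      have := hs0 0; have := hs0 1; have := hs0 2
      intro k; fin_cases k <;> simp only [hM] <;> dsimp <;> linarith
    have hM0 : 0 ≤ M := (hs0 0).trans (hsM 0)
    have h3 : ∀ k, π / 3 ≤ Real.arctan (τ k (ρ, M)) := by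
      intro k
      rw [← Real.arctan_sqrt_three]
      refine Real.arctan_strictMono.monotone (not_lt.1 fun h => ?_)
      have := strictMonoOn_mul_ratio (N k) ρ (hτ0 k _) (Real.sqrt_nonneg 3) h
      simp only [hτ k ρ M hM0] at this
      exact absurd this (not_lt.2 (hsM k))
    have hc : Continuous (F ρ) := hFc.comp (by fun_prop : Continuous fun T : ℝ => (ρ, T))
    obtain ⟨T, hT, e⟩ := intermediate_value_Icc hM0 hc.continuousOn (show (0 : ℝ) ∈ _ from
      ⟨by rw [hFz]; linarith [Real.pi_pos], by
        have := h3 0; have := h3 1; have := h3 2; simp only [F]; linarith⟩)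
    exact ⟨T, hT.1, e⟩
  choose T hT0 hT using hex
  have hTc : Continuous T := continuous_root
    (fun T _ => hFc.comp (by fun_prop : Continuous fun ρ : ℝ => (ρ, T))) hFm hT0 hT
  have hTp : ∀ ρ, 0 < T ρ := fun ρ => (hT0 ρ).lt_of_ne fun h => by
    have := hT ρ
    rw [← h, hFz] at this
    linarith [Real.pi_pos]
  refine ⟨T, fun k ρ => τ k (ρ, T ρ), hTc, fun k => (hτc k).comp (by fun_prop), hTp,
    fun k ρ => ?_, fun k ρ => hτ k ρ _ (hT0 ρ), fun ρ => sub_eq_zero.1 (hT ρ)⟩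
  have := hmono k ρ le_rfl (hTp ρ)
  rwa [hτz] at this

/-! ### The surgery slope -/

/-- The cosine of half the rotation angle of the meridian, for `T = tan ω`, where the meridian is
elliptic; otherwise the value is at least `1`. -/
def meridianCos (ρ T : ℝ) : ℝ := √(1 + ρ ^ 2) * Real.sin (Real.arctan T)

/-- The angle `η` of a band, which enters into the longitude. Where the meridian is not elliptic
`Real.arccos` clamps its angle, and hence `η`, to `0`. -/
def bandAngle (N : ℕ) (ρ T t : ℝ) : ℝ :=
  Real.arctan (ratio N ρ t * Real.tan (Real.arccos (meridianCos ρ T)))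

lemma meridianCos_pos (ρ : ℝ) {T : ℝ} (hT : 0 < T) : 0 < meridianCos ρ T := by
  have h : 0 < Real.sin (Real.arctan T) := Real.sin_arctan_pos.2 hT
  have : 0 < 1 + ρ ^ 2 := by positivity
  unfold meridianCos
  positivity

/-- The angles of a band satisfy the equations for `exists_labelling`. -/
lemma bandAngle_spec (N : ℕ) {ρ T t : ℝ} (hT : 0 < T) (ht : 0 < t) (htT : t * ratio N ρ t = T)
    (hc : meridianCos ρ T < 1) {U V : ℝ}
    (hU : U = (chebyshev (ρ ^ 2 * Real.sin (Real.arctan t) ^ 2) N).1)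
    (hV : V = (chebyshev (ρ ^ 2 * Real.sin (Real.arctan t) ^ 2) N).2) :
    ∃ κ : ℝ, V * Real.cos (Real.arctan t) = κ * Real.cos (Real.arctan T) ∧
      U * Real.sin (Real.arctan t) = κ * Real.sin (Real.arctan T) ∧
      Real.cos (bandAngle N ρ T t) = √(1 + ρ ^ 2) * V * Real.sin (Real.arctan t) ∧
      Real.sin (bandAngle N ρ T t) = κ * Real.sin (Real.arccos (meridianCos ρ T)) := by
  have hy : ρ ^ 2 * Real.sin (Real.arctan t) ^ 2 = halfChordSq ρ t := by
    rw [Real.sin_sq_arctan]; rfl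
  have hV0 : 0 < V := by
    rw [hV, hy]; exact zero_lt_one.trans_le (chebyshev_le (halfChordSq_nonneg ρ t) N).1
  have hR : ratio N ρ t = U / V := by rw [hU, hV, hy]; rfl
  have hUV : (1 + ρ ^ 2 * Real.sin (Real.arctan t) ^ 2) * V ^ 2 -
      ρ ^ 2 * Real.sin (Real.arctan t) ^ 2 * U ^ 2 = 1 := by
    rw [hU, hV]; exact chebyshev_sq _ _
  have hC : 0 < Real.cos (Real.arctan T) := Real.cos_arctan_pos T
  have hc' : 0 < Real.cos (Real.arctan t) := Real.cos_arctan_pos t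
  have hS : Real.sin (Real.arctan T) = T * Real.cos (Real.arctan T) := by
    rw [← Real.tan_mul_cos hC.ne', Real.tan_arctan]
  have hs : Real.sin (Real.arctan t) = t * Real.cos (Real.arctan t) := by
    rw [← Real.tan_mul_cos hc'.ne', Real.tan_arctan]
  have hCS := Real.cos_sq_add_sin_sq (Real.arctan T)
  have hcs := Real.cos_sq_add_sin_sq (Real.arctan t)
  have hS0 : 0 < Real.sin (Real.arctan T) := Real.sin_arctan_pos.2 hT
  have hs0 : 0 < Real.sin (Real.arctan t) := Real.sin_arctan_pos.2 ht
  have hm0 := meridianCos_pos ρ hT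
  have hθc : Real.cos (Real.arccos (meridianCos ρ T)) = meridianCos ρ T :=
    Real.cos_arccos (by linarith) hc.le
  have hθs : 0 < Real.sin (Real.arccos (meridianCos ρ T)) := by
    rw [Real.sin_arccos]
    exact Real.sqrt_pos.2 (by nlinarith)
  have hθ1 := Real.cos_sq_add_sin_sq (Real.arccos (meridianCos ρ T))
  have hm : meridianCos ρ T = √(1 + ρ ^ 2) * Real.sin (Real.arctan T) := rfl
  have hq2 : √(1 + ρ ^ 2) ^ 2 = 1 + ρ ^ 2 := Real.sq_sqrt (by positivity)
  have hq0 : 0 < √(1 + ρ ^ 2) := Real.sqrt_pos.2 (by positivity)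
  have hTU : t * U = T * V := by rw [← htT, hR]; field_simp
  have htan : Real.tan (bandAngle N ρ T t) = U / V * Real.tan (Real.arccos (meridianCos ρ T)) := by
    rw [bandAngle, Real.tan_arctan, hR]
  have hb0 : 0 < Real.cos (bandAngle N ρ T t) := Real.cos_arctan_pos _
  rw [Real.tan_eq_sin_div_cos, Real.tan_eq_sin_div_cos, hθc] at htan
  have hb1 := Real.cos_sq_add_sin_sq (bandAngle N ρ T t)
  rw [hθc] at hθ1
  generalize Real.sin (Real.arccos (meridianCos ρ T)) = sθ at *
  rw [hm] at htan hθ1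
  generalize Real.sin (bandAngle N ρ T t) = sη at *
  generalize Real.cos (bandAngle N ρ T t) = cη at *
  generalize √(1 + ρ ^ 2) = q at *
  generalize Real.sin (Real.arctan T) = S at *
  generalize Real.cos (Real.arctan T) = C at *
  generalize Real.sin (Real.arctan t) = s at *
  generalize Real.cos (Real.arctan t) = c at *
  have e1 : V * c = V * c / C * C := (div_mul_cancel₀ _ hC.ne').symm
  have e2 : U * s = V * c / C * S := by
    rw [hS, hs]; field_simp; linear_combination hTU
  generalize V * c / C = κ at e1 e2
  have hx : 0 < q * V * s := by positivity
  -- both pairs lie on the unit circle and have the same slope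
  have hxy : (q * V * s) ^ 2 + (κ * sθ) ^ 2 = 1 := by
    have hk : κ ^ 2 = V ^ 2 * c ^ 2 + U ^ 2 * s ^ 2 := by
      linear_combination (-κ ^ 2) * hCS - (V * c + κ * C) * e1 - (U * s + κ * S) * e2
    linear_combination hUV + κ ^ 2 * hθ1 + hk + V ^ 2 * hcs +
      q ^ 2 * (U * s + κ * S) * e2 + (V ^ 2 * s ^ 2 - U ^ 2 * s ^ 2) * hq2
  have hslope : sη * (q * V * s) = κ * sθ * cη := by
    have hU' : U = κ * S / s := by rw [← e2]; field_simp
    rw [hU'] at htan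
    field_simp at htan
    linear_combination htan
  have hcη : cη ^ 2 = (q * V * s) ^ 2 := by
    linear_combination (q * V * s) ^ 2 * hb1 - cη ^ 2 * hxy -
      (sη * (q * V * s) + κ * sθ * cη) * hslope
  have hcη' : cη = q * V * s := (pow_left_inj₀ hb0.le hx.le two_ne_zero).1 hcη
  refine ⟨κ, e1, e2, hcη', ?_⟩
  rw [hcη'] at hslope
  exact mul_right_cancel₀ hx.ne' hslope

lemma isElliptic_conj {x : SL(2, ℝ)} (hx : IsElliptic x) (g : SL(2, ℝ)) :
    IsElliptic (g⁻¹ * x * g) := by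
  have : (g⁻¹ * x * g).1.trace = x.1.trace := by
    rw [Matrix.SpecialLinearGroup.coe_mul, Matrix.trace_mul_comm,
      ← Matrix.SpecialLinearGroup.coe_mul, mul_inv_cancel_left]
  rw [IsElliptic, this]
  exact hx

lemma isElliptic_neg {x : SL(2, ℝ)} (hx : IsElliptic x) : IsElliptic (-x) := by
  rw [IsElliptic, Matrix.SpecialLinearGroup.coe_neg, Matrix.trace_neg]
  exact ⟨neg_lt_neg hx.2, neg_lt.1 hx.1⟩

/-- There is a labelling with elliptic meridian that kills the slope `m / l`: the total angle of
`μ ^ m λ ^ l` goes from the angle of `μ ^ m` at `ρ = 0` to `l π` at `ρ = 1` and takes in between a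
value `j π` with `j < l`. -/
theorem exists_labelling_of_slope (N : Fin 3 → ℕ) {m l : ℤ} (hl : 0 < l)
    (hm : m < 0 ∨ 0 < m ∧ m < l) (hodd : Odd m ∨ Odd l) :
    ∃ L : Labelling SL(2, ℝ) N, L.longitude ^ l * L.meridian ^ m = 1 ∧
      ∀ g, IsElliptic (g⁻¹ * L.meridian⁻¹ * g) := by
  obtain ⟨T, t, hTc, htc, hT, ht, htT, hψ⟩ := exists_tangents N
  set θ : ℝ → ℝ := fun ρ => Real.arccos (meridianCos ρ (T ρ)) with hθ
  set η : Fin 3 → ℝ → ℝ := fun k ρ => bandAngle (N k) ρ (T ρ) (t k ρ) with hη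
  set F : ℝ → ℝ := fun ρ => m * θ ρ + l * (π - 2 * (η 0 ρ + η 1 ρ + η 2 ρ)) with hF
  have hπ := Real.pi_pos
  have hcc : Continuous fun ρ => meridianCos ρ (T ρ) := by unfold meridianCos; fun_prop
  have hθc : Continuous θ := Real.continuous_arccos.comp hcc
  have hηc : ∀ k, Continuous (η k) := by
    intro k
    have h1 : Continuous fun ρ => ratio (N k) ρ (t k ρ) :=
      (continuous_ratio (N k)).comp (continuous_id.prodMk (htc k))
    have h2 : Continuous fun ρ => Real.tan (Real.arccos (meridianCos ρ (T ρ))) := by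
      simp only [Real.tan_arccos]
      exact (Real.continuous_sqrt.comp (by fun_prop)).div hcc fun ρ => (meridianCos_pos ρ (hT ρ)).ne'
    exact Real.continuous_arctan.comp (h1.mul h2)
  have hFc : Continuous F := by
    have := hηc 0
    have := hηc 1
    have := hηc 2
    simp only [hF]
    fun_prop
  -- at `ρ = 0` the longitude is trivial
  have hF0 : F 0 = m * θ 0 ∧ 0 < θ 0 ∧ θ 0 < π / 2 := by
    have h0 : θ 0 = π / 2 - Real.arctan (T 0) := by
      have : meridianCos 0 (T 0) = Real.cos (π / 2 - Real.arctan (T 0)) := by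
        simp [meridianCos, Real.cos_pi_div_two_sub]
      have h1 := Real.arctan_pos.2 (hT 0)
      have h2 := Real.arctan_lt_pi_div_two (T 0)
      change Real.arccos (meridianCos 0 (T 0)) = _
      rw [this]
      exact Real.arccos_cos (by linarith) (by linarith)
    have h1 : ∀ k, η k 0 = π / 2 - Real.arctan (t k 0) := by
      intro k
      have h2 : Real.tan (θ 0) = (T 0)⁻¹ := by
        rw [h0, Real.tan_pi_div_two_sub, Real.tan_arctan]
      have h3 : ratio (N k) 0 (t k 0) * (T 0)⁻¹ = (t k 0)⁻¹ := by
        have h4 := htT k 0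
        have h5 := (ht k 0).ne'
        have h6 := (hT 0).ne'
        field_simp
        linear_combination h4
      rw [← Real.arctan_inv_of_pos (ht k 0), ← h3, ← h2]
      rfl
    refine ⟨?_, ?_, ?_⟩
    · simp only [hF, h1]
      linear_combination 2 * (l : ℝ) * hψ 0
    · rw [h0]; linarith [Real.arctan_lt_pi_div_two (T 0)]
    · rw [h0]; linarith [Real.arctan_pos.2 (hT 0)]
  -- where the meridian is not elliptic its angle is clamped to `0`
  have hclamp : ∀ ρ, 1 ≤ meridianCos ρ (T ρ) → F ρ = l * π := by
    intro ρ h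
    have h0 : Real.arccos (meridianCos ρ (T ρ)) = 0 := Real.arccos_eq_zero.2 h
    simp [hF, hη, hθ, bandAngle, h0]
  have hF1 : F 1 = l * π := by
    refine hclamp 1 ?_
    have hT1 : 1 ≤ T 1 := by
      by_contra! hlt
      have h1 : ∀ k, Real.arctan (t k 1) < π / 4 := by
        intro k
        rw [← Real.arctan_one]
        refine Real.arctan_strictMono (lt_of_le_of_lt ?_ hlt)
        rw [← htT k 1]
        exact le_mul_of_one_le_right (ht k 1).le (one_le_ratio _ _ _)
      linarith [h1 0, h1 1, h1 2, hψ 1]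
    have h1 : Real.sin (π / 4) ≤ Real.sin (Real.arctan (T 1)) := by
      refine Real.sin_le_sin_of_le_of_le_pi_div_two (by linarith)
        (Real.arctan_lt_pi_div_two _).le ?_
      rw [← Real.arctan_one]
      exact Real.arctan_strictMono.monotone hT1
    have h2 : √(1 + 1 ^ 2) * Real.sin (π / 4) = 1 := by
      rw [Real.sin_pi_div_four]
      have := Real.mul_self_sqrt (show (0 : ℝ) ≤ 2 by norm_num)
      norm_num
      linarith
    refine h2.symm.trans_le ?_
    exact mul_le_mul_of_nonneg_left h1 (Real.sqrt_nonneg _)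
  have hl' : (0 : ℝ) < l := by exact_mod_cast hl
  obtain ⟨j, hj, hjl, hpar⟩ : ∃ j : ℤ, F 0 ≤ j * π ∧ j < l ∧ (Odd j → Odd m) := by
    obtain ⟨e, h1, h2⟩ := hF0
    rcases hm with h | ⟨h, h'⟩
    · have : (m : ℝ) < 0 := by exact_mod_cast h
      refine ⟨0, ?_, hl, by simp⟩
      rw [e]
      push_cast
      nlinarith
    · have h3 : (0 : ℝ) < m := by exact_mod_cast h
      have h4 : (m : ℝ) ≤ (l - 1 : ℤ) := by exact_mod_cast Int.le_sub_one_of_lt h'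
      refine ⟨l - 1, ?_, by omega, fun ho => hodd.resolve_right fun h5 => ?_⟩
      · rw [e]
        nlinarith
      · have := ho.add_odd odd_one
        rw [sub_add_cancel] at this
        exact (Int.not_even_iff_odd.2 h5) this
  have hjl' : (j : ℝ) * π < l * π := mul_lt_mul_of_pos_right (by exact_mod_cast hjl) hπ
  -- the solution has `F ρ ≠ l * π`, so that the meridian is elliptic there
  obtain ⟨ρ, -, hρ⟩ := intermediate_value_Icc zero_le_one hFc.continuousOn
    (show (j : ℝ) * π ∈ _ from ⟨hj, by rw [hF1]; exact hjl'.le⟩)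
  have hc1 : meridianCos ρ (T ρ) < 1 := by
    by_contra! h
    rw [hclamp ρ h] at hρ
    exact hjl'.ne' hρ
  have hc0 := meridianCos_pos ρ (hT ρ)
  have hcθ : Real.cos (θ ρ) = meridianCos ρ (T ρ) := Real.cos_arccos (by linarith) hc1.le
  have hsθ : Real.sin (θ ρ) ≠ 0 := by
    rw [hθ, Real.sin_arccos]
    exact (Real.sqrt_pos.2 (by nlinarith)).ne'
  choose κ h1 h2 h3 h4 using fun k => bandAngle_spec (N k) (hT ρ) (ht k ρ) (htT k ρ) hc1 rfl rfl
  -- the sign of the meridian makes up for the sign `(-1) ^ j`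
  obtain ⟨σ, hσ, hσm⟩ : ∃ σ : SL(2, ℝ), (σ = 1 ∨ σ = -1) ∧
      ∀ (α δ h), flow α δ h (.ofAdd (j * π)) * (σ * -1) ^ m = 1 := by
    have hj' : ∀ α δ h, flow α δ h (.ofAdd (j * π)) = (-1) ^ j := by
      intro α δ h
      rw [← zsmul_eq_mul, ofAdd_zsmul, map_zpow, flow_pi]
    rcases Int.even_or_odd j with h | h
    · refine ⟨-1, Or.inr rfl, fun α δ h' => ?_⟩
      rw [hj', h.neg_one_zpow]
      simp
    · refine ⟨1, Or.inl rfl, fun α δ h' => ?_⟩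
      rw [hj', h.neg_one_zpow, one_mul, (hpar h).neg_one_zpow]
      simp
  obtain ⟨L, α, δ, h, g, hmer, hlon⟩ := exists_labelling N
    (Real.sq_sqrt (by positivity : 0 ≤ 1 + ρ ^ 2)) hsθ hcθ (fun _ => rfl) (fun _ => rfl)
    h1 h2 h3 h4 (hψ ρ) hσ
  have hcomm : ∀ x, Commute (σ * -1) x := fun x => by
    rcases hσ with rfl | rfl
    · rw [one_mul]; exact neg_one_commute x
    · simp
  refine ⟨L, ?_, fun x => ?_⟩
  · have hconj : ∀ (x y : SL(2, ℝ)) (n : ℤ), (x⁻¹ * y * x) ^ n = x⁻¹ * y ^ n * x := by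
      intro x y n
      have := conj_zpow (a := x⁻¹) (b := y) (i := n)
      rwa [inv_inv] at this
    have hflow : ∀ (n : ℤ) (s : ℝ), flow α δ h (.ofAdd s) ^ n = flow α δ h (.ofAdd (n * s)) :=
      fun n s => by rw [← map_zpow, ← ofAdd_zsmul, zsmul_eq_mul]
    have e : F ρ = l * (π - 2 * (η 0 ρ + η 1 ρ + η 2 ρ)) + m * θ ρ := add_comm _ _
    rw [hmer, hlon, hconj, hconj, (hcomm _).mul_zpow, hflow, hflow]
    have := hσm α δ h
    rw [← hρ, e, ofAdd_add, map_mul] at this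
    have hgrp : ∀ a s b : SL(2, ℝ), g⁻¹ * a * g * (g⁻¹ * (s * b) * g) = g⁻¹ * (a * (s * b)) * g :=
      fun a s b => by group
    rw [hgrp, ((hcomm _).zpow_left m).eq, ← mul_assoc (flow α δ h _)]
    exact (congrArg (g⁻¹ * · * g) this).trans (by group)
  · have hinv : (σ * -1 * flow α δ h (.ofAdd (θ ρ)))⁻¹ =
        σ * -1 * flow α δ h (.ofAdd (-θ ρ)) := by
      rw [ofAdd_neg, map_inv]
      rcases hσ with rfl | rfl <;> simp
    have hx : x⁻¹ * L.meridian⁻¹ * x =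
        (g * x)⁻¹ * (σ * -1 * flow α δ h (.ofAdd (-θ ρ))) * (g * x) := by
      rw [hmer, ← hinv]; group
    rw [hx]
    refine isElliptic_conj ?_ _
    have hf : IsElliptic (flow α δ h (.ofAdd (-θ ρ))) := by
      change (mat _ _).trace ∈ _
      rw [trace_mat]
      have h5 : (Real.cos (-θ ρ) + I * (α * Real.sin (-θ ρ)) : ℂ).re = meridianCos ρ (T ρ) := by
        rw [← hcθ, ← Real.cos_neg]
        simp [-Complex.ofReal_cos, -Complex.ofReal_sin]
      exact ⟨by rw [toAdd_ofAdd, h5]; linarith, by rw [toAdd_ofAdd, h5]; linarith⟩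
    rcases hσ with rfl | rfl
    · rw [one_mul, neg_one_mul]; exact isElliptic_neg hf
    · rw [neg_one_mul, neg_neg, one_mul]; exact hf

end PretzelSurgery

end

theorem proposition3p1 (a : Fin 3 → ℕ) (ha : ∀ i, Odd (a i))
    (m l p q : ℤ) (hpq : l * p - m * q = 1)
    (hml : (m : ℚ) / (l : ℚ) ∈ Set.Iio (0 : ℚ) ∪ Set.Ioo (0 : ℚ) 1)
    (x₀ : PretzelSurgery.boundaryTorus (PretzelSurgery.pretzelTube a)) :
    ∃ ρ : FundamentalGroup (PretzelSurgery.DehnSurgery (PretzelSurgery.pretzelTube a) m l p q)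
          (PretzelSurgery.boundaryInclusion (PretzelSurgery.pretzelTube a) m l p q x₀) →*
        SL(2, ℝ),
      PretzelSurgery.IsEllipticRep (ρ.comp (FundamentalGroup.map
        (PretzelSurgery.boundaryInclusion (PretzelSurgery.pretzelTube a) m l p q) x₀)) := by
  choose N hN using ha
  obtain rfl : a = PretzelSurgery.halfTwists N := funext hN
  have hodd : Odd m ∨ Odd l := by
    by_contra! h
    simp only [Int.not_odd_iff_even] at h
    have := (h.2.mul_right p).sub (h.1.mul_right q)
    rw [hpq] at this
    exact absurd this (by decide)
  have hsign : ∃ m' l' : ℤ, 0 < l' ∧ (m' < 0 ∨ 0 < m' ∧ m' < l') ∧ (Odd m' ∨ Odd l') ∧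
      ((m' = m ∧ l' = l) ∨ (m' = -m ∧ l' = -l)) := by
    rcases lt_trichotomy l 0 with hl | rfl | hl
    · refine ⟨-m, -l, by omega, ?_, by simpa using hodd, Or.inr ⟨rfl, rfl⟩⟩
      have hl' : (l : ℚ) < 0 := by exact_mod_cast hl
      rcases hml with h | ⟨h, h'⟩
      · rw [Set.mem_Iio, div_lt_iff_of_neg hl', zero_mul] at h
        exact Or.inl (by simpa using h)
      · rw [lt_div_iff_of_neg hl', zero_mul] at h
        rw [div_lt_iff_of_neg hl', one_mul] at h'
        exact Or.inr ⟨by simpa using h, by simpa using h'⟩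
    · simp at hml
    · refine ⟨m, l, hl, ?_, hodd, Or.inl ⟨rfl, rfl⟩⟩
      have hl' : (0 : ℚ) < l := by exact_mod_cast hl
      rcases hml with h | ⟨h, h'⟩
      · rw [Set.mem_Iio, div_lt_iff₀ hl', zero_mul] at h
        exact Or.inl (by simpa using h)
      · rw [lt_div_iff₀ hl', zero_mul] at h
        rw [div_lt_iff₀ hl', one_mul] at h'
        exact Or.inr ⟨by simpa using h, by simpa using h'⟩
  obtain ⟨m', l', hl, hm, ho, hs⟩ := hsign
  obtain ⟨L, hL, hell⟩ := PretzelSurgery.exists_labelling_of_slope N hl hm ho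
  have hL' : L.longitude ^ l * L.meridian ^ m = 1 := by
    rcases hs with ⟨rfl, rfl⟩ | ⟨rfl, rfl⟩
    · exact hL
    · rw [zpow_neg, zpow_neg, ← mul_inv_rev, inv_eq_one] at hL
      exact mul_eq_one_iff_eq_inv'.2 (eq_inv_of_mul_eq_one_left hL)
  obtain ⟨ρ, g, hg⟩ := PretzelSurgery.exists_rep_of_labelling L (p := p) (q := q) hL' x₀
  exact ⟨ρ, _, hg, hell g⟩
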